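/- Let $n\ge 1$ and let $H\colon\mathbb{R}^{n}\times\mathbb{R}^n\to\mathbb{R}$, $(q,p)\mapsto H(q,p)$, be of class $C^2$ and of classical type: $H(q,\cdot)$ is even for every $q$, and there is a continuous function $\nu\colon\mathbb{R}^n\to\,]0,\infty[$ with $\frac{\partial^2H}{\partial p^2}(q,p)[\xi,\xi]\ge\nu(q)\|\xi\|^2$ for all $q,p,\xi\in\mathbb{R}^n$. Put $V(q)=H(q,0)$. Let $E\in\mathbb{R}$ and let $D\subset\mathbb{R}^n$ be a potential well, that is, an open set with $C^2$ boundary such that $V<E$ on $D$, and $V=E$ and $\nabla V\neq0$ on $\partial D$. Assume that $\overline D$ is compact. For $q\in D$ let $U(q,\cdot)\colon\mathbb{R}^n\to\mathbb{R}$ be the function that is homogeneous of degree $2$ and equal to $1$ on $\{p: H(q,p)=E\}$, that is, the square of the Minkowski gauge of the convex body $\{p: H(q,p)\le E\}$; let $G(q,v)=\max_{p}\big(\langle v,p\rangle-U(q,p)\big)$ for $q\in D$, and $G(q,v)=0$ for $q\in\partial D$. For $\gamma\in W^{1,2}([0,1],\overline D)$ let $\mathcal{J}(\gamma)=\int_0^1G(\gamma(s),\dot\gamma(s))\,ds$.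 For $y\in D$ let $X_y$ be the set of $\gamma\in W^{1,2}([0,1],\overline D)$ with $\gamma(0)=y$, $\gamma([0,1[)\subset D$ and $\gamma(1)\in\partial D$, and let $\psi(y)=\inf_{\gamma\in X_y}\mathcal{J}(\gamma)$. For $\delta>0$ put $D_\delta=\{y\in D:\operatorname{dist}(y,\partial D)\le\delta\}$, with the Euclidean distance. Then there is $\delta_0>0$ such that for every $\bar\delta\in\,]0,\delta_0]$ the following hold. 1. For every $y\in D_{\bar\delta}$ there are a unique $t_y>0$ and a unique solution $(q_y,p_y)\colon[0,t_y]\to\mathbb{R}^{2n}$ of Hamilton's equations $\dot q=\partial H/\partial p$, $\dot p=-\partial H/\partial q$ with energy $E$ such that $q_y(0)\in\partial D$, $q_y(t_y)=y$ and $\operatorname{dist}(q_y(t),\partial D)\le\bar\delta$ for all $t\in[0,t_y]$. 2. For every $y\in D_{\bar\delta}$ the functional $\mathcal{J}$ has a unique minimizer $\gamma_y$ on $X_y$; the one-sided derivative $\dot\gamma_y(0)$ exists, $G(y,\cdot)$ is differentiable at $\dot\gamma_y(0)$, and $\psi$ is differentiable at $y$ with $$d\psi(y)[\xi]=-\frac{\partial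 G}{\partial v}(y,\dot\gamma_y(0))[\xi]\qquad\text{for all }\xi\in\mathbb{R}^n.$$ 3. There is a function $\varphi\colon \mathbb{R}^n\times\mathbb{R}^n\to\mathbb{R}$, of class $C^1$ near every point of $D_{\bar\delta}\times\mathbb{R}^n$, such that for all $y\in D_{\bar\delta}$ $$\sqrt{\psi(y)}\;\varphi(y,\dot q_y(t_y))\,\dot q_y(t_y)=-\dot\gamma_y(0).$$ 4. $\psi$ is of class $C^2$ in a neighbourhood of every point of $D_{\bar\delta}$. -/

import Mathlib

open Set Filter Topology MeasureTheory

noncomputable section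

namespace BrakeOrbits

/-- Euclidean space `ℝⁿ`. -/
abbrev Vec (n : ℕ) : Type := EuclideanSpace ℝ (Fin n)

/-- `H(q, p)` is a Hamiltonian of class `C²` and of classical type: it is even in `p`, and
`∂²H/∂p²(q, p)[ξ, ξ] ≥ ν(q) ‖ξ‖²` for some continuous positive function `ν`. -/
structure IsClassicalHamiltonian {n : ℕ} (H : Vec n → Vec n → ℝ) : Prop where
  contDiff : ContDiff ℝ 2 (fun z : Vec n × Vec n => H z.1 z.2)
  even : ∀ q p, H q (-p) = H q p
  posDef : ∃ ν : Vec n → ℝ, Continuous ν ∧ (∀ q, 0 < ν q) ∧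
    ∀ q p ξ, ν q * ‖ξ‖ ^ 2 ≤ fderiv ℝ (fderiv ℝ (H q)) p ξ ξ

/-- The potential energy `V(q) = H(q, 0)`. -/
def potential {n : ℕ} (H : Vec n → Vec n → ℝ) (q : Vec n) : ℝ := H q 0

/-- The boundary of `D` is of class `C²`: near each boundary point, `D` is the strict sublevel
set of a `C²` function with nonvanishing differential. -/
def HasC2Boundary {n : ℕ} (D : Set (Vec n)) : Prop :=
  ∀ Q ∈ frontier D, ∃ g : Vec n → ℝ,
    ContDiffAt ℝ 2 g Q ∧ g Q = 0 ∧ fderiv ℝ g Q ≠ 0 ∧ ∀ᶠ x in 𝓝 Q, (x ∈ D ↔ g x < 0)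

/-- `D` is a potential well for `H` at the energy level `E`. -/
structure IsPotentialWell {n : ℕ} (H : Vec n → Vec n → ℝ) (E : ℝ) (D : Set (Vec n)) :
    Prop where
  isOpen : IsOpen D
  boundary : HasC2Boundary D
  potential_lt : ∀ q ∈ D, potential H q < E
  potential_eq : ∀ q ∈ frontier D, potential H q = E
  gradient_ne_zero : ∀ q ∈ frontier D, gradient (potential H) q ≠ 0

/-- `(q, p) : [0, T] → ℝ²ⁿ` solves `q' = ∂H/∂p(q, p)`, `p' = -∂H/∂q(q, p)`
(with one-sided derivatives at the endpoints). -/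
def IsHamiltonSolution {n : ℕ} (H : Vec n → Vec n → ℝ) (T : ℝ) (q p : ℝ → Vec n) : Prop :=
  ∀ t ∈ Icc 0 T,
    HasDerivWithinAt q (gradient (fun x => H (q t) x) (p t)) (Icc 0 T) t ∧
    HasDerivWithinAt p (-(gradient (fun x => H x (p t)) (q t))) (Icc 0 T) t

/-- For `q ∈ D`, the function `U(q, ·)` is homogeneous of degree `2` and equal to `1` exactly on
the energy surface `{p | H(q, p) = E}`. As this surface bounds the convex body
`{p | H(q, p) ≤ E}`, which has `0` in its interior, `U(q, ·)` is the square of the Minkowski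
gauge of that body. -/
def levelHamiltonian {n : ℕ} (H : Vec n → Vec n → ℝ) (E : ℝ) (q p : Vec n) : ℝ :=
  gauge {x : Vec n | H q x ≤ E} p ^ 2

open Classical in
/-- `G(q, v) = max_p (⟨v, p⟩ - U(q, p))` for `q ∈ D`, the square of the Jacobi-Finsler metric,
extended by `0` to the boundary of `D`. -/
def jacobiFinsler {n : ℕ} (H : Vec n → Vec n → ℝ) (E : ℝ) (D : Set (Vec n))
    (q v : Vec n) : ℝ :=
  if q ∈ D then ⨆ p : Vec n, (inner ℝ v p - levelHamiltonian H E q p) else 0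

/-- `W^{1,2}([0, 1], A)`: absolutely continuous curves in `A` with square integrable derivative.
Curves are functions on `ℝ` of which only the restriction to `[0, 1]` matters. -/
def SobolevCurves {n : ℕ} (A : Set (Vec n)) : Set (ℝ → Vec n) :=
  {γ | MapsTo γ (Icc 0 1) A ∧ AbsolutelyContinuousOnInterval γ 0 1 ∧
    MemLp (deriv γ) 2 (volume.restrict (Icc 0 1))}

/-- The energy functional `𝒥(γ) = ∫₀¹ G(γ, γ') ds`. -/
def energy {n : ℕ} (H : Vec n → Vec n → ℝ) (E : ℝ) (D : Set (Vec n)) (γ : ℝ → Vec n) : ℝ :=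
  ∫ s in (0 : ℝ)..1, jacobiFinsler H E D (γ s) (deriv γ s)

/-- The set `X_y` of curves which start at `y`, lie in `D` on `[0, 1)`, and end on `∂D`. -/
def curvesToBoundary {n : ℕ} (D : Set (Vec n)) (y : Vec n) : Set (ℝ → Vec n) :=
  {γ | γ ∈ SobolevCurves (closure D) ∧ γ 0 = y ∧ (∀ s ∈ Ico (0 : ℝ) 1, γ s ∈ D) ∧
    γ 1 ∈ frontier D}

/-- `ψ(y) = inf_{γ ∈ X_y} 𝒥(γ)`. -/
def boundaryEnergy {n : ℕ} (H : Vec n → Vec n → ℝ) (E : ℝ) (D : Set (Vec n))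
    (y : Vec n) : ℝ :=
  sInf (energy H E D '' curvesToBoundary D y)

/-- `γ` minimizes `𝒥` on `X_y`. -/
def IsMinimizer {n : ℕ} (H : Vec n → Vec n → ℝ) (E : ℝ) (D : Set (Vec n)) (y : Vec n)
    (γ : ℝ → Vec n) : Prop :=
  γ ∈ curvesToBoundary D y ∧ IsMinOn (energy H E D) (curvesToBoundary D y) γ

/-- `D_δ`, the set of points of `D` at Euclidean distance at most `δ` from `∂D`. -/
def collar {n : ℕ} (D : Set (Vec n)) (δ : ℝ) : Set (Vec n) :=
  {y | y ∈ D ∧ Metric.infDist y (frontier D) ≤ δ}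

/-- `(q, p)` solves Hamilton's equations on `[0, T]`, `T > 0`, with energy `E`, starts on `∂D`,
arrives at `y` at time `T`, and stays at distance at most `δ` from `∂D`. -/
structure IsCollarSolution {n : ℕ} (H : Vec n → Vec n → ℝ) (E : ℝ) (D : Set (Vec n)) (δ : ℝ)
    (y : Vec n) (T : ℝ) (q p : ℝ → Vec n) : Prop where
  time_pos : 0 < T
  solution : IsHamiltonSolution H T q p
  energy_eq : ∀ t ∈ Icc 0 T, H (q t) (p t) = E
  start : q 0 ∈ frontier D
  arrive : q T = y
  near : ∀ t ∈ Icc 0 T, Metric.infDist (q t) (frontier D) ≤ δ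

/-- Every point `y` of the collar `D_δ` is reached from `∂D` inside the collar by a unique
solution, at a unique time. -/
def CollarProperty {n : ℕ} (H : Vec n → Vec n → ℝ) (E : ℝ) (D : Set (Vec n)) (δ : ℝ) : Prop :=
  ∀ y ∈ collar D δ, ∃ (T : ℝ) (q p : ℝ → Vec n), IsCollarSolution H E D δ y T q p ∧
    ∀ (T' : ℝ) (q' p' : ℝ → Vec n), IsCollarSolution H E D δ y T' q' p' →
      T' = T ∧ EqOn q' q (Icc 0 T) ∧ EqOn p' p (Icc 0 T)

end BrakeOrbits

end

/-! A solution of energy `E` can touch the boundary only at rest: there `V = E`, and `p = 0` is the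
only momentum of that energy by strict convexity and evenness. So everything is governed by the
orbits `q(t, x)` released at rest from `x ∈ ∂D`. Their initial velocity vanishes and their initial
acceleration `a = -∂²H/∂p² ∇V` satisfies `⟨∇V, a⟩ < 0`, so `q(t, x) = x + t²/2 a + o(t²)` enters
`D`. The map degenerates at `t = 0`, but in the variable `r = t²`, reflected to `r < 0`, it is
strictly differentiable (`IsRestFlow.hasStrictFDerivAt_unfold`). The inverse function theorem and
compactness of `∂D` then give coordinates `(t, x)` on a collar
(`IsPotentialWell.exists_collarChart`), in which the distance to `∂D` increases along orbits. This
is the first claim.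

Let `S(y) = ∫ ⟨p, q'⟩` be the action along the orbit from `∂D` to `y`, and `P(y)` the momentum on
arrival. Because all orbits have the same energy and start with `p = 0`, `S` has gradient `P`
(`IsCollarChart.hasFDerivAt_chartAction`). The flow is only `C¹`, but so is `P`, and therefore `S`
is `C²`.

Let `σ(q, ·)` be the support function of `{H(q, ·) ≤ E}`; then `G = σ²/4`. Since `H(y, P(y)) = E`,
the differential `dS = ⟨P, ·⟩` is a calibration: `-⟨P, v⟩ ≤ σ(y, v)`. Integrating along a curve in
`X_y`, from the last time at which it is on the level of `S(y)`, gives `∫ σ ≥ S(y)`, and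
Cauchy–Schwarz gives `𝒥 ≥ S(y)²/4` (`IsCollarChart.energy_bound`). The orbit through `y`, run
backwards so that `S` decreases linearly, attains this value. Equality forces `σ = S(y)` almost
everywhere, and forces `-γ'` to be a multiple of `∂H/∂p` at `P`, so the curve stays on the orbit:
the minimizer is unique.

Hence `ψ = S²/4` near the collar, which gives claim 4, and `dψ = (S/2) ⟨P, ·⟩`. The initial velocity
of the minimizer is `-(S / ⟨∂H/∂p, P⟩) ∂H/∂p`, which gives claim 2 by the envelope formula for `σ`,
and claim 3 with `φ = 2 / ⟨∂H/∂p, P⟩`. -/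

/-! ### Differentiable dependence of the local flow on initial conditions -/

section Flow

variable {E F : Type*} [NormedAddCommGroup E] [NormedSpace ℝ E]
  [NormedAddCommGroup F] [NormedSpace ℝ F]

/-- A continuous field of linear maps acts on continuous functions. -/
noncomputable def pointwiseApply (I : Type*) [TopologicalSpace I] [CompactSpace I] :
    C(I, E →L[ℝ] F) →L[ℝ] C(I, E) →L[ℝ] C(I, F) :=
  LinearMap.mkContinuous₂
    (LinearMap.mk₂ ℝ
      (fun (A : C(I, E →L[ℝ] F)) (h : C(I, E)) =>
        (⟨fun s => A s (h s), A.continuous.clm_apply h.continuous⟩ : C(I, F)))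
      (fun A B h => by ext s; simp) (fun c A h => by ext s; simp)
      (fun A h k => by ext s; simp) (fun c A h => by ext s; simp)) 1
    (fun A h => by
      refine (ContinuousMap.norm_le _ (by positivity)).2 fun s => ?_
      simp only [LinearMap.mk₂_apply, ContinuousMap.coe_mk, one_mul]
      exact ((A s).le_opNorm _).trans (mul_le_mul (A.norm_coe_le_norm s) (h.norm_coe_le_norm s)
        (norm_nonneg _) (norm_nonneg A)))

@[simp] theorem pointwiseApply_apply {I : Type*} [TopologicalSpace I] [CompactSpace I]
    (A : C(I, E →L[ℝ] F)) (h : C(I, E)) (s : I) : pointwiseApply I A h s = A s (h s) := rfl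

/-- Superposition with a `C¹` map is a `C¹` operation on continuous functions. -/
theorem ContDiff.superposition {X : E → F} (hX : ContDiff ℝ 1 X) (I : Type*)
    [TopologicalSpace I] [CompactSpace I] :
    ContDiff ℝ 1 (fun u : C(I, E) => (⟨X, hX.continuous⟩ : C(E, F)).comp u) := by
  obtain ⟨hd, hc⟩ := contDiff_one_iff_fderiv.1 hX
  rw [contDiff_one_iff_hasFDerivAt]
  set X' : C(E, E →L[ℝ] F) := ⟨fderiv ℝ X, hc⟩ with hX'
  have hcomp : Continuous fun u : C(I, E) => X'.comp u := ContinuousMap.continuous_postcomp X'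
  refine ⟨fun u => pointwiseApply I (X'.comp u), (pointwiseApply I).continuous.comp hcomp,
    fun u => ?_⟩
  rw [hasFDerivAt_iff_isLittleO, Asymptotics.isLittleO_iff]
  intro ε hε
  obtain ⟨δ, hδ, hδu⟩ := (Metric.continuousAt_iff (f := fun u : C(I, E) => X'.comp u)
    (a := u)).1 hcomp.continuousAt ε hε
  filter_upwards [Metric.ball_mem_nhds u hδ] with v hv
  refine (ContinuousMap.norm_le _ (by positivity)).2 fun s => ?_
  have key : ∀ x ∈ Metric.ball (u s) δ, ‖fderiv ℝ X x - fderiv ℝ X (u s)‖ ≤ ε := by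
    intro x hx
    -- Translating `u` by a constant moves its value at `s` to `x`, so sup-norm continuity of `u ↦
    -- X' ∘ u` bounds `X'` near `u s` uniformly in `s`.
    have h1 : Dist.dist (u + ContinuousMap.const I (x - u s)) u < δ := by
      rw [dist_eq_norm, add_sub_cancel_left]
      refine lt_of_le_of_lt ((ContinuousMap.norm_le _ (norm_nonneg (x - u s))).2 fun t => ?_)
        (mem_ball_iff_norm.1 hx)
      simp
    have h2 := (ContinuousMap.dist_apply_le_dist s).trans (hδu h1).le
    simpa [hX', dist_eq_norm] using h2
  have hvs : v s ∈ Metric.ball (u s) δ :=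
    lt_of_le_of_lt (ContinuousMap.dist_apply_le_dist s) hv
  have := Convex.norm_image_sub_le_of_norm_fderiv_le' (𝕜 := ℝ) (fun x _ => hd x) key
    (convex_ball _ _) (Metric.mem_ball_self hδ) hvs
  refine this.trans ?_
  gcongr
  simpa using (v - u).norm_coe_le_norm s

variable [CompleteSpace E]

/-- The primitive vanishing at `0`, as an operator on continuous functions on `[0, 1]`. -/
noncomputable def primitiveCLM (E : Type*) [NormedAddCommGroup E] [NormedSpace ℝ E]
    [CompleteSpace E] : C(unitInterval, E) →L[ℝ] C(unitInterval, E) :=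
  LinearMap.mkContinuous
    { toFun := fun u => ⟨fun s => ∫ r in (0 : ℝ)..s, u (projIcc 0 1 zero_le_one r),
        (intervalIntegral.continuous_primitive
          (fun a b => (u.continuous.comp continuous_projIcc).intervalIntegrable a b) 0).comp
          continuous_subtype_val⟩
      map_add' := fun u v => by
        ext s
        exact intervalIntegral.integral_add
          ((u.continuous.comp continuous_projIcc).intervalIntegrable _ _)
          ((v.continuous.comp continuous_projIcc).intervalIntegrable _ _)
      map_smul' := fun c u => by
        ext s
        exact intervalIntegral.integral_smul c _ } 1
    (fun u => by
      refine (ContinuousMap.norm_le _ (by positivity)).2 fun s => ?_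
      refine (intervalIntegral.norm_integral_le_of_norm_le_const
        (C := ‖u‖) fun x _ => u.norm_coe_le_norm _).trans ?_
      rw [sub_zero, abs_of_nonneg s.2.1, one_mul]
      exact mul_le_of_le_one_right (norm_nonneg _) s.2.2)

theorem primitiveCLM_apply (u : C(unitInterval, E)) (s : unitInterval) :
    primitiveCLM E u s = ∫ r in (0 : ℝ)..s, u (projIcc 0 1 zero_le_one r) := rfl

/-- A `C¹` vector field has, near each point, a local flow which is `C¹` in time and initial
condition. -/
theorem ContDiff.exists_local_flow {X : E → E} (hX : ContDiff ℝ 1 X) (z₀ : E) :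
    ∃ r > (0 : ℝ), ∃ α : ℝ × E → E, ContDiffOn ℝ 1 α (Ioo (-r) r ×ˢ Metric.ball z₀ r) ∧
      ∀ z ∈ Metric.ball z₀ r, α (0, z) = z ∧
        ∀ t ∈ Ioo (-r) r, HasDerivAt (fun t => α (t, z)) (X (α (t, z))) t := by
  -- Picard–Lindelöf supplies a jointly continuous flow; the implicit function theorem below
  -- supplies only its differentiability.
  obtain ⟨ε, hε, a, ρ, L, K, hρ, hpl⟩ := IsPicardLindelof.of_contDiffAt_one hX.contDiffAt (x₀ := z₀)
  obtain ⟨α, hα, hαc⟩ := (hpl 0).exists_forall_mem_closedBall_eq_hasDerivWithinAt_continuousOn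
  simp only [zero_sub, zero_add] at hα hαc
  have hρ' : (0 : ℝ) < ρ := hρ
  let ev : C(unitInterval, E) →L[ℝ] E := ContinuousMap.evalCLM ℝ (1 : unitInterval)
  let cst : E →L[ℝ] C(unitInterval, E) :=
    LinearMap.mkContinuous
      { toFun := fun z => ContinuousMap.const unitInterval z
        map_add' := fun x y => rfl
        map_smul' := fun c x => rfl } 1
      (fun z => (ContinuousMap.norm_le _ (by positivity)).2 fun s => by
        rw [one_mul]; exact le_rfl)
  have cst_apply : ∀ z s, cst z s = z := fun z s => rfl
  -- The rescaled solution `u(s) = α(z, t s)` on `[0, 1]` solves `u = z + t ∫₀ˢ X(u)`. Time has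
  -- become a parameter, and at `t = 0` the partial derivative in `u` is the identity.
  let Φ : (ℝ × E) × C(unitInterval, E) → C(unitInterval, E) := fun w =>
    w.2 - cst w.1.2 - w.1.1 • primitiveCLM E ((⟨X, hX.continuous⟩ : C(E, E)).comp w.2)
  have hΦ : ContDiff ℝ 1 Φ := by
    have h1 := (hX.superposition unitInterval).comp
      (contDiff_snd : ContDiff ℝ 1 (Prod.snd : (ℝ × E) × C(unitInterval, E) → _))
    have h2 := (primitiveCLM E).contDiff (n := 1).comp h1
    refine (contDiff_snd.sub (cst.contDiff.comp (contDiff_snd.comp contDiff_fst))).sub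
      ((contDiff_fst.comp contDiff_fst).smul h2)
  set w₀ : (ℝ × E) × C(unitInterval, E) := ((0, z₀), cst z₀) with hw₀
  have hΦ₀ : Φ w₀ = 0 := by simp [Φ, hw₀]
  have hinv : (fderiv ℝ Φ w₀ ∘L .inr ℝ (ℝ × E) C(unitInterval, E)).IsInvertible := by
    have h1 : HasFDerivAt Φ (fderiv ℝ Φ w₀) w₀ :=
      (hΦ.differentiable one_ne_zero _).hasFDerivAt
    have h2 : HasFDerivAt (fun u => (((0 : ℝ), z₀), u))
        (ContinuousLinearMap.inr ℝ (ℝ × E) C(unitInterval, E)) (cst z₀) := by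
      exact hasFDerivAt_prodMk_right _ _
    have h3 := HasFDerivAt.comp (cst z₀) h1 h2
    have h4 : HasFDerivAt (Φ ∘ fun u => (((0 : ℝ), z₀), u))
        (ContinuousLinearMap.id ℝ C(unitInterval, E)) (cst z₀) := by
      have : (Φ ∘ fun u => (((0 : ℝ), z₀), u)) = fun u => u - cst z₀ := by
        funext u; simp [Φ]
      rw [this]
      exact (hasFDerivAt_id _).sub_const _
    rw [h3.unique h4]
    exact ⟨ContinuousLinearEquiv.refl ℝ _, rfl⟩
  have himp := hΦ.contDiffAt.eventually_apply_eq_iff_implicitFunction (u := w₀) one_ne_zero hinv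
  have hsm := hΦ.contDiffAt.contDiffAt_implicitFunction (u := w₀) one_ne_zero hinv
  set β := hΦ.contDiffAt.implicitFunction (u := w₀) one_ne_zero hinv
  rw [hΦ₀] at himp
  -- near `(0, z₀)`, the curves of the flow are the values of the implicit function
  obtain ⟨η, hη, hηU⟩ := Metric.eventually_nhds_iff_ball.1 himp
  have hcz : ContinuousWithinAt α (Metric.closedBall z₀ ρ ×ˢ Icc (-ε) ε) (z₀, 0) :=
    hαc _ ⟨Metric.mem_closedBall_self hρ'.le, by constructor <;> linarith⟩
  have hcz' : ContinuousAt α (z₀, 0) := hcz.continuousAt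
    (prod_mem_nhds (Metric.closedBall_mem_nhds _ hρ') (Icc_mem_nhds (by linarith) hε))
  have hα0 : α (z₀, 0) = z₀ := (hα z₀ (Metric.mem_closedBall_self hρ'.le)).1
  obtain ⟨κ, hκ, hκU⟩ := Metric.continuousAt_iff.1 hcz' (η / 2) (by positivity)
  obtain ⟨θ, hθ, hθU⟩ := Metric.eventually_nhds_iff_ball.1 (hsm.eventually (by simp))
  set r := min (min ε ρ) (min κ (min η θ)) with hr
  have hr0 : 0 < r := by simp only [hr, lt_min_iff]; exact ⟨⟨hε, hρ'⟩, hκ, hη, hθ⟩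
  have hrε : r ≤ ε := (min_le_left _ _).trans (min_le_left _ _)
  have hrρ : r ≤ ρ := (min_le_left _ _).trans (min_le_right _ _)
  have hrκ : r ≤ κ := (min_le_right _ _).trans (min_le_left _ _)
  have hrη : r ≤ η := (min_le_right _ _).trans ((min_le_right _ _).trans (min_le_left _ _))
  have hrθ : r ≤ θ := (min_le_right _ _).trans ((min_le_right _ _).trans (min_le_right _ _))
  have hsol : ∀ z ∈ Metric.ball z₀ r, α (z, 0) = z ∧
      ∀ t ∈ Ioo (-r) r, HasDerivAt (fun t => α (z, t)) (X (α (z, t))) t := by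
    intro z hz
    have hz' : z ∈ Metric.closedBall z₀ ρ :=
      Metric.ball_subset_closedBall (Metric.ball_subset_ball hrρ hz)
    refine ⟨(hα z hz').1, fun t ht => ?_⟩
    exact ((hα z hz').2 t ⟨by linarith [ht.1], by linarith [ht.2]⟩).hasDerivAt
      (Icc_mem_nhds (by linarith [ht.1]) (by linarith [ht.2]))
  have hβ : ∀ t ∈ Ioo (-r) r, ∀ z ∈ Metric.ball z₀ r, α (z, t) = ev (β (t, z)) := by
    intro t ht z hz
    obtain ⟨hz0, hzd⟩ := hsol z hz
    have hts : ∀ s ∈ Icc (0 : ℝ) 1, t * s ∈ Ioo (-r) r := by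
      intro s hs
      rw [mem_Ioo, ← abs_lt] at ht ⊢
      rw [abs_mul, abs_of_nonneg hs.1]
      exact lt_of_le_of_lt (mul_le_of_le_one_right (abs_nonneg _) hs.2) ht
    let u : C(unitInterval, E) := ⟨fun s => α (z, t * s), by
      rw [continuous_iff_continuousAt]
      intro s
      exact ContinuousAt.comp (f := fun s : unitInterval => t * (s : ℝ))
        (hzd _ (hts s s.2)).continuousAt (by fun_prop)⟩
    have hΦu : Φ ((t, z), u) = 0 := by
      ext s
      simp only [Φ, ContinuousMap.sub_apply, cst_apply, ContinuousMap.smul_apply,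
        primitiveCLM_apply, ContinuousMap.zero_apply]
      have hint : ∫ r in (0 : ℝ)..s, t • X (α (z, t * r)) = α (z, t * s) - α (z, t * 0) := by
        refine intervalIntegral.integral_eq_sub_of_hasDerivAt (f := fun r => α (z, t * r))
          (fun r hr => ?_) ?_
        · rw [uIcc_of_le s.2.1] at hr
          have := (hzd _ (hts r ⟨hr.1, hr.2.trans s.2.2⟩)).scomp r
            ((hasDerivAt_id r).const_mul t)
          simpa [Function.comp_def] using this
        · refine ContinuousOn.intervalIntegrable fun r hr => ContinuousAt.continuousWithinAt ?_
          rw [uIcc_of_le s.2.1] at hr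
          refine (hX.continuous.continuousAt.comp ?_).const_smul t
          exact ContinuousAt.comp (f := fun r : ℝ => t * r)
            (hzd _ (hts r ⟨hr.1, hr.2.trans s.2.2⟩)).continuousAt (by fun_prop)
      rw [mul_zero, hz0, intervalIntegral.integral_smul] at hint
      have hint' : ∫ r in (0 : ℝ)..s, X (α (z, t * r)) =
          ∫ r in (0 : ℝ)..s, ((⟨X, hX.continuous⟩ : C(E, E)).comp u)
            (projIcc 0 1 zero_le_one r) := by
        refine intervalIntegral.integral_congr fun r hr => ?_
        rw [uIcc_of_le s.2.1] at hr
        have : r ∈ Icc (0 : ℝ) 1 := ⟨hr.1, hr.2.trans s.2.2⟩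
        simp [u, projIcc_of_mem zero_le_one this]
      rw [← hint', hint]
      simp [u]
    have hmem : ((t, z), u) ∈ Metric.ball w₀ η := by
      rw [Metric.mem_ball, Prod.dist_eq, Prod.dist_eq]
      refine max_lt (max_lt ?_ ?_) ?_
      · simp only [hw₀, Real.dist_eq, sub_zero]
        exact lt_of_lt_of_le (abs_lt.2 ht) hrη
      · exact lt_of_lt_of_le hz hrη
      · refine lt_of_le_of_lt ((ContinuousMap.dist_le (by positivity)).2 fun s => ?_)
          (half_lt_self hη)
        have := hκU (x := (z, t * s)) (by
          rw [Prod.dist_eq]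
          refine max_lt (lt_of_lt_of_le hz hrκ) ?_
          simp only [Real.dist_eq, sub_zero]
          exact lt_of_lt_of_le (abs_lt.2 (hts s s.2)) hrκ)
        rw [hα0] at this
        exact this.le
    have := (hηU _ hmem).1 hΦu
    change α (z, t) = β (t, z) 1
    rw [show β (t, z) = u from this]
    simp [u]
  refine ⟨r, hr0, fun w => α (w.2, w.1), ?_, fun z hz => hsol z hz⟩
  refine ContDiffOn.congr (f := fun w => ev (β w)) (fun w hw => ?_) fun w hw => hβ w.1 hw.1 w.2 hw.2
  refine (ev.contDiff.contDiffAt.comp w (hθU w ?_)).contDiffWithinAt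
  rw [Metric.mem_ball, Prod.dist_eq]
  refine max_lt ?_ (lt_of_lt_of_le hw.2 hrθ)
  simp only [hw₀, Real.dist_eq, sub_zero]
  exact lt_of_lt_of_le (abs_lt.2 hw.1) hrθ

end Flow

/-! ### Uniqueness and gluing of local flows near a compact set -/

section FlowGlue

variable {E : Type*} [NormedAddCommGroup E] [NormedSpace ℝ E]

/-- The set need not be convex, so the mean value inequality is not available; on a compact set,
locally Lipschitz already implies Lipschitz. -/
theorem ContDiff.exists_lipschitzOnWith_of_isCompact {F : Type*} [NormedAddCommGroup F]
    [NormedSpace ℝ F] {X : E → F} {K : Set E} (hK : IsCompact K)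
    (hX : ∀ x ∈ K, ContDiffAt ℝ 1 X x) : ∃ C, LipschitzOnWith C X K := by
  refine LocallyLipschitzOn.exists_lipschitzOnWith_of_compact hK fun x hx => ?_
  obtain ⟨C, t, ht, hC⟩ := (hX x hx).exists_lipschitzOnWith
  exact ⟨C, t, mem_nhdsWithin_of_mem_nhds ht, hC⟩

/-- Two solutions on `[0, T]` of an autonomous equation with `C¹` right-hand side agree if they
agree at `0`. -/
theorem ContDiff.ode_unique_right {X : E → E} (hX : ContDiff ℝ 1 X) {T : ℝ} {f g : ℝ → E}
    (hf : ∀ t ∈ Icc 0 T, HasDerivWithinAt f (X (f t)) (Icc 0 T) t)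
    (hg : ∀ t ∈ Icc 0 T, HasDerivWithinAt g (X (g t)) (Icc 0 T) t) (h0 : f 0 = g 0) :
    EqOn f g (Icc 0 T) := by
  have hfc : ContinuousOn f (Icc 0 T) := fun t ht => (hf t ht).continuousWithinAt
  have hgc : ContinuousOn g (Icc 0 T) := fun t ht => (hg t ht).continuousWithinAt
  -- `X` has no global Lipschitz constant; one on the union of the two traces is enough for
  -- Grönwall.
  obtain ⟨C, hC⟩ := ContDiff.exists_lipschitzOnWith_of_isCompact
    ((isCompact_Icc.image_of_continuousOn hfc).union (isCompact_Icc.image_of_continuousOn hgc))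
    fun x _ => hX.contDiffAt
  have hIci : ∀ t ∈ Ico 0 T, Icc 0 T ∈ 𝓝[Ici t] t := fun t ht =>
    mem_of_superset (Icc_mem_nhdsGE ht.2) (Icc_subset_Icc_left ht.1)
  exact ODE_solution_unique_of_mem_Icc_right (v := fun _ => X) (K := C) (fun t _ => hC) hfc
    (fun t ht => (hf t ⟨ht.1, ht.2.le⟩).mono_of_mem_nhdsWithin (hIci t ht))
    (fun t ht => Or.inl (mem_image_of_mem _ ⟨ht.1, ht.2.le⟩)) hgc
    (fun t ht => (hg t ⟨ht.1, ht.2.le⟩).mono_of_mem_nhdsWithin (hIci t ht))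
    (fun t ht => Or.inr (mem_image_of_mem _ ⟨ht.1, ht.2.le⟩)) h0

/-- A `C¹` vector field has, near a compact set, a local flow for a uniform time, which is `C¹` in
time and initial condition. -/
theorem ContDiff.exists_flow_near_compact [CompleteSpace E] {X : E → E} (hX : ContDiff ℝ 1 X)
    {K : Set E} (hK : IsCompact K) :
    ∃ ε > (0 : ℝ), ∃ U, IsOpen U ∧ K ⊆ U ∧ ∃ α : ℝ × E → E,
      ContDiffOn ℝ 1 α (Ioo (-ε) ε ×ˢ U) ∧ ∀ z ∈ U, α (0, z) = z ∧
        ∀ t ∈ Ioo (-ε) ε, HasDerivAt (fun t => α (t, z)) (X (α (t, z))) t := by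
  classical
  choose r hr α hα hαs using fun z₀ : E => hX.exists_local_flow z₀
  obtain ⟨S, hSK, hS⟩ := hK.elim_nhds_subcover (fun z => Metric.ball z (r z))
    fun z _ => Metric.ball_mem_nhds z (hr z)
  rcases S.eq_empty_or_nonempty with rfl | hSne
  · refine ⟨1, one_pos, ∅, isOpen_empty, by simpa using hS, fun w => w.2, by simp, by simp⟩
  set ε := S.inf' hSne r
  have hε : 0 < ε := (Finset.lt_inf'_iff _).2 fun z _ => hr z
  have hεle : ∀ z ∈ S, Ioo (-ε) ε ⊆ Ioo (-r z) (r z) := fun z hz =>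
    Ioo_subset_Ioo (neg_le_neg (Finset.inf'_le _ hz)) (Finset.inf'_le _ hz)
  have hpick : ∀ z : E, ∃ i, (z ∈ ⋃ i ∈ S, Metric.ball i (r i)) → i ∈ S ∧ z ∈ Metric.ball i (r i) := by
    intro z
    by_cases hz : z ∈ ⋃ i ∈ S, Metric.ball i (r i)
    · obtain ⟨i, hi, hzi⟩ := mem_iUnion₂.1 hz
      exact ⟨i, fun _ => ⟨hi, hzi⟩⟩
    · exact ⟨z, fun h => absurd h hz⟩
  choose i hi using hpick
  have heq : ∀ j ∈ S, ∀ z ∈ Metric.ball j (r j), ∀ t ∈ Ioo (-ε) ε, α (i z) (t, z) = α j (t, z) := by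
    intro j hj z hz t ht
    obtain ⟨hiS, hzi⟩ := hi z (mem_iUnion₂.2 ⟨j, hj, hz⟩)
    obtain ⟨h1, h1'⟩ := hαs _ z hzi
    obtain ⟨h2, h2'⟩ := hαs j z hz
    have hneg : ∀ s ∈ Ioo (-ε) ε, -s ∈ Ioo (-ε) ε := fun s hs => by
      constructor <;> linarith [hs.1, hs.2]
    rcases le_total 0 t with h0 | h0
    · have hsub : Icc 0 t ⊆ Ioo (-ε) ε := fun s hs => ⟨by linarith [hs.1], by linarith [hs.2, ht.2]⟩
      exact hX.ode_unique_right (T := t)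
        (f := fun t => α (i z) (t, z)) (g := fun t => α j (t, z))
        (fun s hs => (h1' s (hεle _ hiS (hsub hs))).hasDerivWithinAt)
        (fun s hs => (h2' s (hεle _ hj (hsub hs))).hasDerivWithinAt) (h1.trans h2.symm)
        (right_mem_Icc.2 h0)
    -- Uniqueness was proved forward in time; for `t ≤ 0` it is applied to `-X` and the reversed
    -- curves.
    · have hsub : ∀ s ∈ Icc 0 (-t), -s ∈ Ioo (-ε) ε :=
        fun s hs => ⟨by linarith [hs.2, ht.1], by linarith [hs.1]⟩
      have hrev : ∀ (β : ℝ → E) (s : ℝ), HasDerivAt β (X (β (-s))) (-s) →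
          HasDerivAt (fun s => β (-s)) (-X (β (-s))) s := by
        intro β s h
        simpa [Function.comp_def] using h.scomp s (hasDerivAt_neg s)
      have := hX.neg.ode_unique_right (T := -t)
        (f := fun t => α (i z) (-t, z)) (g := fun t => α j (-t, z))
        (fun s hs => (hrev (fun t => α (i z) (t, z)) s
          (h1' _ (hεle _ hiS (hsub s hs)))).hasDerivWithinAt)
        (fun s hs => (hrev (fun t => α j (t, z)) s
          (h2' _ (hεle _ hj (hsub s hs)))).hasDerivWithinAt)
        (by simpa using h1.trans h2.symm) (right_mem_Icc.2 (by linarith : (0:ℝ) ≤ -t))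
      simpa using this
  refine ⟨ε, hε, ⋃ i ∈ S, Metric.ball i (r i), isOpen_biUnion fun _ _ => Metric.isOpen_ball, hS,
    fun w => α (i w.2) w, ?_, ?_⟩
  · rintro ⟨t, z⟩ ⟨ht, hz⟩
    obtain ⟨j, hj, hzj⟩ := mem_iUnion₂.1 hz
    have hnhds : Ioo (-ε) ε ×ˢ Metric.ball j (r j) ∈ 𝓝 (t, z) :=
      prod_mem_nhds (isOpen_Ioo.mem_nhds ht) (Metric.isOpen_ball.mem_nhds hzj)
    have h1 : ContDiffAt ℝ 1 (α j) (t, z) := (hα j).contDiffAt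
      (mem_of_superset hnhds (prod_mono (hεle j hj) subset_rfl))
    refine (h1.congr_of_eventuallyEq ?_).contDiffWithinAt
    filter_upwards [hnhds] with w hw
    exact heq j hj w.2 hw.2 w.1 hw.1
  · intro z hz
    obtain ⟨hiS, hzi⟩ := hi z hz
    exact ⟨(hαs _ z hzi).1, fun t ht => (hαs _ z hzi).2 t (hεle _ hiS ht)⟩

end FlowGlue

/-! ### Regularity and convexity of the Hamiltonian in the momentum -/

noncomputable section

namespace BrakeOrbits

variable {n : ℕ} {H : Vec n → Vec n → ℝ} {E : ℝ} {D : Set (Vec n)}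

/-- The velocity `∂H/∂p`. -/
def velocity (H : Vec n → Vec n → ℝ) (q p : Vec n) : Vec n := gradient (fun x => H q x) p

/-- The differential `∂H/∂q`. -/
def positionGradient (H : Vec n → Vec n → ℝ) (q p : Vec n) : Vec n := gradient (fun x => H x p) q

/-- The Hamiltonian vector field. -/
def hamiltonField (H : Vec n → Vec n → ℝ) (z : Vec n × Vec n) : Vec n × Vec n :=
  (velocity H z.1 z.2, -positionGradient H z.1 z.2)

namespace IsClassicalHamiltonian

theorem hasFDerivAt_total (hH : IsClassicalHamiltonian H) (z : Vec n × Vec n) :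
    HasFDerivAt (fun z : Vec n × Vec n => H z.1 z.2)
      (fderiv ℝ (fun z : Vec n × Vec n => H z.1 z.2) z) z :=
  (hH.contDiff.differentiable two_ne_zero z).hasFDerivAt

theorem hasFDerivAt_snd (hH : IsClassicalHamiltonian H) (q p : Vec n) :
    HasFDerivAt (fun x => H q x) ((fderiv ℝ (fun z : Vec n × Vec n => H z.1 z.2) (q, p)).comp
      (ContinuousLinearMap.inr ℝ _ _)) p :=
  HasFDerivAt.comp (g := fun z : Vec n × Vec n => H z.1 z.2) p (hH.hasFDerivAt_total (q, p))
    (hasFDerivAt_prodMk_right q p)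

theorem hasFDerivAt_fst (hH : IsClassicalHamiltonian H) (q p : Vec n) :
    HasFDerivAt (fun x => H x p) ((fderiv ℝ (fun z : Vec n × Vec n => H z.1 z.2) (q, p)).comp
      (ContinuousLinearMap.inl ℝ _ _)) q :=
  HasFDerivAt.comp (g := fun z : Vec n × Vec n => H z.1 z.2) (f := fun x => (x, p)) q
    (hH.hasFDerivAt_total (q, p)) (hasFDerivAt_prodMk_left q p)

theorem contDiff_fderiv (hH : IsClassicalHamiltonian H) :
    ContDiff ℝ 1 (fderiv ℝ (fun z : Vec n × Vec n => H z.1 z.2)) :=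
  hH.contDiff.fderiv_right (by norm_num)

theorem contDiff_velocity (hH : IsClassicalHamiltonian H) :
    ContDiff ℝ 1 (fun z : Vec n × Vec n => velocity H z.1 z.2) := by
  have : (fun z : Vec n × Vec n => velocity H z.1 z.2) = fun z =>
      (InnerProductSpace.toDual ℝ (Vec n)).symm
        ((fderiv ℝ (fun z : Vec n × Vec n => H z.1 z.2) z).comp
          (ContinuousLinearMap.inr ℝ _ _)) := by
    funext z
    rw [velocity, gradient, (hH.hasFDerivAt_snd z.1 z.2).fderiv]
  rw [this]
  exact (InnerProductSpace.toDual ℝ (Vec n)).symm.contDiff.comp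
    (hH.contDiff_fderiv.clm_comp contDiff_const)

theorem contDiff_positionGradient (hH : IsClassicalHamiltonian H) :
    ContDiff ℝ 1 (fun z : Vec n × Vec n => positionGradient H z.1 z.2) := by
  have : (fun z : Vec n × Vec n => positionGradient H z.1 z.2) = fun z =>
      (InnerProductSpace.toDual ℝ (Vec n)).symm
        ((fderiv ℝ (fun z : Vec n × Vec n => H z.1 z.2) z).comp
          (ContinuousLinearMap.inl ℝ _ _)) := by
    funext z
    rw [positionGradient, gradient, (hH.hasFDerivAt_fst z.1 z.2).fderiv]
  rw [this]
  exact (InnerProductSpace.toDual ℝ (Vec n)).symm.contDiff.comp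
    (hH.contDiff_fderiv.clm_comp contDiff_const)

theorem contDiff_hamiltonField (hH : IsClassicalHamiltonian H) :
    ContDiff ℝ 1 (hamiltonField H) :=
  hH.contDiff_velocity.prodMk hH.contDiff_positionGradient.neg

theorem fderiv_snd_apply (hH : IsClassicalHamiltonian H) (q p v : Vec n) :
    fderiv ℝ (H q) p v = inner ℝ (velocity H q p) v := by
  have h := (hH.hasFDerivAt_snd q p).differentiableAt
  rw [velocity, gradient, InnerProductSpace.toDual_symm_apply]

theorem fderiv_total_apply (hH : IsClassicalHamiltonian H) (q p u v : Vec n) :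
    fderiv ℝ (fun z : Vec n × Vec n => H z.1 z.2) (q, p) (u, v) =
      inner ℝ (positionGradient H q p) u + inner ℝ (velocity H q p) v := by
  rw [velocity, gradient, InnerProductSpace.toDual_symm_apply, positionGradient, gradient,
    InnerProductSpace.toDual_symm_apply, (hH.hasFDerivAt_snd q p).fderiv,
    (hH.hasFDerivAt_fst q p).fderiv, ContinuousLinearMap.comp_apply, ContinuousLinearMap.comp_apply,
    ← map_add]
  simp

theorem continuous (hH : IsClassicalHamiltonian H) :
    Continuous (fun z : Vec n × Vec n => H z.1 z.2) := hH.contDiff.continuous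

theorem contDiff_potential (hH : IsClassicalHamiltonian H) : ContDiff ℝ 2 (potential H) :=
  hH.contDiff.comp (contDiff_id.prodMk contDiff_const)

theorem hasFDerivAt_potential (hH : IsClassicalHamiltonian H) (q : Vec n) :
    HasFDerivAt (potential H) (innerSL ℝ (positionGradient H q 0)) q := by
  have h := (hH.contDiff_potential.differentiable two_ne_zero q).hasGradientAt
  exact h.hasFDerivAt

theorem contDiff_velocity_right (hH : IsClassicalHamiltonian H) (q : Vec n) :
    ContDiff ℝ 1 (velocity H q) :=
  hH.contDiff_velocity.comp (contDiff_const.prodMk contDiff_id)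

theorem hessian_apply (hH : IsClassicalHamiltonian H) (q p u v : Vec n) :
    fderiv ℝ (fderiv ℝ (H q)) p u v = inner ℝ (fderiv ℝ (velocity H q) p u) v := by
  have h1 : fderiv ℝ (H q) = fun p => innerSL ℝ (velocity H q p) := by
    funext p
    ext v
    simp [hH.fderiv_snd_apply]
  have h2 := ((hH.contDiff_velocity_right q).differentiable one_ne_zero p).hasFDerivAt
  have h3 : HasFDerivAt (fun p => innerSL ℝ (velocity H q p))
      ((innerSL ℝ).comp (fderiv ℝ (velocity H q) p)) p :=
    (innerSL ℝ (E := Vec n)).hasFDerivAt.comp p h2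
  rw [h1, h3.fderiv]
  simp

/-- The derivative of an even function is odd. -/
theorem velocity_zero (hH : IsClassicalHamiltonian H) (q : Vec n) : velocity H q 0 = 0 := by
  have h1 := hH.hasFDerivAt_snd q 0
  have h2 : HasFDerivAt (fun x => H q x) (-(fderiv ℝ (H q) 0)) 0 := by
    have h3 : HasFDerivAt (fun x => H q x) (fderiv ℝ (H q) 0) (-0) := by
      rw [neg_zero]; exact h1.differentiableAt.hasFDerivAt
    have h4 := h3.comp (0 : Vec n) (hasFDerivAt_id (𝕜 := ℝ) (0 : Vec n)).neg
    simp only [Function.comp_def, hH.even] at h4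
    exact h4.congr_fderiv (by ext v; simp)
  have h5 : fderiv ℝ (H q) 0 = -(fderiv ℝ (H q) 0) :=
    h1.differentiableAt.hasFDerivAt.unique h2
  have h6 : fderiv ℝ (H q) 0 = 0 := by
    ext v
    have := congrArg (fun L : Vec n →L[ℝ] ℝ => L v) h5
    simp only [_root_.neg_apply] at this
    simpa using (by linarith : fderiv ℝ (H q) 0 v = 0)
  rw [velocity, gradient]
  change (InnerProductSpace.toDual ℝ (Vec n)).symm (fderiv ℝ (H q) 0) = 0
  rw [h6, map_zero]

/-- Mean value theorem for `s ↦ ⟨∂H/∂p(q, p + s u), u⟩`, whose derivative is the Hessian in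
direction `u`. -/
theorem strongly_monotone (hH : IsClassicalHamiltonian H) {ν : Vec n → ℝ}
    (hν : ∀ q p ξ, ν q * ‖ξ‖ ^ 2 ≤ fderiv ℝ (fderiv ℝ (H q)) p ξ ξ) (q p u : Vec n) :
    ν q * ‖u‖ ^ 2 ≤ inner ℝ (velocity H q (p + u)) u - inner ℝ (velocity H q p) u := by
  have hd : ∀ s : ℝ, HasDerivAt (fun s : ℝ => inner ℝ (velocity H q (p + s • u)) u)
      (inner ℝ (fderiv ℝ (velocity H q) (p + s • u) u) u) s := by
    intro s
    have h1 := ((hH.contDiff_velocity_right q).differentiable one_ne_zero (p + s • u)).hasFDerivAt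
    have h2 : HasDerivAt (fun s : ℝ => p + s • u) u s := by
      simpa using ((hasDerivAt_id s).smul_const u).const_add p
    have h3 := h1.comp_hasDerivAt s h2
    have h4 := h3.inner ℝ (hasDerivAt_const s u)
    simpa using h4
  obtain ⟨c, -, hc⟩ := exists_hasDerivAt_eq_slope
    (fun s : ℝ => inner ℝ (velocity H q (p + s • u)) u) _ zero_lt_one
    (fun s _ => (hd s).continuousAt.continuousWithinAt) (fun s _ => hd s)
  have h := hν q (p + c • u) u
  rw [hH.hessian_apply, hc] at h
  simpa using h

/-- The quantitative convexity inequality for `H(q, ·)`. -/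
theorem strongly_convex (hH : IsClassicalHamiltonian H) {ν : Vec n → ℝ}
    (hν : ∀ q p ξ, ν q * ‖ξ‖ ^ 2 ≤ fderiv ℝ (fderiv ℝ (H q)) p ξ ξ) (q p u : Vec n) :
    H q p + inner ℝ (velocity H q p) u + ν q / 2 * ‖u‖ ^ 2 ≤ H q (p + u) := by
  -- `k` is `H` along the segment minus its first order part and the claimed quadratic part; strong
  -- monotonicity says that `k' ≥ 0`.
  set k : ℝ → ℝ := fun s =>
    H q (p + s • u) - s * inner ℝ (velocity H q p) u - ν q / 2 * ‖u‖ ^ 2 * s ^ 2 with hk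
  have hd : ∀ s : ℝ, HasDerivAt k (inner ℝ (velocity H q (p + s • u)) u -
      inner ℝ (velocity H q p) u - ν q * ‖u‖ ^ 2 * s) s := by
    intro s
    have h1 := (hH.hasFDerivAt_snd q (p + s • u)).differentiableAt.hasFDerivAt
    have h2 : HasDerivAt (fun s : ℝ => p + s • u) u s := by
      simpa using ((hasDerivAt_id s).smul_const u).const_add p
    have h3 := h1.comp_hasDerivAt s h2
    have h4 := (h3.sub ((hasDerivAt_id s).mul_const (inner ℝ (velocity H q p) u))).sub
      (((hasDerivAt_id s).pow 2).const_mul (ν q / 2 * ‖u‖ ^ 2))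
    refine HasDerivAt.congr_deriv h4 ?_
    have h5 : fderiv ℝ (fun x => H q x) (p + s • u) u = inner ℝ (velocity H q (p + s • u)) u :=
      hH.fderiv_snd_apply q (p + s • u) u
    rw [h5]
    simp
    ring
  have hmono : MonotoneOn k (Icc 0 1) := by
    refine monotoneOn_of_deriv_nonneg (convex_Icc 0 1)
      (fun s _ => (hd s).continuousAt.continuousWithinAt)
      (fun s _ => (hd s).differentiableAt.differentiableWithinAt) fun s hs => ?_
    rw [interior_Icc] at hs
    rw [(hd s).deriv]
    have h := hH.strongly_monotone hν q p (s • u)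
    rw [norm_smul, inner_smul_right, inner_smul_right, Real.norm_of_nonneg hs.1.le] at h
    have : s * (ν q * ‖u‖ ^ 2 * s) ≤
        s * (inner ℝ (velocity H q (p + s • u)) u - inner ℝ (velocity H q p) u) := by
      calc _ = ν q * (s * ‖u‖) ^ 2 := by ring
        _ ≤ _ := h
        _ = _ := by ring
    linarith [le_of_mul_le_mul_left this hs.1]
  have := hmono (left_mem_Icc.2 zero_le_one) (right_mem_Icc.2 zero_le_one) zero_le_one
  simp only [hk, zero_smul, add_zero, one_smul] at this
  linarith

theorem potential_add_le (hH : IsClassicalHamiltonian H) {ν : Vec n → ℝ}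
    (hν : ∀ q p ξ, ν q * ‖ξ‖ ^ 2 ≤ fderiv ℝ (fderiv ℝ (H q)) p ξ ξ) (q p : Vec n) :
    potential H q + ν q / 2 * ‖p‖ ^ 2 ≤ H q p := by
  have := hH.strongly_convex hν q 0 p
  rw [hH.velocity_zero, inner_zero_left, zero_add] at this
  simpa [potential] using this

theorem potential_le (hH : IsClassicalHamiltonian H) (q p : Vec n) : potential H q ≤ H q p := by
  obtain ⟨ν, -, hν0, hν⟩ := hH.posDef
  have := hH.potential_add_le hν q p
  have : 0 ≤ ν q / 2 * ‖p‖ ^ 2 := by have := hν0 q; positivity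
  linarith

/-- This is what forces a solution of energy `E` to be at rest whenever it is on `∂D`. -/
theorem eq_zero_of_eq_potential (hH : IsClassicalHamiltonian H) {q p : Vec n}
    (h : H q p = potential H q) : p = 0 := by
  obtain ⟨ν, -, hν0, hν⟩ := hH.posDef
  have h1 := hH.potential_add_le hν q p
  have h2 := hν0 q
  have h3 : ‖p‖ ^ 2 ≤ 0 := by
    by_contra h4
    have : 0 < ν q / 2 * ‖p‖ ^ 2 := mul_pos (half_pos h2) (not_le.1 h4)
    linarith
  exact norm_eq_zero.1 (pow_eq_zero_iff two_ne_zero |>.1 (le_antisymm h3 (by positivity)))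

theorem le_inner_velocity (hH : IsClassicalHamiltonian H) {ν : Vec n → ℝ}
    (hν : ∀ q p ξ, ν q * ‖ξ‖ ^ 2 ≤ fderiv ℝ (fderiv ℝ (H q)) p ξ ξ) (q p : Vec n) :
    ν q * ‖p‖ ^ 2 ≤ inner ℝ (velocity H q p) p := by
  have := hH.strongly_monotone hν q 0 p
  rw [hH.velocity_zero, inner_zero_left, zero_add] at this
  linarith

theorem inner_velocity_pos (hH : IsClassicalHamiltonian H) {q p : Vec n} (hp : p ≠ 0) :
    0 < inner ℝ (velocity H q p) p := by
  obtain ⟨ν, -, hν0, hν⟩ := hH.posDef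
  refine lt_of_lt_of_le ?_ (hH.le_inner_velocity hν q p)
  have := hν0 q
  have := norm_pos_iff.2 hp
  positivity

theorem continuous_right (hH : IsClassicalHamiltonian H) (q : Vec n) : Continuous (H q) :=
  hH.continuous.comp (by fun_prop : Continuous fun p : Vec n => (q, p))

/-- Average the tangent inequality at the intermediate point `m`; the first order terms cancel. -/
theorem convexOn (hH : IsClassicalHamiltonian H) (q : Vec n) : ConvexOn ℝ univ (H q) := by
  obtain ⟨ν, -, hν0, hν⟩ := hH.posDef
  refine ⟨convex_univ, fun x _ y _ a b ha hb hab => ?_⟩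
  set m := a • x + b • y with hm
  have hpos : ∀ u : Vec n, 0 ≤ ν q / 2 * ‖u‖ ^ 2 := fun u => by have := hν0 q; positivity
  have h1 := hH.strongly_convex hν q m (x - m)
  have h2 := hH.strongly_convex hν q m (y - m)
  rw [add_sub_cancel] at h1 h2
  have h3 : a * inner ℝ (velocity H q m) (x - m) + b * inner ℝ (velocity H q m) (y - m) = 0 := by
    rw [← inner_smul_right, ← inner_smul_right, ← inner_add_right]
    have : a • (x - m) + b • (y - m) = (0 : Vec n) := by
      rw [smul_sub, smul_sub, hm]
      have : b = 1 - a := by linarith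
      subst this
      module
    rw [this, inner_zero_right]
  have h4 := mul_le_mul_of_nonneg_left (show H q m + inner ℝ (velocity H q m) (x - m) ≤ H q x by
    linarith [hpos (x - m)]) ha
  have h5 := mul_le_mul_of_nonneg_left (show H q m + inner ℝ (velocity H q m) (y - m) ≤ H q y by
    linarith [hpos (y - m)]) hb
  have h6 : a * H q m + b * H q m = H q m := by rw [← add_mul, hab, one_mul]
  simp only [smul_eq_mul]
  linarith

theorem norm_sq_le (hH : IsClassicalHamiltonian H) {ν : Vec n → ℝ} (hν0 : ∀ q, 0 < ν q)
    (hν : ∀ q p ξ, ν q * ‖ξ‖ ^ 2 ≤ fderiv ℝ (fderiv ℝ (H q)) p ξ ξ) {q p : Vec n}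
    (h : H q p ≤ E) : ‖p‖ ^ 2 ≤ 2 * (E - potential H q) / ν q := by
  rw [le_div_iff₀ (hν0 q)]
  linarith [hH.potential_add_le hν q p]

end IsClassicalHamiltonian

end BrakeOrbits

end

/-! ### The support function of the energy body and the Jacobi–Finsler metric -/

noncomputable section

namespace BrakeOrbits

variable {n : ℕ} {H : Vec n → Vec n → ℝ} {E : ℝ} {D : Set (Vec n)}

/-- The support function of the convex body `{p | H(q, p) ≤ E}`. -/
def supportFunction (H : Vec n → Vec n → ℝ) (E : ℝ) (q v : Vec n) : ℝ :=
  sSup ((fun p => inner ℝ v p) '' {p | H q p ≤ E})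

/-- A vector which is nonpositive on an open half space is a nonpositive multiple of the normal. -/
theorem exists_nonneg_smul_of_halfspace {V : Type*} [NormedAddCommGroup V]
    [InnerProductSpace ℝ V] {m v : V} (hm : m ≠ 0)
    (h : ∀ u, inner ℝ m u < 0 → inner ℝ v u ≤ 0) : ∃ c : ℝ, 0 ≤ c ∧ v = c • m := by
  -- Pass to the closed half space by pushing `u` to `u - ε m`; it contains both directions
  -- orthogonal to `m`, where `v` must then vanish.
  have h' : ∀ u, inner ℝ m u ≤ 0 → inner ℝ v u ≤ 0 := by
    intro u hu
    have hmm : 0 < inner ℝ m m := real_inner_self_pos.2 hm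
    have hε : ∀ ε : ℝ, 0 < ε → inner ℝ v u ≤ ε * inner ℝ v m := by
      intro ε hε
      have := h (u - ε • m) (by
        rw [inner_sub_right, inner_smul_right]
        have := mul_pos hε hmm
        linarith)
      rw [inner_sub_right, inner_smul_right] at this
      linarith
    have ht : Tendsto (fun ε : ℝ => ε * inner ℝ v m) (𝓝[>] 0) (𝓝 0) := by
      have : Tendsto (fun ε : ℝ => ε * inner ℝ v m) (𝓝 0) (𝓝 (0 * inner ℝ v m)) :=
        (continuous_id.mul continuous_const).tendsto 0
      rw [zero_mul] at this
      exact this.mono_left nhdsWithin_le_nhds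
    exact ge_of_tendsto ht (by filter_upwards [self_mem_nhdsWithin] with ε h1 using hε ε h1)
  have hmm : 0 < inner ℝ m m := real_inner_self_pos.2 hm
  set c : ℝ := inner ℝ v m / inner ℝ m m with hc
  refine ⟨c, ?_, ?_⟩
  · have := h' (-m) (by rw [inner_neg_right]; linarith)
    rw [inner_neg_right] at this
    exact div_nonneg (by linarith) hmm.le
  · have horth : inner ℝ m (v - c • m) = 0 := by
      rw [inner_sub_right, inner_smul_right, hc, real_inner_comm]
      field_simp
      ring
    have h1 := h' (v - c • m) horth.le
    have h2 : inner ℝ (v - c • m) (v - c • m) ≤ 0 := by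
      rw [inner_sub_left, inner_smul_left, horth]
      simpa using h1
    exact sub_eq_zero.1 (real_inner_self_nonpos.1 h2)

namespace IsClassicalHamiltonian

theorem isBounded_sublevel (hH : IsClassicalHamiltonian H) (E : ℝ) (q : Vec n) :
    ∃ R : ℝ, ∀ p, H q p ≤ E → ‖p‖ ≤ R := by
  obtain ⟨ν, -, hν0, hν⟩ := hH.posDef
  exact ⟨√(2 * (E - potential H q) / ν q), fun p hp => Real.le_sqrt_of_sq_le (hH.norm_sq_le hν0 hν hp)⟩

theorem bddAbove_support (hH : IsClassicalHamiltonian H) (E : ℝ) (q v : Vec n) :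
    BddAbove ((fun p => inner ℝ v p) '' {p | H q p ≤ E}) := by
  obtain ⟨R, hR⟩ := hH.isBounded_sublevel E q
  refine ⟨‖v‖ * R, ?_⟩
  rintro _ ⟨p, hp, rfl⟩
  exact (real_inner_le_norm v p).trans (mul_le_mul_of_nonneg_left (hR p hp) (norm_nonneg v))

theorem inner_le_supportFunction (hH : IsClassicalHamiltonian H) {q p : Vec n} (hp : H q p ≤ E)
    (v : Vec n) : inner ℝ v p ≤ supportFunction H E q v :=
  le_csSup (hH.bddAbove_support E q v) (mem_image_of_mem _ hp)

theorem supportFunction_nonneg (hH : IsClassicalHamiltonian H) {q : Vec n}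
    (hq : potential H q ≤ E) (v : Vec n) : 0 ≤ supportFunction H E q v := by
  simpa using hH.inner_le_supportFunction (p := 0) hq v

theorem supportFunction_le {q v : Vec n} (hq : potential H q ≤ E) {c : ℝ}
    (h : ∀ p, H q p ≤ E → inner ℝ v p ≤ c) : supportFunction H E q v ≤ c := by
  refine csSup_le ⟨_, mem_image_of_mem _ (show (0 : Vec n) ∈ {p | H q p ≤ E} from hq)⟩ ?_
  rintro _ ⟨p, hp, rfl⟩
  exact h p hp

theorem supportFunction_neg (hH : IsClassicalHamiltonian H) (q v : Vec n) :
    supportFunction H E q (-v) = supportFunction H E q v := by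
  unfold supportFunction
  congr 1
  ext x
  constructor
  · rintro ⟨p, hp, rfl⟩
    exact ⟨-p, by rwa [mem_ofPred_eq, hH.even], by simp⟩
  · rintro ⟨p, hp, rfl⟩
    exact ⟨-p, by rwa [mem_ofPred_eq, hH.even], by simp⟩

/-- `∂H/∂p(q, P)` is the outer normal of the body at `P`; strong convexity makes `P` its maximizer
with a quadratic gap, which is what makes the support function differentiable. -/
theorem inner_velocity_le (hH : IsClassicalHamiltonian H) {ν : Vec n → ℝ}
    (hν : ∀ q p ξ, ν q * ‖ξ‖ ^ 2 ≤ fderiv ℝ (fderiv ℝ (H q)) p ξ ξ) {q P p : Vec n}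
    (hP : H q P = E) (hp : H q p ≤ E) :
    inner ℝ (velocity H q P) p ≤
      inner ℝ (velocity H q P) P - ν q / 2 * ‖p - P‖ ^ 2 := by
  have := hH.strongly_convex hν q P (p - P)
  rw [add_sub_cancel, inner_sub_right] at this
  linarith

theorem supportFunction_smul_velocity (hH : IsClassicalHamiltonian H) {q P : Vec n}
    (hP : H q P = E) {c : ℝ} (hc : 0 ≤ c) :
    supportFunction H E q (c • velocity H q P) = c * inner ℝ (velocity H q P) P := by
  obtain ⟨ν, -, hν0, hν⟩ := hH.posDef
  apply le_antisymm
  · refine supportFunction_le (hP ▸ hH.potential_le q P) fun p hp => ?_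
    rw [inner_smul_left]
    refine mul_le_mul_of_nonneg_left ?_ hc
    have h1 := hH.inner_velocity_le hν hP hp
    have : 0 ≤ ν q / 2 * ‖p - P‖ ^ 2 := by have := hν0 q; positivity
    linarith
  · have := hH.inner_le_supportFunction hP.le (c • velocity H q P)
    rwa [inner_smul_left] at this

/-- Envelope principle: the gradient is the maximizer. Below, `P` is a competitor for every
direction; above, the quadratic gap at `P` absorbs the displacement of the maximizer, with an error
of second order. -/
theorem hasFDerivAt_supportFunction (hH : IsClassicalHamiltonian H) {q P : Vec n}
    (hP : H q P = E) {c : ℝ} (hc : 0 < c) :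
    HasFDerivAt (supportFunction H E q) (innerSL ℝ P) (c • velocity H q P) := by
  obtain ⟨ν, -, hν0, hν⟩ := hH.posDef
  have hνq := hν0 q
  have hval := hH.supportFunction_smul_velocity hP hc.le
  have hbound : ∀ v, |supportFunction H E q v - supportFunction H E q (c • velocity H q P) -
      innerSL ℝ P (v - c • velocity H q P)| ≤ 1 / (2 * c * ν q) * ‖v - c • velocity H q P‖ ^ 2 := by
    intro v
    set h := v - c • velocity H q P with hh
    have hv : v = c • velocity H q P + h := by rw [hh]; abel
    rw [innerSL_apply_apply, hval, abs_le]
    have hpos : 0 ≤ 1 / (2 * c * ν q) * ‖h‖ ^ 2 := by positivity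
    constructor
    · have := hH.inner_le_supportFunction hP.le v
      rw [hv, inner_add_left, inner_smul_left, ← hv] at this
      simp only [conj_trivial] at this
      linarith [real_inner_comm h P]
    · have : supportFunction H E q v ≤ c * inner ℝ (velocity H q P) P + inner ℝ P h +
          1 / (2 * c * ν q) * ‖h‖ ^ 2 := by
        refine supportFunction_le (hP ▸ hH.potential_le q P) fun p hp => ?_
        have h1 := hH.inner_velocity_le hν hP hp
        have h2 := mul_le_mul_of_nonneg_left h1 hc.le
        rw [hv, inner_add_left, inner_smul_left]
        simp only [conj_trivial]
        have h3 : inner ℝ h p - inner ℝ P h ≤ ‖h‖ * ‖p - P‖ := by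
          rw [real_inner_comm h P, ← inner_sub_right]
          exact real_inner_le_norm _ _
        -- Young's inequality, weighted to match the gap `c ν/2 ‖p - P‖²`.
        have h4 : ‖h‖ * ‖p - P‖ ≤ c * (ν q / 2 * ‖p - P‖ ^ 2) + 1 / (2 * c * ν q) * ‖h‖ ^ 2 := by
          have h5 : c * (ν q / 2 * ‖p - P‖ ^ 2) + 1 / (2 * c * ν q) * ‖h‖ ^ 2 - ‖h‖ * ‖p - P‖ =
              1 / (2 * c * ν q) * (‖h‖ - c * ν q * ‖p - P‖) ^ 2 := by
            field_simp
            ring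
          have h6 : 0 ≤ 1 / (2 * c * ν q) * (‖h‖ - c * ν q * ‖p - P‖) ^ 2 := by positivity
          linarith
        rw [mul_sub] at h2
        linarith
      linarith
  refine HasFDerivAt.of_isLittleO ?_
  have h2 : (fun v => ‖v - c • velocity H q P‖ ^ 2) =o[𝓝 (c • velocity H q P)]
      fun v => v - c • velocity H q P := by
    refine Asymptotics.IsLittleO.of_norm_right ?_
    have ht : Tendsto (fun v => ‖v - c • velocity H q P‖) (𝓝 (c • velocity H q P)) (𝓝 0) :=
      tendsto_norm_sub_self _
    simpa [pow_two, Function.comp_def] using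
      ((Asymptotics.isLittleO_one_iff ℝ).2 ht).mul_isBigO
        (Asymptotics.isBigO_refl (fun v => ‖v - c • velocity H q P‖) _)
  refine Asymptotics.IsBigO.trans_isLittleO ?_ h2
  refine Asymptotics.IsBigO.of_bound (1 / (2 * c * ν q)) (Eventually.of_forall fun v => ?_)
  rw [Real.norm_eq_abs, Real.norm_of_nonneg (by positivity)]
  exact hbound v

/-- A maximizer of a linear function on `{p | H(q, p) ≤ E}` lying on the energy surface. -/
theorem exists_smul_velocity_of_eq_supportFunction (hH : IsClassicalHamiltonian H)
    {q P v : Vec n} (hP : H q P = E) (hP0 : P ≠ 0) (hv : inner ℝ v P = supportFunction H E q v) :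
    ∃ c : ℝ, 0 ≤ c ∧ v = c • velocity H q P := by
  have hvel : velocity H q P ≠ 0 := fun h0 => by
    have := hH.inner_velocity_pos (q := q) hP0
    rw [h0, inner_zero_left] at this
    exact lt_irrefl _ this
  refine exists_nonneg_smul_of_halfspace hvel fun u hu => ?_
  -- If `u` points strictly inward at `P`, then `P + s u` stays in the body for small `s > 0`, and
  -- maximality of `P` gives `⟨v, u⟩ ≤ 0`. So `v` lies on the ray of the normal.
  have hd : HasDerivAt (fun s : ℝ => H q (P + s • u)) (inner ℝ (velocity H q P) u) 0 := by
    have h1 := (hH.hasFDerivAt_snd q P).differentiableAt.hasFDerivAt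
    have h2 : HasDerivAt (fun s : ℝ => P + s • u) u 0 := by
      simpa using ((hasDerivAt_id (0 : ℝ)).smul_const u).const_add P
    have h3 := HasFDerivAt.comp_hasDerivAt (0 : ℝ) (f := fun s : ℝ => P + s • u)
      (by simpa using h1) h2
    refine h3.congr_deriv ?_
    exact hH.fderiv_snd_apply q P u
  have hlt : ∀ᶠ s in 𝓝[>] (0 : ℝ), H q (P + s • u) < E := by
    have h1 := (hasDerivWithinAt_iff_tendsto_slope' (by simp)).1 (hd.hasDerivWithinAt (s := Ioi 0))
    have h2 := h1.eventually (gt_mem_nhds hu)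
    filter_upwards [h2, self_mem_nhdsWithin] with s hs hs0
    rw [slope_def_field, sub_zero, zero_smul, add_zero, hP] at hs
    have := (div_lt_iff₀ (show (0:ℝ) < s from hs0)).1 hs
    linarith
  obtain ⟨s, hs, hs0⟩ := (hlt.and self_mem_nhdsWithin).exists
  have h4 := hH.inner_le_supportFunction hs.le v
  rw [← hv, inner_add_right, inner_smul_right] at h4
  by_contra h5
  have := mul_pos (show (0:ℝ) < s from hs0) (not_le.1 h5)
  linarith

/-- Polarity of gauge and support function: write `p = b x` with `x` in the body and `b` decreasing
to the gauge. -/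
theorem inner_le_gauge_mul (hH : IsClassicalHamiltonian H) {q : Vec n} (hq : potential H q < E)
    (v p : Vec n) : inner ℝ v p ≤ gauge {x : Vec n | H q x ≤ E} p * supportFunction H E q v := by
  have hσ := hH.supportFunction_nonneg hq.le v
  have habs : Absorbent ℝ {x : Vec n | H q x ≤ E} := by
    refine absorbent_nhds_zero (mem_of_superset
      ((isOpen_lt (hH.continuous_right q) continuous_const).mem_nhds
        (show (0 : Vec n) ∈ {x | H q x < E} from hq)) fun x hx => (show H q x < E from hx).le)
  have h1 : ∀ a, gauge {x : Vec n | H q x ≤ E} p < a →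
      inner ℝ v p ≤ a * supportFunction H E q v := by
    intro a ha
    obtain ⟨b, hb0, hba, x, hx, rfl⟩ := exists_lt_of_gauge_lt habs ha
    simp only [inner_smul_right]
    have := hH.inner_le_supportFunction hx v
    calc b * inner ℝ v x ≤ b * supportFunction H E q v := by gcongr
      _ ≤ a * supportFunction H E q v := by gcongr
  have ht : Tendsto (fun a : ℝ => a * supportFunction H E q v)
      (𝓝[>] (gauge {x : Vec n | H q x ≤ E} p))
      (𝓝 (gauge {x : Vec n | H q x ≤ E} p * supportFunction H E q v)) :=
    ((continuous_id.mul continuous_const).tendsto _).mono_left nhdsWithin_le_nhds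
  exact ge_of_tendsto ht (by filter_upwards [self_mem_nhdsWithin] with a ha using h1 a ha)

/-- With `g` the gauge of `p`, polarity gives `⟨v, p⟩ - g² ≤ g σ - g²`, whose maximum over `g` is
`σ²/4`, at `g = σ/2`. -/
theorem jacobiFinsler_eq (hH : IsClassicalHamiltonian H) {q : Vec n} (hqD : q ∈ D)
    (hq : potential H q < E) (v : Vec n) :
    jacobiFinsler H E D q v = supportFunction H E q v ^ 2 / 4 := by
  rw [jacobiFinsler, if_pos hqD]
  set σ := supportFunction H E q v
  have hσ : 0 ≤ σ := hH.supportFunction_nonneg hq.le v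
  have hle : ∀ p, inner ℝ v p - levelHamiltonian H E q p ≤ σ ^ 2 / 4 := by
    intro p
    have h1 := hH.inner_le_gauge_mul hq v p
    rw [levelHamiltonian]
    nlinarith [sq_nonneg (σ / 2 - gauge {x : Vec n | H q x ≤ E} p)]
  have hbdd : BddAbove (range fun p => inner ℝ v p - levelHamiltonian H E q p) :=
    ⟨σ ^ 2 / 4, by rintro _ ⟨p, rfl⟩; exact hle p⟩
  apply le_antisymm (ciSup_le hle)
  set G := ⨆ p, (inner ℝ v p - levelHamiltonian H E q p)
  -- Test the supremum with `(σ/2) p`, the optimal scale.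
  have hG : ∀ p, H q p ≤ E → σ / 2 * inner ℝ v p - σ ^ 2 / 4 ≤ G := by
    intro p hp
    refine le_trans ?_ (le_ciSup hbdd ((σ / 2) • p))
    rw [levelHamiltonian, gauge_smul_of_nonneg (by positivity), inner_smul_right, smul_eq_mul]
    have h1 : gauge {x : Vec n | H q x ≤ E} p ≤ 1 := gauge_le_one_of_mem hp
    have h0 : 0 ≤ gauge {x : Vec n | H q x ≤ E} p := gauge_nonneg _
    have : (σ / 2 * gauge {x : Vec n | H q x ≤ E} p) ^ 2 ≤ (σ / 2) ^ 2 := by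
      apply pow_le_pow_left₀ (by positivity)
      exact mul_le_of_le_one_right (by positivity) h1
    nlinarith
  rcases hσ.eq_or_lt with h0 | h0
  · have := hG 0 hq.le
    rw [← h0] at this ⊢
    simpa using this
  · have : σ ≤ (G + σ ^ 2 / 4) / (σ / 2) := by
      refine supportFunction_le hq.le fun p hp => ?_
      rw [le_div_iff₀ (by positivity)]
      have := hG p hp
      linarith
    rw [le_div_iff₀ (by positivity)] at this
    nlinarith

theorem hasFDerivAt_jacobiFinsler (hH : IsClassicalHamiltonian H) {q P : Vec n} (hqD : q ∈ D)
    (hq : potential H q < E) (hP : H q P = E) {c : ℝ} (hc : 0 < c) :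
    HasFDerivAt (jacobiFinsler H E D q)
      ((c * inner ℝ (velocity H q P) P / 2) • innerSL ℝ P) (c • velocity H q P) := by
  have h1 : jacobiFinsler H E D q = fun v => supportFunction H E q v ^ 2 / 4 := by
    funext v
    exact hH.jacobiFinsler_eq hqD hq v
  rw [h1]
  have h2 := ((hH.hasFDerivAt_supportFunction hP hc).pow 2).mul_const (1 / 4)
  rw [hH.supportFunction_smul_velocity hP hc.le] at h2
  simp only [div_eq_mul_one_div (_ ^ 2) (4 : ℝ)]
  refine h2.congr_fderiv ?_
  ext w
  simp
  ring

/-- Only momenta with `H < E` are used on the right, so that each set of the union is open in `(q,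
v)`. Nothing is lost, because shrinking a momentum of the body towards `0` makes the inequality
strict by convexity and `V < E`. -/
theorem lowerSemicontinuous_supportFunction (hH : IsClassicalHamiltonian H)
    (hV : ∀ q ∈ D, potential H q < E) (a : ℝ) :
    {z : Vec n × Vec n | z.1 ∈ D ∧ a < supportFunction H E z.1 z.2} =
      (Prod.fst ⁻¹' D) ∩
        ⋃ p : Vec n, {z : Vec n × Vec n | H z.1 p < E} ∩ {z | a < inner ℝ z.2 p} := by
  ext ⟨q, v⟩
  simp only [mem_ofPred_eq, mem_inter_iff, mem_preimage, mem_iUnion, and_congr_right_iff]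
  intro hq
  constructor
  · intro h
    obtain ⟨_, ⟨p, hp, rfl⟩, hap⟩ := exists_lt_of_lt_csSup
      ⟨_, mem_image_of_mem _ (show (0 : Vec n) ∈ {p | H q p ≤ E} from (hV q hq).le)⟩ h
    have hmem : ∀ s ∈ Ico (0 : ℝ) 1, H q (s • p) < E := by
      intro s hs
      have h1 := (hH.convexOn q).2 (mem_univ (0 : Vec n)) (mem_univ p)
        (sub_nonneg.2 hs.2.le) hs.1 (by ring)
      rw [smul_zero, zero_add] at h1
      have h2 := mul_lt_mul_of_pos_left (hV q hq) (sub_pos.2 hs.2)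
      have h3 := mul_le_mul_of_nonneg_left (show H q p ≤ E from hp) hs.1
      simp only [smul_eq_mul] at h1
      rw [potential] at h2
      linarith
    have ht : Tendsto (fun s : ℝ => s * inner ℝ v p) (𝓝[<] 1) (𝓝 (1 * inner ℝ v p)) :=
      ((continuous_id.mul continuous_const).tendsto _).mono_left nhdsWithin_le_nhds
    rw [one_mul] at ht
    obtain ⟨s, hs1, hs2⟩ := ((ht.eventually (lt_mem_nhds hap)).and
      (Ico_mem_nhdsLT (zero_lt_one' ℝ))).exists
    exact ⟨s • p, hmem s hs2, by rwa [inner_smul_right]⟩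
  · rintro ⟨p, hp, hap⟩
    exact hap.trans_le (hH.inner_le_supportFunction hp.le v)

/-- Lower semicontinuity holds over `D` only, hence the indicator. It makes `σ(γ, γ')` measurable
along curves without any continuity of `γ'`. -/
theorem measurable_indicator_supportFunction (hH : IsClassicalHamiltonian H) (hD : IsOpen D)
    (hV : ∀ q ∈ D, potential H q < E) :
    Measurable ((Prod.fst ⁻¹' D).indicator
      fun z : Vec n × Vec n => supportFunction H E z.1 z.2) := by
  have hDm : MeasurableSet (Prod.fst ⁻¹' D : Set (Vec n × Vec n)) :=
    (hD.preimage continuous_fst).measurableSet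
  refine measurable_of_Ioi fun a => ?_
  have hopen : IsOpen {z : Vec n × Vec n | z.1 ∈ D ∧ a < supportFunction H E z.1 z.2} := by
    rw [hH.lowerSemicontinuous_supportFunction hV a]
    refine (hD.preimage continuous_fst).inter (isOpen_iUnion fun p => IsOpen.inter ?_ ?_)
    · exact isOpen_lt (hH.continuous.comp
        (by fun_prop : Continuous fun z : Vec n × Vec n => (z.1, p))) continuous_const
    · exact isOpen_lt continuous_const (by fun_prop)
  by_cases ha : a < 0
  · have : ((Prod.fst ⁻¹' D).indicator
        fun z : Vec n × Vec n => supportFunction H E z.1 z.2) ⁻¹' Ioi a =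
        {z | z.1 ∈ D ∧ a < supportFunction H E z.1 z.2} ∪ (Prod.fst ⁻¹' D)ᶜ := by
      ext z
      by_cases hz : z.1 ∈ D <;> simp [indicator, hz, ha]
    rw [this]
    exact hopen.measurableSet.union hDm.compl
  · have : ((Prod.fst ⁻¹' D).indicator
        fun z : Vec n × Vec n => supportFunction H E z.1 z.2) ⁻¹' Ioi a =
        {z | z.1 ∈ D ∧ a < supportFunction H E z.1 z.2} := by
      ext z
      by_cases hz : z.1 ∈ D <;> simp [indicator, hz, ha]
    rw [this]
    exact hopen.measurableSet

end IsClassicalHamiltonian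

end BrakeOrbits

end

/-! ### The well near its boundary and the flow from rest -/

noncomputable section

namespace BrakeOrbits

variable {n : ℕ} {H : Vec n → Vec n → ℝ} {E : ℝ} {D : Set (Vec n)}

/-- A property which holds near every point of a compact set holds uniformly near that set. -/
theorem exists_uniform_radius {Y : Type*} [PseudoMetricSpace Y] {K : Set Y} (hK : IsCompact K)
    {P : Y → Prop} (h : ∀ x ∈ K, ∀ᶠ w in 𝓝 x, P w) :
    ∃ δ > (0 : ℝ), ∀ x ∈ K, ∀ w, dist w x < δ → P w := by
  choose! r hr hP using fun x hx => Metric.eventually_nhds_iff.1 (h x hx)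
  obtain ⟨δ, hδ, hL⟩ := lebesgue_number_lemma_of_metric (c := fun x : K => Metric.ball (x : Y) (r x))
    hK (fun _ => Metric.isOpen_ball) fun x hx => mem_iUnion.2 ⟨⟨x, hx⟩, Metric.mem_ball_self (hr x hx)⟩
  refine ⟨δ, hδ, fun x hx w hw => ?_⟩
  obtain ⟨i, hi⟩ := hL x hx
  exact hP i i.2 (hi hw)

namespace IsPotentialWell

theorem notMem_of_mem_frontier (hD : IsPotentialWell H E D) {x : Vec n} (hx : x ∈ frontier D) :
    x ∉ D := fun h => (hD.potential_lt x h).ne (hD.potential_eq x hx)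

theorem positionGradient_ne_zero (hD : IsPotentialWell H E D) {x : Vec n} (hx : x ∈ frontier D) :
    positionGradient H x 0 ≠ 0 := hD.gradient_ne_zero x hx

theorem subset_of_isPreconnected (hD : IsPotentialWell H E D) {t : Set (Vec n)}
    (ht : IsPreconnected t) (hfr : ∀ x ∈ t, x ∉ frontier D) (hne : (t ∩ D).Nonempty) : t ⊆ D := by
  have hcover : t ⊆ D ∪ (closure D)ᶜ := fun x hx => by
    by_contra h
    rw [mem_union, not_or, notMem_compl_iff] at h
    exact hfr x hx (hD.isOpen.frontier_eq ▸ ⟨h.2, h.1⟩)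
  intro x hx
  by_contra hxD
  obtain ⟨z, -, hz, hz'⟩ := ht D (closure D)ᶜ hD.isOpen isClosed_closure.isOpen_compl hcover hne
    ⟨x, hx, (hcover hx).resolve_left hxD⟩
  exact hz' (subset_closure hz)

theorem notMem_frontier_of_lt (hD : IsPotentialWell H E D) {x : Vec n} (hx : potential H x < E) :
    x ∉ frontier D := fun h => hx.ne (hD.potential_eq x h)

/-- Near the boundary the well fills the whole sublevel set of the potential. -/
theorem eventually_mem_of_potential_lt (hH : IsClassicalHamiltonian H)
    (hD : IsPotentialWell H E D) {Q : Vec n} (hQ : Q ∈ frontier D) :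
    ∀ᶠ x in 𝓝 Q, potential H x < E → x ∈ D := by
  set N := positionGradient H Q 0 with hN
  have hN0 : 0 < ‖N‖ := norm_pos_iff.2 (hD.positionGradient_ne_zero hQ)
  have hstrict : HasStrictFDerivAt (potential H) (innerSL ℝ N) Q :=
    hH.contDiff_potential.contDiffAt.hasStrictFDerivAt' (hH.hasFDerivAt_potential Q) two_ne_zero
  have hev := hstrict.isLittleO.def (c := ‖N‖ / 4) (by positivity)
  obtain ⟨δ, hδ, hball⟩ := Metric.eventually_nhds_iff_ball.1 hev
  have hV : ∀ x ∈ Metric.ball Q δ, ∀ y ∈ Metric.ball Q δ,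
      potential H x - potential H y ≤ inner ℝ N (x - y) + ‖N‖ / 4 * ‖x - y‖ := by
    intro x hx y hy
    have h1 := hball (x, y) (by rw [← ball_prod_same]; exact ⟨hx, hy⟩)
    simp only [innerSL_apply_apply] at h1
    linarith [(abs_le.1 h1).2]
  have hVQ : potential H Q = E := hD.potential_eq Q hQ
  set ρ := δ / 2 with hρ
  have hρ0 : 0 < ρ := half_pos hδ
  -- Down the gradient: `V < E` on a whole ball around `Q + ρ e`, and along the segments from points
  -- of `{V < E}` near `Q` in direction `ρ e`, which end in this ball.
  set e : Vec n := -(‖N‖⁻¹ • N) with he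
  have hNe : inner ℝ N e = -‖N‖ := by
    rw [he, inner_neg_right, inner_smul_right, real_inner_self_eq_norm_sq]
    field_simp
  have hen : ‖e‖ = 1 := by
    rw [he, norm_neg, norm_smul, norm_inv, norm_norm]
    field_simp
  have hballV : ∀ x ∈ Metric.ball (Q + ρ • e) (ρ / 2), potential H x < E := by
    intro x hx
    obtain ⟨w, rfl⟩ : ∃ w, x = Q + ρ • e + w := ⟨x - (Q + ρ • e), by abel⟩
    have hw : ‖w‖ < ρ / 2 := by simpa [dist_eq_norm] using hx
    have hz : ‖Q + ρ • e + w - Q‖ ≤ 3 / 2 * ρ := by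
      rw [add_assoc, add_sub_cancel_left]
      refine (norm_add_le _ _).trans ?_
      rw [norm_smul, hen, Real.norm_of_nonneg hρ0.le]
      linarith
    have h1 := hV (Q + ρ • e + w) (by rw [mem_ball_iff_norm]; linarith) Q (Metric.mem_ball_self hδ)
    have h2 : inner ℝ N (Q + ρ • e + w - Q) ≤ -(ρ * ‖N‖) + ‖N‖ * (ρ / 2) := by
      rw [add_assoc, add_sub_cancel_left, inner_add_right, inner_smul_right, hNe]
      have := (real_inner_le_norm N w).trans (mul_le_mul_of_nonneg_left hw.le hN0.le)
      linarith
    have h3 := mul_le_mul_of_nonneg_left hz (by positivity : 0 ≤ ‖N‖ / 4)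
    have h4 : 0 < ‖N‖ * ρ := by positivity
    rw [hVQ] at h1
    linarith
  have hseg : ∀ x ∈ Metric.ball Q (ρ / 2), potential H x < E →
      ∀ z ∈ segment ℝ x (x + ρ • e), potential H z < E := by
    intro x hx hxE z hz
    rw [segment_eq_image'] at hz
    obtain ⟨s, hs, rfl⟩ := hz
    simp only [add_sub_cancel_left]
    have hx' : ‖x - Q‖ < ρ / 2 := mem_ball_iff_norm.1 hx
    have hsn : ‖s • ρ • e‖ = s * ρ := by
      rw [norm_smul, norm_smul, hen, Real.norm_of_nonneg hρ0.le, Real.norm_of_nonneg hs.1, mul_one]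
    have hsρ : s * ρ ≤ ρ := mul_le_of_le_one_left hρ0.le hs.2
    have h1 := hV (x + s • ρ • e) (by
        rw [mem_ball_iff_norm, add_sub_right_comm]
        have := norm_add_le (x - Q) (s • ρ • e)
        linarith) x (by rw [mem_ball_iff_norm]; linarith)
    rw [add_sub_cancel_left, hsn, inner_smul_right, inner_smul_right, hNe] at h1
    have : 0 ≤ s * ρ * ‖N‖ := mul_nonneg (mul_nonneg hs.1 hρ0.le) hN0.le
    linarith
  have hshift : ∀ x ∈ Metric.ball Q (ρ / 2), x + ρ • e ∈ Metric.ball (Q + ρ • e) (ρ / 2) := by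
    intro x hx
    rw [mem_ball_iff_norm] at hx ⊢
    rwa [add_sub_add_right_eq_sub]
  -- Some point of `D` is near `Q`. As `{V < E}` misses the frontier, `D` spreads from it along its
  -- segment to the ball, over the ball, and back along the segment to any other nearby point with
  -- `V < E`.
  obtain ⟨x₀, hx₀, hx₀D⟩ := mem_closure_iff_nhds.1 (frontier_subset_closure hQ) _
    (Metric.ball_mem_nhds Q (half_pos hρ0))
  have h1 := hD.subset_of_isPreconnected (convex_segment _ _).isPreconnected
    (fun z hz => hD.notMem_frontier_of_lt (hseg x₀ hx₀ (hD.potential_lt x₀ hx₀D) z hz)) ⟨x₀, left_mem_segment _ _ _, hx₀D⟩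
    (right_mem_segment ℝ _ _)
  have h2 := hD.subset_of_isPreconnected (convex_ball _ _).isPreconnected
    (fun z hz => hD.notMem_frontier_of_lt (hballV z hz))
    ⟨_, hshift x₀ hx₀, h1⟩
  filter_upwards [Metric.ball_mem_nhds Q (half_pos hρ0)] with x hx hxE
  exact hD.subset_of_isPreconnected (convex_segment _ _).isPreconnected
    (fun z hz => hD.notMem_frontier_of_lt (hseg x hx hxE z hz)) ⟨_, right_mem_segment ℝ _ _, h2 (hshift x hx)⟩ (left_mem_segment ℝ _ _)

/-- Near the boundary, the boundary is the whole level set of the potential. -/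
theorem eventually_mem_frontier_of_potential_eq (hH : IsClassicalHamiltonian H)
    (hD : IsPotentialWell H E D) {Q : Vec n} (hQ : Q ∈ frontier D) :
    ∀ᶠ x in 𝓝 Q, potential H x = E → x ∈ frontier D := by
  have hN : ∀ᶠ x in 𝓝 Q, positionGradient H x 0 ≠ 0 := by
    have hc : Continuous fun x : Vec n => positionGradient H x 0 :=
      hH.contDiff_positionGradient.continuous.comp
        (by fun_prop : Continuous fun x : Vec n => (x, (0 : Vec n)))
    exact hc.continuousAt.eventually_ne (hD.positionGradient_ne_zero hQ)
  filter_upwards [hN, (hD.eventually_mem_of_potential_lt hH hQ).eventually_nhds] with x hx hxn hxE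
  rw [hD.isOpen.frontier_eq]
  refine ⟨?_, fun h => (hD.potential_lt x h).ne hxE⟩
  rw [mem_closure_iff_frequently]
  by_contra hfr
  rw [not_frequently] at hfr
  -- If `D` did not accumulate at `x`, then `V ≥ E = V(x)` near `x`, against the nonvanishing
  -- gradient.
  have hmin : IsLocalMin (potential H) x := by
    filter_upwards [hfr, hxn] with y hy hy'
    by_contra hlt
    exact hy (hy' (by linarith [not_le.1 hlt]))
  have h0 := hmin.hasFDerivAt_eq_zero (hH.hasFDerivAt_potential x)
  apply hx
  have := congrArg (fun L : Vec n →L[ℝ] ℝ => L (positionGradient H x 0)) h0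
  simpa using this

end IsPotentialWell

/-- A family of solutions of Hamilton's equations starting at rest, `C¹` in all variables. -/
structure IsRestFlow (H : Vec n → Vec n → ℝ) (ε : ℝ) (U : Set (Vec n))
    (q p : ℝ × Vec n → Vec n) : Prop where
  pos : 0 < ε
  isOpen : IsOpen U
  contDiffOn_q : ContDiffOn ℝ 1 q (Ioo (-ε) ε ×ˢ U)
  contDiffOn_p : ContDiffOn ℝ 1 p (Ioo (-ε) ε ×ˢ U)
  q_zero : ∀ x ∈ U, q (0, x) = x
  p_zero : ∀ x ∈ U, p (0, x) = 0
  deriv_q : ∀ x ∈ U, ∀ t ∈ Ioo (-ε) ε,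
    HasDerivAt (fun s => q (s, x)) (velocity H (q (t, x)) (p (t, x))) t
  deriv_p : ∀ x ∈ U, ∀ t ∈ Ioo (-ε) ε,
    HasDerivAt (fun s => p (s, x)) (-positionGradient H (q (t, x)) (p (t, x))) t

/-- The starting points fill an open neighbourhood of `M`, not just `M`, so that the flow can be
differentiated in them without charts on the boundary. -/
theorem IsClassicalHamiltonian.exists_restFlow (hH : IsClassicalHamiltonian H) {M : Set (Vec n)}
    (hM : IsCompact M) : ∃ ε U q p, M ⊆ U ∧ IsRestFlow H ε U q p := by
  have hi : Continuous fun x : Vec n => (x, (0 : Vec n)) := by fun_prop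
  obtain ⟨ε, hε, U, hU, hKU, α, hα, hs⟩ :=
    hH.contDiff_hamiltonField.exists_flow_near_compact (hM.image hi)
  have hi' : ContDiff ℝ 1 fun w : ℝ × Vec n => (w.1, (w.2, (0 : Vec n))) := by fun_prop
  have hc : ContDiffOn ℝ 1 (fun w : ℝ × Vec n => α (w.1, (w.2, (0 : Vec n))))
      (Ioo (-ε) ε ×ˢ ((fun x : Vec n => (x, (0 : Vec n))) ⁻¹' U)) :=
    hα.comp hi'.contDiffOn fun w hw => ⟨hw.1, hw.2⟩
  refine ⟨ε, (fun x : Vec n => (x, (0 : Vec n))) ⁻¹' U,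
    fun w => (α (w.1, (w.2, 0))).1, fun w => (α (w.1, (w.2, 0))).2,
    fun x hx => hKU (mem_image_of_mem _ hx), hε, hU.preimage hi, ?_, ?_, ?_, ?_, ?_, ?_⟩
  · exact contDiff_fst.comp_contDiffOn hc
  · exact contDiff_snd.comp_contDiffOn hc
  · intro x hx
    simp [(hs _ hx).1]
  · intro x hx
    simp [(hs _ hx).1]
  · intro x hx t ht
    exact (_root_.hasFDerivAt_fst (𝕜 := ℝ)).comp_hasDerivAt t ((hs _ hx).2 t ht)
  · intro x hx t ht
    exact (_root_.hasFDerivAt_snd (𝕜 := ℝ)).comp_hasDerivAt t ((hs _ hx).2 t ht)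

end BrakeOrbits

end

/-! ### Removing the degeneracy at rest: the variable `r = t²` -/

noncomputable section

namespace BrakeOrbits

variable {n : ℕ} {H : Vec n → Vec n → ℝ} {E : ℝ} {D : Set (Vec n)}

/-- The initial acceleration of the solution which starts at rest at `Q`. -/
def restAcceleration (H : Vec n → Vec n → ℝ) (Q : Vec n) : Vec n :=
  fderiv ℝ (velocity H Q) 0 (-positionGradient H Q 0)

/-- The acceleration is minus the momentum Hessian applied to `∇V`, and that Hessian is positive
definite: orbits leave the boundary transversally. -/
theorem IsClassicalHamiltonian.inner_restAcceleration_neg (hH : IsClassicalHamiltonian H)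
    {Q : Vec n} (hQ : positionGradient H Q 0 ≠ 0) :
    inner ℝ (positionGradient H Q 0) (restAcceleration H Q) < 0 := by
  obtain ⟨ν, -, hν0, hν⟩ := hH.posDef
  have h := hν Q 0 (positionGradient H Q 0)
  rw [hH.hessian_apply] at h
  rw [restAcceleration, map_neg, inner_neg_right, real_inner_comm]
  have h1 := norm_pos_iff.2 hQ
  have h2 : 0 < ν Q * ‖positionGradient H Q 0‖ ^ 2 := mul_pos (hν0 Q) (by positivity)
  linarith

namespace IsRestFlow

variable {ε : ℝ} {U : Set (Vec n)} {q p : ℝ × Vec n → Vec n}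

theorem mem_nhds (hF : IsRestFlow H ε U q p) {t : ℝ} (ht : t ∈ Ioo (-ε) ε) {x : Vec n}
    (hx : x ∈ U) : Ioo (-ε) ε ×ˢ U ∈ 𝓝 (t, x) :=
  prod_mem_nhds (isOpen_Ioo.mem_nhds ht) (hF.isOpen.mem_nhds hx)

theorem zero_mem (hF : IsRestFlow H ε U q p) : (0 : ℝ) ∈ Ioo (-ε) ε :=
  ⟨neg_lt_zero.2 hF.pos, hF.pos⟩

theorem contDiffAt_q (hF : IsRestFlow H ε U q p) {t : ℝ} (ht : t ∈ Ioo (-ε) ε) {x : Vec n}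
    (hx : x ∈ U) : ContDiffAt ℝ 1 q (t, x) := hF.contDiffOn_q.contDiffAt (hF.mem_nhds ht hx)

theorem contDiffAt_p (hF : IsRestFlow H ε U q p) {t : ℝ} (ht : t ∈ Ioo (-ε) ε) {x : Vec n}
    (hx : x ∈ U) : ContDiffAt ℝ 1 p (t, x) := hF.contDiffOn_p.contDiffAt (hF.mem_nhds ht hx)

/-- The velocity is `C¹` in `(t, x)` and vanishes on `t = 0`. Strict differentiability at `(0, Q)`,
applied to `(t, x)` and `(0, x)`, makes the expansion uniform in `x`. -/
theorem velocity_isLittleO (hF : IsRestFlow H ε U q p) (hH : IsClassicalHamiltonian H)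
    {Q : Vec n} (hQ : Q ∈ U) {η : ℝ} (hη : 0 < η) :
    ∀ᶠ w in 𝓝 ((0 : ℝ), Q),
      ‖velocity H (q w) (p w) - w.1 • restAcceleration H Q‖ ≤ η * |w.1| := by
  set g : ℝ × Vec n → Vec n := fun w => velocity H (q w) (p w) with hg
  have hgc : ContDiffAt ℝ 1 g (0, Q) :=
    hH.contDiff_velocity.contDiffAt.comp (0, Q)
      ((hF.contDiffAt_q hF.zero_mem hQ).prodMk (hF.contDiffAt_p hF.zero_mem hQ))
  have hgs := hgc.hasStrictFDerivAt one_ne_zero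
  have hg1 : fderiv ℝ g (0, Q) (1, 0) = restAcceleration H Q := by
    have h1 : HasDerivAt (fun s : ℝ => (s, Q)) ((1 : ℝ), (0 : Vec n)) 0 :=
      (hasDerivAt_id _).prodMk (hasDerivAt_const _ _)
    have h2 : HasDerivAt (fun s : ℝ => g (s, Q)) (fderiv ℝ g (0, Q) (1, 0)) 0 :=
      HasFDerivAt.comp_hasDerivAt (f := fun s : ℝ => (s, Q)) 0 hgs.hasFDerivAt h1
    have hq := hF.deriv_q Q hQ 0 hF.zero_mem
    have hp := hF.deriv_p Q hQ 0 hF.zero_mem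
    rw [hF.q_zero Q hQ, hF.p_zero Q hQ, hH.velocity_zero] at hq
    rw [hF.q_zero Q hQ, hF.p_zero Q hQ] at hp
    have hv : HasFDerivAt (fun z : Vec n × Vec n => velocity H z.1 z.2)
        (fderiv ℝ (fun z : Vec n × Vec n => velocity H z.1 z.2) (Q, 0)) (q (0, Q), p (0, Q)) := by
      rw [hF.q_zero Q hQ, hF.p_zero Q hQ]
      exact (hH.contDiff_velocity.differentiable one_ne_zero _).hasFDerivAt
    have h3 : HasDerivAt (fun s : ℝ => g (s, Q)) _ 0 :=
      HasFDerivAt.comp_hasDerivAt (f := fun s : ℝ => (q (s, Q), p (s, Q))) 0 hv (hq.prodMk hp)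
    rw [h2.unique h3, restAcceleration]
    have h4 : HasFDerivAt (velocity H Q)
        ((fderiv ℝ (fun z : Vec n × Vec n => velocity H z.1 z.2) (Q, 0)).comp
          (ContinuousLinearMap.inr ℝ _ _)) 0 :=
      HasFDerivAt.comp (g := fun z : Vec n × Vec n => velocity H z.1 z.2) (f := fun x => (Q, x)) 0
        (hH.contDiff_velocity.differentiable one_ne_zero _).hasFDerivAt (hasFDerivAt_prodMk_right Q 0)
    rw [h4.fderiv]
    simp
  have hpair : Tendsto (fun w : ℝ × Vec n => (w, ((0 : ℝ), w.2))) (𝓝 (0, Q))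
      (𝓝 (((0 : ℝ), Q), ((0 : ℝ), Q))) := by
    have : Continuous (fun w : ℝ × Vec n => (w, ((0 : ℝ), w.2))) := by fun_prop
    exact this.tendsto _
  have hU : ∀ᶠ w in 𝓝 ((0 : ℝ), Q), w.2 ∈ U :=
    continuous_snd.continuousAt.eventually (hF.isOpen.mem_nhds hQ)
  filter_upwards [hpair.eventually (hgs.isLittleO.def hη), hU] with w hw hwU
  have h0 : g (0, w.2) = 0 := by
    simp only [hg, hF.q_zero _ hwU, hF.p_zero _ hwU, hH.velocity_zero]
  have hsub : w - (0, w.2) = w.1 • ((1 : ℝ), (0 : Vec n)) := by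
    ext <;> simp
  simp only [h0, hsub, map_smul, hg1, sub_zero] at hw
  simpa [norm_smul, Prod.norm_def] using hw

/-- The `x`-derivative of the flow is the identity at `t = 0`; this controls variations of the
starting point at fixed time. -/
theorem q_sub_isLittleO (hF : IsRestFlow H ε U q p)
    {Q : Vec n} (hQ : Q ∈ U) {η : ℝ} (hη : 0 < η) :
    ∃ δ > 0, ∀ t : ℝ, |t| < δ → ∀ x ∈ Metric.ball Q δ, ∀ x' ∈ Metric.ball Q δ,
      ‖q (t, x) - q (t, x') - (x - x')‖ ≤ η * ‖x - x'‖ := by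
  have hqs := (hF.contDiffAt_q hF.zero_mem hQ).hasStrictFDerivAt one_ne_zero
  have hq1 : ∀ v, fderiv ℝ q (0, Q) (0, v) = v := by
    intro v
    have h1 : HasFDerivAt (fun x => q (0, x)) ((fderiv ℝ q (0, Q)).comp
        (ContinuousLinearMap.inr ℝ _ _)) Q :=
      HasFDerivAt.comp (f := fun x => ((0 : ℝ), x)) Q hqs.hasFDerivAt (hasFDerivAt_prodMk_right 0 Q)
    have h2 : HasFDerivAt (fun x => q (0, x)) (ContinuousLinearMap.id ℝ (Vec n)) Q :=
      (hasFDerivAt_id Q).congr_of_eventuallyEq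
        (by filter_upwards [hF.isOpen.mem_nhds hQ] with x hx using hF.q_zero x hx)
    have := congrArg (fun L : Vec n →L[ℝ] Vec n => L v) (h1.unique h2)
    simpa using this
  obtain ⟨δ, hδ, hball⟩ := Metric.eventually_nhds_iff_ball.1 (hqs.isLittleO.def hη)
  refine ⟨δ, hδ, fun t ht x hx x' hx' => ?_⟩
  have ht' : t ∈ Metric.ball (0 : ℝ) δ := by simpa using ht
  have := hball ((t, x), (t, x')) (by
    rw [← ball_prod_same, ← ball_prod_same]
    exact ⟨⟨ht', hx⟩, ⟨ht', hx'⟩⟩)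
  simpa [hq1, Prod.norm_def] using this

/-- The flow in the time variable `r = t ^ 2`, extended to negative `r` by reflection. -/
def unfold (q : ℝ × Vec n → Vec n) (w : ℝ × Vec n) : Vec n :=
  w.2 + Real.sign w.1 • (q (√|w.1|, w.2) - w.2)

theorem unfold_of_pos {r : ℝ} (hr : 0 < r) (x : Vec n) : unfold q (r, x) = q (√r, x) := by
  simp [unfold, Real.sign_of_pos hr, abs_of_pos hr]

theorem unfold_zero (x : Vec n) : unfold q (0, x) = x := by
  simp [unfold]

theorem unfold_neg (r : ℝ) (x : Vec n) : unfold q (-r, x) = (2 : ℝ) • x - unfold q (r, x) := by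
  simp only [unfold, abs_neg, Real.sign_neg]
  module

/-- Integrating `q' = u a + o(u)` from `s` to `t` gives `(t² - s²)/2 a` up to `η (t² - s²)/2`, which
is linear in `r = t²`. The reflection carries this over to `r < 0`, and opposite signs are compared
through `r = 0`. -/
theorem unfold_time_bound (hF : IsRestFlow H ε U q p) (hH : IsClassicalHamiltonian H)
    {Q : Vec n} (hQ : Q ∈ U) {η : ℝ} (hη : 0 < η) :
    ∃ δ > 0, ∀ r r' : ℝ, |r| < δ → |r'| < δ → ∀ x ∈ Metric.ball Q δ,
      ‖unfold q (r, x) - unfold q (r', x) - ((r - r') / 2) • restAcceleration H Q‖ ≤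
        η * |r - r'| := by
  obtain ⟨δ, hδ, hball⟩ := Metric.eventually_nhds_iff_ball.1
    ((hF.velocity_isLittleO hH hQ hη).and
      (continuous_snd.continuousAt.eventually (hF.isOpen.mem_nhds hQ)))
  set a := restAcceleration H Q
  set κ := min δ ε with hκ
  have hκ0 : 0 < κ := lt_min hδ hF.pos
  -- the forward estimate
  have hfwd : ∀ x ∈ Metric.ball Q δ, ∀ s t : ℝ, 0 ≤ s → s ≤ t → t < κ →
      ‖q (t, x) - q (s, x) - ((t ^ 2 - s ^ 2) / 2) • a‖ ≤ η * ((t ^ 2 - s ^ 2) / 2) := by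
    intro x hx s t hs hst htκ
    have hxU : ∀ u ∈ Icc s t, x ∈ U ∧ ‖velocity H (q (u, x)) (p (u, x)) - u • a‖ ≤ η * |u| := by
      intro u hu
      have h0 : |u| < δ := by
        rw [abs_of_nonneg (hs.trans hu.1)]
        exact (hu.2.trans_lt htκ).trans_le (min_le_left _ _)
      have := hball (u, x) (by rw [← ball_prod_same]; exact ⟨by simpa using h0, hx⟩)
      exact ⟨this.2, this.1⟩
    have hd : ∀ u ∈ Icc s t, HasDerivAt (fun u => q (u, x) - q (s, x) - ((u ^ 2 - s ^ 2) / 2) • a)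
        (velocity H (q (u, x)) (p (u, x)) - u • a) u := by
      intro u hu
      have hu' : u ∈ Ioo (-ε) ε :=
        ⟨by linarith [hu.1, hF.pos], (hu.2.trans_lt htκ).trans_le (min_le_right _ _)⟩
      have h1 := hF.deriv_q x (hxU u hu).1 u hu'
      have h2 : HasDerivAt (fun u : ℝ => (u ^ 2 - s ^ 2) / 2) u u := by
        have := (((hasDerivAt_id u).pow 2).sub_const (s ^ 2)).div_const 2
        refine this.congr_deriv ?_
        simp
      exact (h1.sub_const _).sub (h2.smul_const a)
    have hB : ∀ u, HasDerivAt (fun u : ℝ => η * ((u ^ 2 - s ^ 2) / 2)) (η * u) u := by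
      intro u
      have := ((((hasDerivAt_id u).pow 2).sub_const (s ^ 2)).div_const 2).const_mul η
      refine this.congr_deriv ?_
      simp
    have := image_norm_le_of_norm_deriv_right_le_deriv_boundary'
      (f := fun u => q (u, x) - q (s, x) - ((u ^ 2 - s ^ 2) / 2) • a)
      (f' := fun u => velocity H (q (u, x)) (p (u, x)) - u • a)
      (B := fun u : ℝ => η * ((u ^ 2 - s ^ 2) / 2)) (B' := fun u => η * u) (a := s) (b := t)
      (fun u hu => (hd u hu).continuousAt.continuousWithinAt)
      (fun u hu => (hd u ⟨hu.1, hu.2.le⟩).hasDerivWithinAt) (by simp)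
      (fun u _ => (hB u).continuousAt.continuousWithinAt) (fun u _ => (hB u).hasDerivWithinAt)
      (fun u hu => by
        have := (hxU u ⟨hu.1, hu.2.le⟩).2
        rwa [abs_of_nonneg (hs.trans hu.1)] at this)
    exact this (right_mem_Icc.2 hst)
  have hpos : ∀ x ∈ Metric.ball Q δ, x ∈ U → ∀ r r' : ℝ, 0 ≤ r' → r' ≤ r → r < κ ^ 2 →
      ‖unfold q (r, x) - unfold q (r', x) - ((r - r') / 2) • a‖ ≤ η * |r - r'| := by
    intro x hx hxU r r' h0 h1 h2
    have hq : ∀ r : ℝ, 0 ≤ r → unfold q (r, x) = q (√r, x) := by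
      intro r hr
      rcases hr.eq_or_lt with rfl | hr
      · rw [unfold_zero, Real.sqrt_zero, hF.q_zero x hxU]
      · exact unfold_of_pos hr x
    have h3 := hfwd x hx (√r') (√r) (Real.sqrt_nonneg _) (Real.sqrt_le_sqrt h1)
      (by rw [Real.sqrt_lt' hκ0]; exact h2)
    rw [Real.sq_sqrt h0, Real.sq_sqrt (h0.trans h1)] at h3
    rw [hq r (h0.trans h1), hq r' h0, abs_of_nonneg (sub_nonneg.2 h1)]
    refine h3.trans ?_
    have := mul_nonneg hη.le (sub_nonneg.2 h1)
    linarith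
  have hpos' : ∀ x ∈ Metric.ball Q δ, x ∈ U → ∀ r r' : ℝ, 0 ≤ r → 0 ≤ r' → r < κ ^ 2 →
      r' < κ ^ 2 → ‖unfold q (r, x) - unfold q (r', x) - ((r - r') / 2) • a‖ ≤ η * |r - r'| := by
    intro x hx hxU r r' h0 h0' h1 h1'
    rcases le_total r' r with h | h
    · exact hpos x hx hxU r r' h0' h h1
    · have := hpos x hx hxU r' r h0 h h1'
      rw [abs_sub_comm, ← norm_neg, show -(unfold q (r, x) - unfold q (r', x) -
        ((r - r') / 2) • a) = unfold q (r', x) - unfold q (r, x) - ((r' - r) / 2) • a by module]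
      exact this
  have hneg' : ∀ x ∈ Metric.ball Q δ, x ∈ U → ∀ r r' : ℝ, r ≤ 0 → r' ≤ 0 → -r < κ ^ 2 →
      -r' < κ ^ 2 → ‖unfold q (r, x) - unfold q (r', x) - ((r - r') / 2) • a‖ ≤ η * |r - r'| := by
    intro x hx hxU r r' h0 h0' h1 h1'
    have := hpos' x hx hxU (-r) (-r') (neg_nonneg.2 h0) (neg_nonneg.2 h0') h1 h1'
    rw [unfold_neg, unfold_neg, show -r - -r' = r' - r by ring] at this
    rw [abs_sub_comm, ← norm_neg, show -(unfold q (r, x) - unfold q (r', x) -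
      ((r - r') / 2) • a) = (2 : ℝ) • x - unfold q (r, x) - ((2 : ℝ) • x - unfold q (r', x)) -
        ((r' - r) / 2) • a by module]
    exact this
  have hmix : ∀ x ∈ Metric.ball Q δ, x ∈ U → ∀ r r' : ℝ, 0 ≤ r → r' ≤ 0 → r < κ ^ 2 →
      -r' < κ ^ 2 → ‖unfold q (r, x) - unfold q (r', x) - ((r - r') / 2) • a‖ ≤ η * |r - r'| := by
    intro x hx hxU r r' h0 h0' h1 h1'
    have e1 := hpos' x hx hxU r 0 h0 le_rfl h1 (by positivity)
    have e2 := hneg' x hx hxU 0 r' le_rfl h0' (by simpa using by positivity) h1'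
    have e3 : |r - r'| = |r - 0| + |0 - r'| := by
      rw [abs_of_nonneg (by linarith), abs_of_nonneg (by linarith), abs_of_nonneg (by linarith)]
      ring
    rw [e3, mul_add]
    refine le_trans (le_of_eq ?_) ((norm_add_le _ _).trans (add_le_add e1 e2))
    congr 1
    module
  refine ⟨min δ (κ ^ 2), lt_min hδ (by positivity), fun r r' hr hr' x hx => ?_⟩
  have hx' : x ∈ Metric.ball Q δ := Metric.ball_subset_ball (min_le_left _ _) hx
  have hxU : x ∈ U := (hball (0, x) (by rw [← ball_prod_same]; exact ⟨by simpa using hδ, hx'⟩)).2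
  have hr2 := abs_lt.1 (hr.trans_le (min_le_right _ _))
  have hr2' := abs_lt.1 (hr'.trans_le (min_le_right _ _))
  rcases le_total 0 r with h | h <;> rcases le_total 0 r' with h' | h'
  · exact hpos' x hx' hxU r r' h h' hr2.2 hr2'.2
  · exact hmix x hx' hxU r r' h h' hr2.2 (by linarith [hr2'.1])
  · have := hmix x hx' hxU r' r h' h hr2'.2 (by linarith [hr2.1])
    rw [abs_sub_comm, ← norm_neg, show -(unfold q (r, x) - unfold q (r', x) -
      ((r - r') / 2) • a) = unfold q (r', x) - unfold q (r, x) - ((r' - r) / 2) • a by module]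
    exact this
  · exact hneg' x hx' hxU r r' h h' (by linarith [hr2.1]) (by linarith [hr2'.1])

/-- The increment is split into a change of `r` at fixed `x` and a change of `x` at fixed `r'`. -/
theorem hasStrictFDerivAt_unfold (hF : IsRestFlow H ε U q p) (hH : IsClassicalHamiltonian H)
    {Q : Vec n} (hQ : Q ∈ U) :
    HasStrictFDerivAt (unfold q) (ContinuousLinearMap.snd ℝ ℝ (Vec n) +
      (ContinuousLinearMap.fst ℝ ℝ (Vec n)).smulRight ((1 / 2 : ℝ) • restAcceleration H Q))
      (0, Q) := by
  refine HasStrictFDerivAt.of_isLittleO (Asymptotics.IsLittleO.of_bound fun c hc => ?_)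
  obtain ⟨δ₁, hδ₁, h1⟩ := hF.unfold_time_bound hH hQ (half_pos hc)
  obtain ⟨δ₂, hδ₂, h2⟩ := hF.q_sub_isLittleO hQ (half_pos hc)
  -- The time is `√|r|`, so a bound `δ₂` on time requires `δ₂²` for `r`.
  set δ := min δ₁ (min δ₂ (δ₂ ^ 2)) with hδ
  have hδ0 : 0 < δ := lt_min hδ₁ (lt_min hδ₂ (by positivity))
  filter_upwards [Metric.ball_mem_nhds (((0 : ℝ), Q), ((0 : ℝ), Q)) hδ0] with w hw
  rw [← ball_prod_same, ← ball_prod_same] at hw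
  obtain ⟨⟨r, x⟩, ⟨r', x'⟩⟩ := w
  obtain ⟨⟨hr, hx⟩, ⟨hr', hx'⟩⟩ := hw
  simp only [mem_ball_zero_iff, Real.norm_eq_abs] at hr hr'
  have hδ1 : δ ≤ δ₁ := min_le_left _ _
  have hδ2 : δ ≤ δ₂ := (min_le_right _ _).trans (min_le_left _ _)
  have hδ3 : δ ≤ δ₂ ^ 2 := (min_le_right _ _).trans (min_le_right _ _)
  have e1 := h1 r r' (hr.trans_le hδ1) (hr'.trans_le hδ1) x (Metric.ball_subset_ball hδ1 hx)
  have e2 : ‖unfold q (r', x) - unfold q (r', x') - (x - x')‖ ≤ c / 2 * ‖x - x'‖ := by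
    have ht : |√(|r'|)| < δ₂ := by
      rw [abs_of_nonneg (Real.sqrt_nonneg _), Real.sqrt_lt' hδ₂]
      exact hr'.trans_le hδ3
    have := h2 _ ht x (Metric.ball_subset_ball hδ2 hx) x' (Metric.ball_subset_ball hδ2 hx')
    have e : unfold q (r', x) - unfold q (r', x') - (x - x') =
        Real.sign r' • (q (√(|r'|), x) - q (√(|r'|), x') - (x - x')) := by
      simp only [unfold]
      module
    rw [e, norm_smul]
    have hs : ‖Real.sign r'‖ ≤ 1 := by
      rcases Real.sign_apply_eq r' with h | h | h <;> simp [h]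
    calc _ ≤ 1 * ‖q (√(|r'|), x) - q (√(|r'|), x') - (x - x')‖ := by gcongr
      _ ≤ _ := by rw [one_mul]; exact this
  have e3 : |r - r'| ≤ ‖((r, x), (r', x')).1 - ((r, x), (r', x')).2‖ := by
    rw [Prod.norm_def]; exact le_max_left _ _
  have e4 : ‖x - x'‖ ≤ ‖((r, x), (r', x')).1 - ((r, x), (r', x')).2‖ := by
    rw [Prod.norm_def]; exact le_max_right _ _
  have e5 : unfold q (r, x) - unfold q (r', x') - (ContinuousLinearMap.snd ℝ ℝ (Vec n) +
      (ContinuousLinearMap.fst ℝ ℝ (Vec n)).smulRight ((1 / 2 : ℝ) • restAcceleration H Q))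
      ((r, x) - (r', x')) =
      (unfold q (r, x) - unfold q (r', x) - ((r - r') / 2) • restAcceleration H Q) +
      (unfold q (r', x) - unfold q (r', x') - (x - x')) := by
    simp
    module
  change ‖unfold q (r, x) - unfold q (r', x') - (ContinuousLinearMap.snd ℝ ℝ (Vec n) +
      (ContinuousLinearMap.fst ℝ ℝ (Vec n)).smulRight ((1 / 2 : ℝ) • restAcceleration H Q))
      ((r, x) - (r', x'))‖ ≤ _
  rw [e5]
  refine (norm_add_le _ _).trans ((add_le_add e1 e2).trans ?_)
  have := mul_le_mul_of_nonneg_left e3 (half_pos hc).le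
  have := mul_le_mul_of_nonneg_left e4 (half_pos hc).le
  linarith

end IsRestFlow

end BrakeOrbits

end

/-! ### The shooting map and the notion of collar chart -/

/-- Derivatives near a point of invertible strict differentiability are invertible. -/
theorem HasStrictFDerivAt.eventually_exists_equiv {V W : Type*} [NormedAddCommGroup V]
    [NormedSpace ℝ V] [CompleteSpace V] [NormedAddCommGroup W] [NormedSpace ℝ W]
    {f : V → W} {e : V ≃L[ℝ] W} {a : V} (hf : HasStrictFDerivAt f (e : V →L[ℝ] W) a) :
    ∀ᶠ w in 𝓝 a, ∀ f' : V →L[ℝ] W, HasFDerivAt f f' w →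
      ∃ e' : V ≃L[ℝ] W, (e' : V →L[ℝ] W) = f' := by
  obtain ⟨c, hc, hball⟩ := Metric.mem_nhds_iff.1 e.nhds
  obtain ⟨δ, hδ, h⟩ := Metric.eventually_nhds_iff_ball.1 (hf.isLittleO.def (half_pos hc))
  filter_upwards [Metric.ball_mem_nhds a hδ] with w hw f' hf'
  have h1 : HasFDerivAt (fun x => f x - e x) (f' - (e : V →L[ℝ] W)) w :=
    hf'.sub (e : V →L[ℝ] W).hasFDerivAt
  have h2 : ‖f' - (e : V →L[ℝ] W)‖ ≤ c / 2 := by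
    refine h1.le_of_lip' (by positivity) ?_
    filter_upwards [Metric.isOpen_ball.mem_nhds hw] with x hx
    have := h (x, w) (by rw [← ball_prod_same]; exact ⟨hx, hw⟩)
    refine le_trans (le_of_eq ?_) this
    congr 1
    simp only [ContinuousLinearEquiv.coe_coe, map_sub]
    abel
  exact hball (by rw [mem_ball_iff_norm]; linarith)

/-- A continuous function is strictly increasing if its values to the left of each point are
locally smaller. -/
theorem strictMonoOn_of_eventually_lt {d : ℝ → ℝ} {T : ℝ} (hd : ContinuousOn d (Icc 0 T))
    (h : ∀ t ∈ Ioc 0 T, ∀ᶠ s in 𝓝[<] t, d s < d t) : StrictMonoOn d (Icc 0 T) := by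
  intro a ha b hb hab
  have hmin : ∀ c ∈ Ioc a b, ∃ s ∈ Icc a b, d s < d c := by
    intro c hc
    obtain ⟨s, hs, hs'⟩ := ((h c ⟨ha.1.trans_lt hc.1, hc.2.trans hb.2⟩).and
      (Ioo_mem_nhdsLT hc.1)).exists
    exact ⟨s, ⟨hs'.1.le, hs'.2.le.trans hc.2⟩, hs⟩
  obtain ⟨c, hc, hcm⟩ := isCompact_Icc.exists_isMinOn (nonempty_Icc.2 hab.le)
    (hd.mono (Icc_subset_Icc ha.1 hb.2))
  rcases hc.1.eq_or_lt with rfl | hac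
  · refine lt_of_le_of_ne (hcm (right_mem_Icc.2 hab.le)) fun heq => ?_
    obtain ⟨s, hs, hsb⟩ := hmin b (right_mem_Ioc.2 hab)
    have : d a ≤ d s := hcm hs
    linarith
  · obtain ⟨s, hs, hsc⟩ := hmin c ⟨hac, hc.2⟩
    exact absurd (hcm hs) (not_le.2 hsc)

noncomputable section

namespace BrakeOrbits

variable {n : ℕ} {H : Vec n → Vec n → ℝ} {E : ℝ} {D : Set (Vec n)}

/-- The time-squared flow together with the energy of the initial point. -/
def shoot (H : Vec n → Vec n → ℝ) (q : ℝ × Vec n → Vec n) (w : ℝ × Vec n) : ℝ × Vec n :=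
  (potential H w.2, IsRestFlow.unfold q w)

/-- Coordinates on the collar of a potential well by solutions starting at rest on the boundary. -/
structure IsCollarChart (H : Vec n → Vec n → ℝ) (E : ℝ) (D : Set (Vec n)) (t₁ : ℝ)
    (q p : ℝ × Vec n → Vec n) : Prop where
  pos : 0 < t₁
  contDiffAt_q : ∀ t ∈ Icc 0 t₁, ∀ x ∈ frontier D, ContDiffAt ℝ 1 q (t, x)
  contDiffAt_p : ∀ t ∈ Icc 0 t₁, ∀ x ∈ frontier D, ContDiffAt ℝ 1 p (t, x)
  q_zero : ∀ x ∈ frontier D, q (0, x) = x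
  p_zero : ∀ x ∈ frontier D, p (0, x) = 0
  deriv_q : ∀ x ∈ frontier D, ∀ t ∈ Icc 0 t₁,
    HasDerivAt (fun s => q (s, x)) (velocity H (q (t, x)) (p (t, x))) t
  deriv_p : ∀ x ∈ frontier D, ∀ t ∈ Icc 0 t₁,
    HasDerivAt (fun s => p (s, x)) (-positionGradient H (q (t, x)) (p (t, x))) t
  mem : ∀ x ∈ frontier D, ∀ t ∈ Ioc 0 t₁, q (t, x) ∈ D
  injOn : InjOn q (Icc 0 t₁ ×ˢ frontier D)
  collar : ∀ t₂, 0 < t₂ → ∃ δ > 0, ∀ y ∈ D, Metric.infDist y (frontier D) < δ →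
    ∃ t ∈ Ioo 0 t₂, ∃ x ∈ frontier D, q (t, x) = y
  inverse : ∀ t ∈ Ioo 0 t₁, ∀ x ∈ frontier D, ∃ g : Vec n → ℝ × Vec n,
    ContDiffAt ℝ 1 g (q (t, x)) ∧
      ∀ᶠ y in 𝓝 (q (t, x)), g y ∈ Ioo 0 t₁ ×ˢ frontier D ∧ q (g y) = y
  strictMonoOn : ∀ x ∈ frontier D,
    StrictMonoOn (fun t => Metric.infDist (q (t, x)) (frontier D)) (Icc 0 t₁)

namespace IsRestFlow

variable {ε : ℝ} {U : Set (Vec n)} {q p : ℝ × Vec n → Vec n}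

theorem unfold_sq (hF : IsRestFlow H ε U q p) {t : ℝ} (ht : 0 ≤ t) {x : Vec n} (hx : x ∈ U) :
    unfold q (t ^ 2, x) = q (t, x) := by
  rcases ht.eq_or_lt with rfl | h
  · rw [zero_pow two_ne_zero, unfold_zero, hF.q_zero x hx]
  · rw [unfold_of_pos (by positivity), Real.sqrt_sq ht]

/-- The derivative is `(r, v) ↦ (⟨N, v⟩, v + r/2 a)`: on its kernel `r ⟨N, a⟩ = 0`, hence `r = 0`
and `v = 0`. Carrying `V(x)` as an extra coordinate replaces a parametrization of `∂D`, which is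
recovered as the slice `V = E`. -/
theorem exists_hasStrictFDerivAt_shoot (hF : IsRestFlow H ε U q p)
    (hH : IsClassicalHamiltonian H) {Q : Vec n} (hQ : Q ∈ U) (hN : positionGradient H Q 0 ≠ 0) :
    ∃ e : (ℝ × Vec n) ≃L[ℝ] (ℝ × Vec n),
      HasStrictFDerivAt (shoot H q) (e : (ℝ × Vec n) →L[ℝ] (ℝ × Vec n)) (0, Q) := by
  set N := positionGradient H Q 0
  set a := restAcceleration H Q
  set L : (ℝ × Vec n) →L[ℝ] (ℝ × Vec n) :=
    ((innerSL ℝ N).comp (ContinuousLinearMap.snd ℝ ℝ (Vec n))).prod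
      (ContinuousLinearMap.snd ℝ ℝ (Vec n) +
        (ContinuousLinearMap.fst ℝ ℝ (Vec n)).smulRight ((1 / 2 : ℝ) • a)) with hL
  have hs : HasStrictFDerivAt (shoot H q) L (0, Q) := by
    refine HasStrictFDerivAt.prodMk ?_ (hF.hasStrictFDerivAt_unfold hH hQ)
    have h1 : HasStrictFDerivAt (potential H) (innerSL ℝ N) Q :=
      hH.contDiff_potential.contDiffAt.hasStrictFDerivAt' (hH.hasFDerivAt_potential Q) two_ne_zero
    exact HasStrictFDerivAt.comp (f := fun w : ℝ × Vec n => w.2) (0, Q) h1 hasStrictFDerivAt_snd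
  have hNa : inner ℝ N a < 0 := hH.inner_restAcceleration_neg hN
  have hinj : Function.Injective (L : (ℝ × Vec n) →ₗ[ℝ] (ℝ × Vec n)) := by
    rw [← LinearMap.ker_eq_bot, LinearMap.ker_eq_bot']
    rintro ⟨r, v⟩ hrv
    have h1 : inner ℝ N v = 0 := congrArg Prod.fst hrv
    have h2 : v + r • ((1 / 2 : ℝ) • a) = 0 := congrArg Prod.snd hrv
    have h3 : inner ℝ N (v + r • ((1 / 2 : ℝ) • a)) = 0 := by rw [h2, inner_zero_right]
    rw [inner_add_right, h1, inner_smul_right, inner_smul_right, zero_add] at h3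
    have h4 : r = 0 := by
      rcases mul_eq_zero.1 h3 with h | h
      · exact h
      · linarith
    subst h4
    rw [zero_smul, add_zero] at h2
    rw [h2]
    rfl
  refine ⟨(LinearEquiv.ofInjectiveEndo (L : (ℝ × Vec n) →ₗ[ℝ] (ℝ × Vec n))
    hinj).toContinuousLinearEquiv, ?_⟩
  have : (((LinearEquiv.ofInjectiveEndo (L : (ℝ × Vec n) →ₗ[ℝ] (ℝ × Vec n))
      hinj).toContinuousLinearEquiv : (ℝ × Vec n) ≃L[ℝ] (ℝ × Vec n)) :
        (ℝ × Vec n) →L[ℝ] (ℝ × Vec n)) = L := by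
    exact ContinuousLinearMap.ext fun w => rfl
  rw [this]
  exact hs

/-- To first order `V` changes by `r/2 ⟨N, a⟩`, so the sign of `r` tells the two sides of the
boundary apart. -/
theorem eventually_potential_unfold (hF : IsRestFlow H ε U q p) (hH : IsClassicalHamiltonian H)
    {Q : Vec n} (hQ : Q ∈ U) (hN : positionGradient H Q 0 ≠ 0) :
    ∀ᶠ w in 𝓝 ((0 : ℝ), Q), (0 < w.1 → potential H (unfold q w) < potential H w.2) ∧
      (w.1 < 0 → potential H w.2 < potential H (unfold q w)) := by
  set N := positionGradient H Q 0
  set a := restAcceleration H Q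
  have hNa : inner ℝ N a < 0 := hH.inner_restAcceleration_neg hN
  have h1 : HasStrictFDerivAt (potential H) (innerSL ℝ N) (unfold q (0, Q)) := by
    rw [unfold_zero]
    exact hH.contDiff_potential.contDiffAt.hasStrictFDerivAt' (hH.hasFDerivAt_potential Q) two_ne_zero
  have h2 := HasStrictFDerivAt.comp (0, Q) h1 (hF.hasStrictFDerivAt_unfold hH hQ)
  have hpair : Tendsto (fun w : ℝ × Vec n => (w, ((0 : ℝ), w.2))) (𝓝 (0, Q))
      (𝓝 (((0 : ℝ), Q), ((0 : ℝ), Q))) := by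
    have : Continuous (fun w : ℝ × Vec n => (w, ((0 : ℝ), w.2))) := by fun_prop
    exact this.tendsto _
  filter_upwards [hpair.eventually (h2.isLittleO.def (c := -inner ℝ N a / 4) (by linarith))] with w hw
  obtain ⟨r, x⟩ := w
  have hsub : ((r, x) : ℝ × Vec n) - (0, x) = (r, 0) := by simp
  simp only [unfold_zero, hsub, Prod.norm_def, norm_zero, Real.norm_eq_abs,
    ContinuousLinearMap.comp_apply, innerSL_apply_apply, add_apply,
    ContinuousLinearMap.smulRight_apply, ContinuousLinearMap.coe_fst', ContinuousLinearMap.coe_snd',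
    zero_add, inner_smul_right, abs_nonneg, sup_of_le_left] at hw
  have hw' := abs_le.1 hw
  constructor
  · intro hr
    simp only at hr ⊢
    rw [abs_of_pos hr] at hw'
    have := mul_neg_of_pos_of_neg hr hNa
    linarith [hw'.2]
  · intro hr
    simp only at hr ⊢
    rw [abs_of_neg hr] at hw'
    have := mul_pos_of_neg_of_neg hr hNa
    linarith [hw'.1]

/-- The gradient is taken at a second point, independent of the start of the orbit: it will be the
boundary point nearest to the orbit, which need not be its starting point. -/
theorem eventually_inner_velocity_neg (hF : IsRestFlow H ε U q p) (hH : IsClassicalHamiltonian H)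
    {Q : Vec n} (hQ : Q ∈ U) (hN : positionGradient H Q 0 ≠ 0) :
    ∀ᶠ w in 𝓝 (((0 : ℝ), Q), Q), 0 < w.1.1 →
      inner ℝ (positionGradient H w.2 0) (velocity H (q w.1) (p w.1)) < 0 := by
  set N := positionGradient H Q 0
  set a := restAcceleration H Q
  have hNa : inner ℝ N a < 0 := hH.inner_restAcceleration_neg hN
  have hN0 : 0 < ‖N‖ := norm_pos_iff.2 hN
  set η := -inner ℝ N a / (4 * ‖N‖) with hη
  have hη0 : 0 < η := div_pos (by linarith) (by positivity)
  have hc : Continuous fun x : Vec n => positionGradient H x 0 :=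
    hH.contDiff_positionGradient.continuous.comp
      (by fun_prop : Continuous fun x : Vec n => (x, (0 : Vec n)))
  have e1 : ∀ᶠ w in 𝓝 (((0 : ℝ), Q), Q), inner ℝ (positionGradient H w.2 0) a < inner ℝ N a / 2 := by
    have : ContinuousAt (fun w : (ℝ × Vec n) × Vec n => inner ℝ (positionGradient H w.2 0) a)
        (((0 : ℝ), Q), Q) := by
      have : Continuous fun w : (ℝ × Vec n) × Vec n => inner ℝ (positionGradient H w.2 0) a :=
        (hc.comp continuous_snd).inner continuous_const
      exact this.continuousAt
    exact this.eventually (gt_mem_nhds (by change inner ℝ N a < _; linarith))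
  have e2 : ∀ᶠ w in 𝓝 (((0 : ℝ), Q), Q), ‖positionGradient H w.2 0‖ < 2 * ‖N‖ := by
    have : Continuous fun w : (ℝ × Vec n) × Vec n => ‖positionGradient H w.2 0‖ :=
      (hc.comp continuous_snd).norm
    exact this.continuousAt.eventually (gt_mem_nhds (by change ‖N‖ < _; linarith))
  have e3 := continuous_fst.continuousAt (x := (((0 : ℝ), Q), Q)) |>.eventually
    (hF.velocity_isLittleO hH hQ hη0)
  filter_upwards [e1, e2, e3] with w h1 h2 h3 hr
  rw [abs_of_pos hr] at h3
  set N' := positionGradient H w.2 0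
  set g := velocity H (q w.1) (p w.1)
  have h4 : inner ℝ N' g = w.1.1 * inner ℝ N' a + inner ℝ N' (g - w.1.1 • a) := by
    rw [inner_sub_right, inner_smul_right]; ring
  have h5 : inner ℝ N' (g - w.1.1 • a) ≤ 2 * ‖N‖ * (η * w.1.1) :=
    (real_inner_le_norm _ _).trans (mul_le_mul h2.le h3 (norm_nonneg _) (by positivity))
  have h6 : 2 * ‖N‖ * (η * w.1.1) = -(w.1.1 * (inner ℝ N a / 2)) := by
    rw [hη]; field_simp; ring
  have h7 := mul_lt_mul_of_pos_left h1 hr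
  linarith

end IsRestFlow

/-- Moving against the potential gradient increases the distance to the boundary. -/
theorem IsPotentialWell.inner_pos_of_nearest (hH : IsClassicalHamiltonian H)
    (hD : IsPotentialWell H E D) {y Q w : Vec n} (hy : y ∈ D) (hQ : Q ∈ frontier D)
    (hd : ∀ z ∈ frontier D, dist y Q ≤ dist y z)
    (hw : inner ℝ (positionGradient H Q 0) w < 0) : 0 < inner ℝ (y - Q) w := by
  have hyQ : y - Q ≠ 0 := fun h => hD.notMem_of_mem_frontier hQ (sub_eq_zero.1 h ▸ hy)
  -- The ball around `y` that touches `∂D` at `Q` lies in `D`. Directions entering it cannot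
  -- increase `V` at `Q` to first order, so `∇V(Q)` is a nonnegative multiple of `-(y - Q)`.
  have hball : Metric.ball y (dist y Q) ⊆ D :=
    hD.subset_of_isPreconnected (convex_ball _ _).isPreconnected
      (fun z hz hzf => by
        have := hd z hzf
        rw [Metric.mem_ball, dist_comm] at hz
        linarith) ⟨y, Metric.mem_ball_self (dist_pos.2 (sub_ne_zero.1 hyQ)), hy⟩
  obtain ⟨c, hc, hcm⟩ := exists_nonneg_smul_of_halfspace (m := -(y - Q))
    (v := positionGradient H Q 0) (neg_ne_zero.2 hyQ) (by
      intro u hu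
      rw [inner_neg_left, neg_lt_zero] at hu
      have hline : HasDerivAt (fun s : ℝ => Q + s • u) u 0 := by
        simpa using ((hasDerivAt_id (0 : ℝ)).smul_const u).const_add Q
      have h1 : HasDerivAt (fun s : ℝ => potential H (Q + s • u))
          (inner ℝ (positionGradient H Q 0) u) 0 := by
        have := HasFDerivAt.comp_hasDerivAt (0 : ℝ) (f := fun s : ℝ => Q + s • u)
          (by simpa using hH.hasFDerivAt_potential Q) hline
        exact this
      have h2 : HasDerivAt (fun s : ℝ => ‖y - (Q + s • u)‖ ^ 2) (-(2 * inner ℝ (y - Q) u)) 0 := by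
        have := (hline.const_sub y).norm_sq
        simpa using this
      have h3 : ∀ᶠ s in 𝓝[>] (0 : ℝ), ‖y - (Q + s • u)‖ ^ 2 < ‖y - Q‖ ^ 2 := by
        have e1 := (hasDerivWithinAt_iff_tendsto_slope' (by simp)).1
          (h2.hasDerivWithinAt (s := Ioi 0))
        filter_upwards [e1.eventually (gt_mem_nhds (show -(2 * inner ℝ (y - Q) u) < 0 by linarith)), self_mem_nhdsWithin] with s hs hs0
        rw [slope_def_field, sub_zero, zero_smul, add_zero] at hs
        have := (div_lt_iff₀ (show (0:ℝ) < s from hs0)).1 hs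
        rw [zero_mul] at this
        linarith
      have e2 := (hasDerivWithinAt_iff_tendsto_slope' (by simp)).1
        (h1.hasDerivWithinAt (s := Ioi 0))
      refine le_of_tendsto e2 ?_
      filter_upwards [h3, self_mem_nhdsWithin] with s hs hs0
      have hmem : Q + s • u ∈ D := hball (by
        rw [Metric.mem_ball, dist_comm, dist_eq_norm, dist_eq_norm]
        exact lt_of_pow_lt_pow_left₀ 2 (norm_nonneg _) hs)
      rw [slope_def_field, sub_zero, zero_smul, add_zero, hD.potential_eq Q hQ]
      exact div_nonpos_of_nonpos_of_nonneg (by linarith [hD.potential_lt _ hmem])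
        (show (0:ℝ) < s from hs0).le)
  rw [hcm, inner_smul_left, inner_neg_left] at hw
  simp only [conj_trivial] at hw
  by_contra h
  have := mul_nonneg hc (neg_nonneg.2 (not_lt.1 h))
  linarith

end BrakeOrbits
end

/-! ### Construction of the collar chart -/

noncomputable section

namespace BrakeOrbits

variable {n : ℕ} {H : Vec n → Vec n → ℝ} {E : ℝ} {D : Set (Vec n)}

/-- For `t > 0` the substitution `r = t²` is smooth, so the shooting map is `C¹` at `(t², x)`. The
required inverse is its local inverse on the slice where the first coordinate is `V(x)`, followed by
a square root. -/
theorem IsRestFlow.exists_local_inverse {ε : ℝ} {U : Set (Vec n)} {q p : ℝ × Vec n → Vec n}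
    (hF : IsRestFlow H ε U q p) (hH : IsClassicalHamiltonian H) {t : ℝ} (ht0 : 0 < t) (htε : t < ε)
    {x : Vec n} (hx : x ∈ U)
    (hinv : ∀ f', HasFDerivAt (shoot H q) f' (t ^ 2, x) →
      ∃ e : (ℝ × Vec n) ≃L[ℝ] (ℝ × Vec n), (e : (ℝ × Vec n) →L[ℝ] (ℝ × Vec n)) = f') :
    ∃ g : Vec n → ℝ × Vec n, ContDiffAt ℝ 1 g (q (t, x)) ∧ g (q (t, x)) = (t, x) ∧
      ∀ᶠ y in 𝓝 (q (t, x)), potential H (g y).2 = potential H x ∧ q (g y) = y := by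
  have hc : ContDiffAt ℝ 1 (shoot H q) (t ^ 2, x) := by
    refine ContDiffAt.prodMk ?_ ?_
    · exact (hH.contDiff_potential.of_le one_le_two).contDiffAt.comp _ contDiffAt_snd
    · have h1 : ContDiffAt ℝ 1 (fun w : ℝ × Vec n => (√w.1, w.2)) (t ^ 2, x) :=
        (contDiffAt_fst.sqrt (by positivity)).prodMk contDiffAt_snd
      have h2 : ContDiffAt ℝ 1 q ((fun w : ℝ × Vec n => (√w.1, w.2)) (t ^ 2, x)) := by
        simp only [Real.sqrt_sq ht0.le]
        exact hF.contDiffAt_q ⟨by linarith, htε⟩ hx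
      refine (h2.comp (t ^ 2, x) h1).congr_of_eventuallyEq ?_
      have : ∀ᶠ w : ℝ × Vec n in 𝓝 (t ^ 2, x), 0 < w.1 :=
        continuous_fst.continuousAt.eventually (lt_mem_nhds (by positivity))
      filter_upwards [this] with w hw
      exact IsRestFlow.unfold_of_pos hw w.2
  obtain ⟨e, he⟩ := hinv _ (hc.differentiableAt one_ne_zero).hasFDerivAt
  have hd : HasFDerivAt (shoot H q) (e : (ℝ × Vec n) →L[ℝ] (ℝ × Vec n)) (t ^ 2, x) := by
    rw [he]; exact (hc.differentiableAt one_ne_zero).hasFDerivAt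
  have hval : shoot H q (t ^ 2, x) = (potential H x, q (t, x)) := by
    rw [shoot, hF.unfold_sq ht0.le hx]
  set G := hc.localInverse hd one_ne_zero with hG
  have hGc : ContDiffAt ℝ 1 G (potential H x, q (t, x)) := by
    rw [← hval]; exact hc.to_localInverse hd one_ne_zero
  have hG0 : G (potential H x, q (t, x)) = (t ^ 2, x) := by
    rw [← hval]
    exact (hc.hasStrictFDerivAt' hd one_ne_zero).localInverse_apply_image
  have hGr : ∀ᶠ z in 𝓝 (potential H x, q (t, x)), shoot H q (G z) = z := by
    rw [← hval]
    exact (hc.hasStrictFDerivAt' hd one_ne_zero).eventually_right_inverse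
  have hpair : ContDiff ℝ 1 fun y : Vec n => (potential H x, y) := by fun_prop
  have hg1 : ContDiffAt ℝ 1 (fun y => G (potential H x, y)) (q (t, x)) :=
    ContDiffAt.comp (g := G) (f := fun y : Vec n => (potential H x, y)) (q (t, x)) hGc
      hpair.contDiffAt
  have hpos : ∀ᶠ y in 𝓝 (q (t, x)), 0 < (G (potential H x, y)).1 := by
    refine (continuous_fst.continuousAt.comp hg1.continuousAt).eventually (lt_mem_nhds ?_)
    simp only [Function.comp_apply, hG0]
    positivity
  refine ⟨fun y => (√(G (potential H x, y)).1, (G (potential H x, y)).2), ?_, ?_, ?_⟩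
  · exact ((hg1.fst).sqrt (by rw [hG0]; positivity)).prodMk hg1.snd
  · simp only [hG0, Real.sqrt_sq ht0.le]
  · filter_upwards [hpos, (hpair.continuous.tendsto (q (t, x))).eventually hGr] with y hy hy'
    refine ⟨congrArg Prod.fst hy', ?_⟩
    have h2 : IsRestFlow.unfold q (G (potential H x, y)) = y := congrArg Prod.snd hy'
    rwa [show G (potential H x, y) = ((G (potential H x, y)).1, (G (potential H x, y)).2) from rfl,
      IsRestFlow.unfold_of_pos hy] at h2

/-- Each property of a chart holds near every point `(0, Q)` with `Q ∈ ∂D`; compactness of `{0} ×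
∂D` yields one time `t₁` for all of them. -/
theorem IsPotentialWell.exists_collarChart (hH : IsClassicalHamiltonian H)
    (hD : IsPotentialWell H E D) (hDc : IsCompact (closure D)) (hMne : (frontier D).Nonempty) :
    ∃ t₁ q p, IsCollarChart H E D t₁ q p := by
  set M := frontier D with hM
  have hMc : IsCompact M := hDc.of_isClosed_subset isClosed_frontier frontier_subset_closure
  obtain ⟨ε, U, q, p, hMU, hF⟩ := hH.exists_restFlow hMc
  have hN : ∀ Q ∈ M, positionGradient H Q 0 ≠ 0 := fun Q hQ => hD.positionGradient_ne_zero hQ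
  have hVM : ∀ Q ∈ M, potential H Q = E := hD.potential_eq
  choose! e he using fun Q (hQ : Q ∈ M) =>
    hF.exists_hasStrictFDerivAt_shoot hH (hMU hQ) (hN Q hQ)
  set K : Set (ℝ × Vec n) := (fun x : Vec n => ((0 : ℝ), x)) '' M with hK
  have hKc : IsCompact K := hMc.image (by fun_prop)
  -- local injectivity
  obtain ⟨T, hT, hTinj⟩ : ∃ T ∈ 𝓝ˢ K, InjOn (shoot H q) T := by
    refine Set.InjOn.exists_mem_nhdsSet ?_ hKc ?_ ?_
    · rintro _ ⟨x, hx, rfl⟩ _ ⟨x', hx', rfl⟩ h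
      have := congrArg Prod.snd h
      simp only [shoot, IsRestFlow.unfold_zero] at this
      rw [this]
    · rintro _ ⟨x, hx, rfl⟩
      exact (he x hx).continuousAt
    · rintro _ ⟨x, hx, rfl⟩
      have h1 := (he x hx).eventually_left_inverse
      refine ⟨_, h1, fun a ha b hb hab => ?_⟩
      rw [← show _ = a from ha, ← show _ = b from hb, hab]
  have hunf : ∀ Q ∈ M, ContinuousAt (IsRestFlow.unfold q) (0, Q) := fun Q hQ =>
    (hF.hasStrictFDerivAt_unfold hH (hMU hQ)).continuousAt
  let P : ℝ × Vec n → Prop := fun w =>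
    w ∈ T ∧ w.2 ∈ U ∧ (potential H w.2 = E → w.2 ∈ M) ∧
    (0 < w.1 → potential H (IsRestFlow.unfold q w) < potential H w.2) ∧
    (w.1 < 0 → potential H w.2 < potential H (IsRestFlow.unfold q w)) ∧
    (potential H (IsRestFlow.unfold q w) < E → IsRestFlow.unfold q w ∈ D) ∧
    ∀ f', HasFDerivAt (shoot H q) f' w →
      ∃ e : (ℝ × Vec n) ≃L[ℝ] (ℝ × Vec n), (e : (ℝ × Vec n) →L[ℝ] (ℝ × Vec n)) = f'
  have hP : ∀ w ∈ K, ∀ᶠ w' in 𝓝 w, P w' := by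
    rintro _ ⟨Q, hQ, rfl⟩
    have hsnd : Tendsto (Prod.snd : ℝ × Vec n → Vec n) (𝓝 (0, Q)) (𝓝 Q) :=
      continuous_snd.tendsto _
    have h1 : ∀ᶠ w in 𝓝 ((0 : ℝ), Q), w ∈ T := by
      exact (mem_nhdsSet_iff_forall.1 hT) _ (mem_image_of_mem _ hQ)
    have h2 := hunf Q hQ
    rw [ContinuousAt, IsRestFlow.unfold_zero] at h2
    filter_upwards [h1, hsnd.eventually (hF.isOpen.mem_nhds (hMU hQ)),
      hsnd.eventually (hD.eventually_mem_frontier_of_potential_eq hH hQ),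
      hF.eventually_potential_unfold hH (hMU hQ) (hN Q hQ),
      h2.eventually (hD.eventually_mem_of_potential_lt hH hQ),
      (he Q hQ).eventually_exists_equiv] with w a1 a2 a3 a4 a5 a6
    exact ⟨a1, a2, a3, a4.1, a4.2, a5, a6⟩
  obtain ⟨δ₀, hδ₀, hPδ⟩ := exists_uniform_radius hKc hP
  obtain ⟨δ₅, hδ₅, hneg⟩ := exists_uniform_radius
    (K := (fun x : Vec n => (((0 : ℝ), x), x)) '' M) (hMc.image (by fun_prop))
    (P := fun w => 0 < w.1.1 →
      inner ℝ (positionGradient H w.2 0) (velocity H (q w.1) (p w.1)) < 0) (by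
        rintro _ ⟨Q, hQ, rfl⟩
        exact hF.eventually_inner_velocity_neg hH (hMU hQ) (hN Q hQ))
  obtain ⟨δ₆, hδ₆, hclose⟩ := exists_uniform_radius hKc
    (P := fun w => dist (q w) w.2 < δ₅ / 2) (by
        rintro _ ⟨Q, hQ, rfl⟩
        have h1 : ContinuousAt (fun w : ℝ × Vec n => dist (q w) w.2) (0, Q) :=
          (hF.contDiffAt_q hF.zero_mem (hMU hQ)).continuousAt.dist continuous_snd.continuousAt
        refine h1.eventually (gt_mem_nhds ?_)
        simp only [hF.q_zero Q (hMU hQ), dist_self]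
        positivity)
  -- The bound `1` gives `t² ≤ t`, so that smallness of `t` also ensures smallness of `r = t²`.
  set m := min 1 (min ε (min δ₀ (min δ₅ δ₆))) with hm
  have hm0 : 0 < m := lt_min one_pos (lt_min hF.pos (lt_min hδ₀ (lt_min hδ₅ hδ₆)))
  set t₁ := m / 2 with ht₁
  have ht₁0 : 0 < t₁ := half_pos hm0
  have ht₁m : t₁ < m := half_lt_self hm0
  have hmε : m ≤ ε := (min_le_right _ _).trans (min_le_left _ _)
  have hmδ₀ : m ≤ δ₀ := (min_le_right _ _).trans ((min_le_right _ _).trans (min_le_left _ _))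
  have hmδ₅ : m ≤ δ₅ := (min_le_right _ _).trans ((min_le_right _ _).trans
    ((min_le_right _ _).trans (min_le_left _ _)))
  have hmδ₆ : m ≤ δ₆ := (min_le_right _ _).trans ((min_le_right _ _).trans
    ((min_le_right _ _).trans (min_le_right _ _)))
  have hm1 : m ≤ 1 := min_le_left _ _
  have hdist : ∀ (r : ℝ) (x : Vec n), dist ((r, x) : ℝ × Vec n) (0, x) = |r| := by
    intro r x
    rw [Prod.dist_eq]
    simp
  have hIcc : ∀ t ∈ Icc 0 t₁, t ∈ Ioo (-ε) ε := fun t ht =>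
    ⟨by linarith [ht.1, hF.pos], by linarith [ht.2]⟩
  have hsq : ∀ t ∈ Icc 0 t₁, |t ^ 2| < δ₀ := by
    intro t ht
    rw [abs_of_nonneg (by positivity)]
    have : t ^ 2 ≤ t := by nlinarith [ht.1, ht.2]
    linarith [ht.2]
  have hPt : ∀ x ∈ M, ∀ t ∈ Icc 0 t₁, P (t ^ 2, x) := fun x hx t ht =>
    hPδ (0, x) (mem_image_of_mem _ hx) (t ^ 2, x) (by rw [hdist]; exact hsq t ht)
  have hunfq : ∀ x ∈ M, ∀ t ∈ Icc 0 t₁, IsRestFlow.unfold q (t ^ 2, x) = q (t, x) :=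
    fun x hx t ht => hF.unfold_sq ht.1 (hMU hx)
  have hmem : ∀ x ∈ M, ∀ t ∈ Ioc 0 t₁, q (t, x) ∈ D := by
    intro x hx t ht
    have ht' : t ∈ Icc 0 t₁ := ⟨ht.1.le, ht.2⟩
    obtain ⟨-, -, -, h4, -, h6, -⟩ := hPt x hx t ht'
    have h7 := h4 (by have := ht.1; positivity)
    rw [hVM x hx] at h7
    have h8 := h6 h7
    rwa [hunfq x hx t ht'] at h8
  have hinjOn : InjOn q (Icc 0 t₁ ×ˢ M) := by
    rintro ⟨t, x⟩ ⟨ht, hx⟩ ⟨t', x'⟩ ⟨ht', hx'⟩ h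
    have h1 : shoot H q (t ^ 2, x) = shoot H q (t' ^ 2, x') := by
      simp only [shoot]
      rw [hunfq x hx t ht, hunfq x' hx' t' ht', hVM x hx, hVM x' hx', h]
    have h2 := hTinj (hPt x hx t ht).1 (hPt x' hx' t' ht').1 h1
    rw [Prod.mk.injEq] at h2 ⊢
    exact ⟨(pow_left_inj₀ ht.1 ht'.1 two_ne_zero).1 h2.1, h2.2⟩
  refine ⟨t₁, q, p, ht₁0, fun t ht x hx => hF.contDiffAt_q (hIcc t ht) (hMU hx),
    fun t ht x hx => hF.contDiffAt_p (hIcc t ht) (hMU hx), fun x hx => hF.q_zero x (hMU hx),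
    fun x hx => hF.p_zero x (hMU hx), fun x hx t ht => hF.deriv_q x (hMU hx) t (hIcc t ht),
    fun x hx t ht => hF.deriv_p x (hMU hx) t (hIcc t ht), hmem, hinjOn, ?_, ?_, ?_⟩
  · -- the image covers a collar
    intro t₂ ht₂
    set ρ := min δ₀ (t₂ ^ 2) with hρ
    have hρ0 : 0 < ρ := lt_min hδ₀ (by positivity)
    obtain ⟨δ, hδ, hcov⟩ := exists_uniform_radius hMc
      (P := fun y => ∃ Q ∈ M, ∃ w, dist w ((0 : ℝ), Q) < ρ ∧ shoot H q w = (E, y)) (by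
        intro Q hQ
        -- The shooting map is open at `(0, Q)`, so the points `(E, y)` with `y` near `Q` are
        -- reached from starting points with `V = E`.
        have h1 : shoot H q '' Metric.ball (0, Q) ρ ∈ 𝓝 (E, Q) := by
          have h2 := (he Q hQ).map_nhds_eq_of_equiv
          have h3 : shoot H q (0, Q) = (E, Q) := by
            rw [shoot, IsRestFlow.unfold_zero, hVM Q hQ]
          rw [← h3, ← h2]
          exact image_mem_map (Metric.ball_mem_nhds _ hρ0)
        have h4 : Tendsto (fun y : Vec n => (E, y)) (𝓝 Q) (𝓝 (E, Q)) := by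
          exact (by fun_prop : Continuous fun y : Vec n => (E, y)).tendsto Q
        filter_upwards [h4.eventually h1] with y hy
        obtain ⟨w, hw, hwy⟩ := hy
        exact ⟨Q, hQ, w, hw, hwy⟩)
    refine ⟨δ, hδ, fun y hy hyd => ?_⟩
    obtain ⟨Q, hQ, hyQ⟩ := (Metric.infDist_lt_iff hMne).1 hyd
    obtain ⟨Q', hQ', ⟨r, x⟩, hw, hwy⟩ := hcov Q hQ y hyQ
    have hV : potential H x = E := congrArg Prod.fst hwy
    have hu : IsRestFlow.unfold q (r, x) = y := congrArg Prod.snd hwy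
    obtain ⟨-, h2, h3, h4, h5, -, -⟩ := hPδ _ (mem_image_of_mem _ hQ') (r, x)
      (hw.trans_le (min_le_left _ _))
    have hxM : x ∈ M := h3 hV
    have hyV := hD.potential_lt y hy
    rw [hu, hV] at h5
    -- On the reflected side `r < 0` one has `V > E`, and `r = 0` gives a boundary point; neither is
    -- possible for `y ∈ D`.
    have hr : 0 < r := by
      rcases lt_trichotomy r 0 with h | h | h
      · exact absurd (h5 h) (not_lt.2 hyV.le)
      · subst h
        rw [IsRestFlow.unfold_zero] at hu
        exact absurd hy (hu ▸ hD.notMem_of_mem_frontier hxM)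
      · exact h
    refine ⟨√r, ⟨Real.sqrt_pos.2 hr, ?_⟩, x, hxM, ?_⟩
    · rw [Real.sqrt_lt' ht₂]
      have h6 : |r| ≤ dist ((r, x) : ℝ × Vec n) (0, Q') := by
        rw [Prod.dist_eq]
        refine le_trans (le_of_eq ?_) (le_max_left _ _)
        simp
      rw [abs_of_pos hr] at h6
      exact (h6.trans_lt hw).trans_le (min_le_right _ _)
    · rw [← hu, IsRestFlow.unfold_of_pos hr]
  · -- local inverses
    intro t ht x hx
    have ht' : t ∈ Icc 0 t₁ := ⟨ht.1.le, ht.2.le⟩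
    obtain ⟨g, hg, hg0, hgr⟩ := hF.exists_local_inverse hH ht.1 (hIcc t ht').2 (hMU hx)
      (hPt x hx t ht').2.2.2.2.2.2
    refine ⟨g, hg, ?_⟩
    have h1 : Tendsto g (𝓝 (q (t, x))) (𝓝 (t, x)) := by
      have := hg.continuousAt.tendsto
      rwa [hg0] at this
    have h2 : ∀ᶠ w : ℝ × Vec n in 𝓝 (t, x), w.1 ∈ Ioo 0 t₁ :=
      continuous_fst.continuousAt.eventually (isOpen_Ioo.mem_nhds ht)
    have h3 : ∀ᶠ w : ℝ × Vec n in 𝓝 (t, x), potential H w.2 = E → w.2 ∈ M :=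
      (continuous_snd.tendsto (t, x)).eventually (hD.eventually_mem_frontier_of_potential_eq hH hx)
    filter_upwards [hgr, h1.eventually h2, h1.eventually h3] with y a1 a2 a3
    exact ⟨⟨a2, a3 (a1.1.trans (hVM x hx))⟩, a1.2⟩
  · -- the distance to the boundary increases
    intro x hx
    refine strictMonoOn_of_eventually_lt (fun t ht => ?_) fun t ht => ?_
    · exact ((Metric.continuous_infDist_pt _).continuousAt.comp
        (hF.deriv_q x (hMU hx) t (hIcc t ht)).continuousAt).continuousWithinAt
    have ht' : t ∈ Icc 0 t₁ := ⟨ht.1.le, ht.2⟩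
    -- Let `Q` be nearest to `q(t, x)`. The velocity has positive product with `q(t, x) - Q`, so
    -- slightly earlier points are closer to this same `Q`; no differentiability of the distance
    -- function is needed.
    obtain ⟨Q, hQ, hQd⟩ := hMc.exists_infDist_eq_dist ⟨x, hx⟩ (q (t, x))
    have hnear : ∀ z ∈ M, dist (q (t, x)) Q ≤ dist (q (t, x)) z := fun z hz =>
      hQd ▸ Metric.infDist_le_dist_of_mem hz
    have hdQx : dist Q x < δ₅ := by
      have h1 := hclose (0, x) (mem_image_of_mem _ hx) (t, x) (by
        rw [hdist, abs_of_pos ht.1]; linarith [ht.2])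
      have h2 := hnear x hx
      have h3 := dist_triangle_left Q x (q (t, x))
      simp only at h1
      linarith
    have hw := hneg ((0, x), x) (mem_image_of_mem _ hx) ((t, x), Q) (by
      rw [Prod.dist_eq, hdist, abs_of_pos ht.1]
      exact max_lt (by linarith [ht.2]) hdQx) ht.1
    have hpos := hD.inner_pos_of_nearest hH (hmem x hx t ht) hQ hnear hw
    have hder : HasDerivAt (fun s => ‖q (s, x) - Q‖ ^ 2)
        (2 * inner ℝ (q (t, x) - Q) (velocity H (q (t, x)) (p (t, x)))) t :=
      ((hF.deriv_q x (hMU hx) t (hIcc t ht')).sub_const Q).norm_sq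
    have e1 := (hasDerivWithinAt_iff_tendsto_slope' (by simp)).1
      (hder.hasDerivWithinAt (s := Iio t))
    filter_upwards [e1.eventually (lt_mem_nhds
      (show 0 < 2 * inner ℝ (q (t, x) - Q) (velocity H (q (t, x)) (p (t, x))) by linarith)),
      self_mem_nhdsWithin] with s hs hst
    have hst' : s - t < 0 := sub_neg.2 hst
    rw [slope_def_field] at hs
    have h1 : ‖q (s, x) - Q‖ ^ 2 - ‖q (t, x) - Q‖ ^ 2 < 0 := by
      by_contra h
      exact absurd hs (not_lt.2 (div_nonpos_of_nonneg_of_nonpos (not_lt.1 h) hst'.le))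
    have h2 : ‖q (s, x) - Q‖ < ‖q (t, x) - Q‖ :=
      lt_of_pow_lt_pow_left₀ 2 (norm_nonneg _) (by linarith)
    calc Metric.infDist (q (s, x)) M ≤ dist (q (s, x)) Q := Metric.infDist_le_dist_of_mem hQ
      _ < dist (q (t, x)) Q := by rwa [dist_eq_norm, dist_eq_norm]
      _ = _ := hQd.symm

end BrakeOrbits
end

/-! ### The action and its gradient -/

/-- The primitive of a function which is continuous on a closed interval. -/
theorem ContinuousOn.hasDerivWithinAt_primitive {φ : ℝ → ℝ} {T : ℝ} (hφ : ContinuousOn φ (Icc 0 T))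
    {t : ℝ} (ht : t ∈ Icc 0 T) :
    HasDerivWithinAt (fun t => ∫ s in (0 : ℝ)..t, φ s) (φ t) (Icc 0 T) t := by
  have hT : (0 : ℝ) ≤ T := ht.1.trans ht.2
  set ψ : ℝ → ℝ := IccExtend hT ((Icc 0 T).domRestrict φ) with hψ
  have hψc : Continuous ψ := (continuousOn_iff_continuous_domRestrict.1 hφ).Icc_extend'
  have heq : ∀ s ∈ Icc 0 T, ψ s = φ s := fun s hs => by
    rw [hψ, IccExtend_of_mem _ _ hs]; rfl
  have h1 : HasDerivAt (fun t => ∫ s in (0 : ℝ)..t, ψ s) (ψ t) t :=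
    intervalIntegral.integral_hasDerivAt_right (hψc.intervalIntegrable _ _)
      hψc.stronglyMeasurable.stronglyMeasurableAtFilter hψc.continuousAt
  rw [heq t ht] at h1
  have hint : ∀ u ∈ Icc 0 T, ∫ s in (0 : ℝ)..u, φ s = ∫ s in (0 : ℝ)..u, ψ s := by
    intro u hu
    refine intervalIntegral.integral_congr fun s hs => ?_
    rw [uIcc_of_le hu.1] at hs
    exact (heq s ⟨hs.1, hs.2.trans hu.2⟩).symm
  exact h1.hasDerivWithinAt.congr hint (hint t ht)

noncomputable section

namespace BrakeOrbits

variable {n : ℕ} {H : Vec n → Vec n → ℝ} {E : ℝ} {D : Set (Vec n)} {t₁ : ℝ}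
  {q p : ℝ × Vec n → Vec n}

/-- The action `∫₀ᵗ ⟨p, q'⟩` along the solutions starting at rest. -/
def restAction (H : Vec n → Vec n → ℝ) (q p : ℝ × Vec n → Vec n) (w : ℝ × Vec n) : ℝ :=
  ∫ s in (0 : ℝ)..w.1, inner ℝ (velocity H (q (s, w.2)) (p (s, w.2))) (p (s, w.2))

/-- The region covered by a collar chart. -/
def chartRegion (D : Set (Vec n)) (t₁ : ℝ) (q : ℝ × Vec n → Vec n) : Set (Vec n) :=
  q '' (Ioo 0 t₁ ×ˢ frontier D)

/-- The coordinates in a collar chart. -/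
def chartInv (D : Set (Vec n)) (t₁ : ℝ) (q : ℝ × Vec n → Vec n) : Vec n → ℝ × Vec n :=
  Function.invFunOn q (Ioo 0 t₁ ×ˢ frontier D)

/-- The action as a function of the end point. -/
def chartAction (H : Vec n → Vec n → ℝ) (D : Set (Vec n)) (t₁ : ℝ) (q p : ℝ × Vec n → Vec n)
    (y : Vec n) : ℝ := restAction H q p (chartInv D t₁ q y)

/-- The momentum as a function of the end point. -/
def chartMomentum (D : Set (Vec n)) (t₁ : ℝ) (q p : ℝ × Vec n → Vec n) (y : Vec n) : Vec n :=
  p (chartInv D t₁ q y)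

namespace IsCollarChart

theorem mem_Icc_of_mem_Ioo {t : ℝ} (ht : t ∈ Ioo 0 t₁) : t ∈ Icc 0 t₁ := ⟨ht.1.le, ht.2.le⟩

theorem chartInv_apply (hC : IsCollarChart H E D t₁ q p) {t : ℝ} (ht : t ∈ Ioo 0 t₁) {x : Vec n}
    (hx : x ∈ frontier D) : chartInv D t₁ q (q (t, x)) = (t, x) :=
  (hC.injOn.mono (prod_mono Ioo_subset_Icc_self subset_rfl)).leftInvOn_invFunOn ⟨ht, hx⟩

theorem chartInv_mem {y : Vec n} (hy : y ∈ chartRegion D t₁ q) :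
    (chartInv D t₁ q y).1 ∈ Ioo 0 t₁ ∧ (chartInv D t₁ q y).2 ∈ frontier D :=
  Function.invFunOn_mem hy

theorem apply_chartInv {y : Vec n} (hy : y ∈ chartRegion D t₁ q) : q (chartInv D t₁ q y) = y :=
  Function.invFunOn_eq hy

theorem contDiffAt_chartInv (hC : IsCollarChart H E D t₁ q p) {y : Vec n}
    (hy : y ∈ chartRegion D t₁ q) : ContDiffAt ℝ 1 (chartInv D t₁ q) y := by
  obtain ⟨⟨t, x⟩, ⟨ht, hx⟩, rfl⟩ := hy
  obtain ⟨g, hg, hev⟩ := hC.inverse t ht x hx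
  refine hg.congr_of_eventuallyEq ?_
  filter_upwards [hev] with y hy
  have := hC.chartInv_apply hy.1.1 hy.1.2
  rwa [Prod.mk.eta, hy.2] at this

theorem isOpen_chartRegion (hC : IsCollarChart H E D t₁ q p) : IsOpen (chartRegion D t₁ q) := by
  rw [isOpen_iff_mem_nhds]
  rintro _ ⟨⟨t, x⟩, ⟨ht, hx⟩, rfl⟩
  obtain ⟨g, -, hev⟩ := hC.inverse t ht x hx
  filter_upwards [hev] with y hy
  exact ⟨g y, hy.1, hy.2⟩

theorem chartRegion_subset (hC : IsCollarChart H E D t₁ q p) : chartRegion D t₁ q ⊆ D := by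
  rintro _ ⟨⟨t, x⟩, ⟨ht, hx⟩, rfl⟩
  exact hC.mem x hx t ⟨ht.1, ht.2.le⟩

theorem energy_eq (hC : IsCollarChart H E D t₁ q p) (hH : IsClassicalHamiltonian H)
    (hD : IsPotentialWell H E D) {t : ℝ} (ht : t ∈ Icc 0 t₁) {x : Vec n} (hx : x ∈ frontier D) :
    H (q (t, x)) (p (t, x)) = E := by
  have hd : ∀ s ∈ Icc 0 t₁, HasDerivAt (fun s => H (q (s, x)) (p (s, x))) 0 s := by
    intro s hs
    have h1 := HasFDerivAt.comp_hasDerivAt (f := fun s : ℝ => (q (s, x), p (s, x))) s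
      (hH.hasFDerivAt_total (q (s, x), p (s, x))) ((hC.deriv_q x hx s hs).prodMk (hC.deriv_p x hx s hs))
    rw [hH.fderiv_total_apply, inner_neg_right, real_inner_comm, add_neg_cancel] at h1
    exact h1
  have := constant_of_has_deriv_right_zero
    (fun s hs => (hd s hs).continuousAt.continuousWithinAt)
    (fun s hs => (hd s ⟨hs.1, hs.2.le⟩).hasDerivWithinAt) t ht
  rw [this, hC.q_zero x hx, hC.p_zero x hx]
  exact hD.potential_eq x hx

/-- Inside the well `V < E`, so energy `E` requires nonzero momentum. -/
theorem p_ne_zero (hC : IsCollarChart H E D t₁ q p) (hH : IsClassicalHamiltonian H)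
    (hD : IsPotentialWell H E D) {t : ℝ} (ht : t ∈ Ioc 0 t₁) {x : Vec n} (hx : x ∈ frontier D) :
    p (t, x) ≠ 0 := by
  intro h
  have h1 := hC.energy_eq hH hD ⟨ht.1.le, ht.2⟩ hx
  rw [h] at h1
  exact (hD.potential_lt _ (hC.mem x hx t ht)).ne h1

theorem continuousOn_power (hC : IsCollarChart H E D t₁ q p) (hH : IsClassicalHamiltonian H)
    {x : Vec n} (hx : x ∈ frontier D) :
    ContinuousOn (fun s => inner ℝ (velocity H (q (s, x)) (p (s, x))) (p (s, x))) (Icc 0 t₁) := by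
  intro s hs
  have hq := (hC.deriv_q x hx s hs).continuousAt
  have hp := (hC.deriv_p x hx s hs).continuousAt
  have hv : ContinuousAt (fun s => velocity H (q (s, x)) (p (s, x))) s :=
    ContinuousAt.comp (f := fun s : ℝ => (q (s, x), p (s, x)))
      hH.contDiff_velocity.continuous.continuousAt (hq.prodMk hp)
  exact (hv.inner hp).continuousWithinAt

theorem hasDerivWithinAt_restAction (hC : IsCollarChart H E D t₁ q p)
    (hH : IsClassicalHamiltonian H) {t : ℝ} (ht : t ∈ Icc 0 t₁) {x : Vec n}
    (hx : x ∈ frontier D) :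
    HasDerivWithinAt (fun s => restAction H q p (s, x))
      (inner ℝ (velocity H (q (t, x)) (p (t, x))) (p (t, x))) (Icc 0 t₁) t :=
  (hC.continuousOn_power hH hx).hasDerivWithinAt_primitive ht

theorem restAction_zero (x : Vec n) : restAction H q p (0, x) = 0 := by
  simp [restAction]

theorem strictMonoOn_restAction (hC : IsCollarChart H E D t₁ q p) (hH : IsClassicalHamiltonian H)
    (hD : IsPotentialWell H E D) {x : Vec n} (hx : x ∈ frontier D) :
    StrictMonoOn (fun s => restAction H q p (s, x)) (Icc 0 t₁) := by
  refine strictMonoOn_of_deriv_pos (convex_Icc _ _)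
    (fun s hs => (hC.hasDerivWithinAt_restAction hH hs hx).continuousWithinAt) fun s hs => ?_
  rw [interior_Icc] at hs
  have h1 := (hC.hasDerivWithinAt_restAction hH ⟨hs.1.le, hs.2.le⟩ hx).hasDerivAt
    (Icc_mem_nhds hs.1 hs.2)
  rw [h1.deriv]
  exact hH.inner_velocity_pos (hC.p_ne_zero hH hD ⟨hs.1, hs.2.le⟩ hx)

/-- The Taylor estimate at equal energies. -/
theorem exists_energy_taylor_bound (hC : IsCollarChart H E D t₁ q p)
    (hH : IsClassicalHamiltonian H) (hD : IsPotentialWell H E D)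
    (hMc : IsCompact (frontier D)) :
    ∃ C : ℝ, 0 ≤ C ∧ ∀ w ∈ Icc 0 t₁ ×ˢ frontier D, ∀ w' ∈ Icc 0 t₁ ×ˢ frontier D,
      |inner ℝ (positionGradient H (q w) (p w)) (q w' - q w) +
        inner ℝ (velocity H (q w) (p w)) (p w' - p w)| ≤ C * ‖w' - w‖ ^ 2 := by
  set K : Set (ℝ × Vec n) := Icc 0 t₁ ×ˢ frontier D
  have hKc : IsCompact K := isCompact_Icc.prod hMc
  have hzc : ∀ w ∈ K, ContDiffAt ℝ 1 (fun w => (q w, p w)) w := fun w hw =>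
    (hC.contDiffAt_q w.1 hw.1 w.2 hw.2).prodMk (hC.contDiffAt_p w.1 hw.1 w.2 hw.2)
  obtain ⟨L, hL⟩ := ContDiff.exists_lipschitzOnWith_of_isCompact hKc hzc
  obtain ⟨R, hR⟩ := (hKc.image_of_continuousOn
    (fun w hw => (hzc w hw).continuousAt.continuousWithinAt)).isBounded.subset_closedBall
      (0 : Vec n × Vec n)
  have hzB : ∀ w ∈ K, (q w, p w) ∈ Metric.closedBall (0 : Vec n × Vec n) R := fun w hw =>
    hR (mem_image_of_mem _ hw)
  obtain ⟨C₁, hC₁⟩ := ContDiff.exists_lipschitzOnWith_of_isCompact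
    (isCompact_closedBall (0 : Vec n × Vec n) R) (fun w _ => hH.contDiff_fderiv.contDiffAt)
  refine ⟨C₁ * L ^ 2, by positivity, fun w hw w' hw' => ?_⟩
  have hseg : segment ℝ (q w, p w) (q w', p w') ⊆ Metric.closedBall (0 : Vec n × Vec n) R :=
    (convex_closedBall _ _).segment_subset (hzB w hw) (hzB w' hw')
  have hl : ‖(q w', p w') - (q w, p w)‖ ≤ L * ‖w' - w‖ := hL.norm_sub_le hw' hw
  have h1 := Convex.norm_image_sub_le_of_norm_fderiv_le' (𝕜 := ℝ)
    (f := fun z : Vec n × Vec n => H z.1 z.2) (s := segment ℝ (q w, p w) (q w', p w'))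
    (φ := fderiv ℝ (fun z : Vec n × Vec n => H z.1 z.2) (q w, p w))
    (C := C₁ * ‖(q w', p w') - (q w, p w)‖)
    (fun u _ => hH.contDiff.differentiable two_ne_zero u)
    (fun u hu => (hC₁.norm_sub_le (hseg hu) (hzB w hw)).trans
      (mul_le_mul_of_nonneg_left (norm_sub_le_of_mem_segment hu) C₁.2))
    (convex_segment _ _) (left_mem_segment _ _ _) (right_mem_segment _ _ _)
  have e1 : H (q w') (p w') = E := hC.energy_eq hH hD hw'.1 hw'.2
  have e2 : H (q w) (p w) = E := hC.energy_eq hH hD hw.1 hw.2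
  have e3 := hH.fderiv_total_apply (q w) (p w) (q w' - q w) (p w' - p w)
  rw [e1, e2, sub_self, zero_sub, norm_neg, Prod.mk_sub_mk, e3, Real.norm_eq_abs] at h1
  rw [Prod.mk_sub_mk] at hl
  refine h1.trans ?_
  calc _ ≤ C₁ * (L * ‖w' - w‖) * (L * ‖w' - w‖) := by gcongr
    _ = _ := by ring

/-- Along two orbits, the defect `S' - S - ⟨p, q' - q⟩` has time derivative `dH(q' - q, p' - p) +
⟨v' - v, p' - p⟩`, where primes mark the second orbit and `v` is the velocity. The first term is
quadratic because the energies agree, the second because everything is Lipschitz, and the defect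
vanishes at time `0` because `p` does. -/
theorem exists_action_bound_of_fixed_time (hC : IsCollarChart H E D t₁ q p)
    (hH : IsClassicalHamiltonian H) (hD : IsPotentialWell H E D)
    (hMc : IsCompact (frontier D)) {L : ℝ}
    (hv : ∀ w ∈ Icc 0 t₁ ×ˢ frontier D, ∀ w' ∈ Icc 0 t₁ ×ˢ frontier D,
      ‖velocity H (q w') (p w') - velocity H (q w) (p w)‖ ≤ L * ‖w' - w‖)
    (hp : ∀ w ∈ Icc 0 t₁ ×ˢ frontier D, ∀ w' ∈ Icc 0 t₁ ×ˢ frontier D,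
      ‖p w' - p w‖ ≤ L * ‖w' - w‖) :
    ∃ C : ℝ, 0 ≤ C ∧ ∀ t ∈ Icc 0 t₁, ∀ x ∈ frontier D, ∀ x' ∈ frontier D,
      |restAction H q p (t, x') - restAction H q p (t, x) -
        inner ℝ (p (t, x)) (q (t, x') - q (t, x))| ≤ C * ‖x' - x‖ ^ 2 := by
  obtain ⟨C, hC0, htaylor⟩ := hC.exists_energy_taylor_bound hH hD hMc
  have ht₁ := hC.pos
  refine ⟨(C + L * L) * t₁, mul_nonneg (add_nonneg hC0 (mul_self_nonneg L)) ht₁.le,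
    fun t ht x hx x' hx' => ?_⟩
  set f : ℝ → ℝ := fun s => restAction H q p (s, x') - restAction H q p (s, x) -
      inner ℝ (p (s, x)) (q (s, x') - q (s, x)) with hf
  have hd : ∀ s ∈ Icc 0 t₁, HasDerivWithinAt f
      ((inner ℝ (positionGradient H (q (s, x)) (p (s, x))) (q (s, x') - q (s, x)) +
        inner ℝ (velocity H (q (s, x)) (p (s, x))) (p (s, x') - p (s, x))) +
        inner ℝ (velocity H (q (s, x')) (p (s, x')) - velocity H (q (s, x)) (p (s, x)))
          (p (s, x') - p (s, x))) (Icc 0 t₁) s := by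
    intro s hs
    have h1 := hC.hasDerivWithinAt_restAction hH hs hx'
    have h2 := hC.hasDerivWithinAt_restAction hH hs hx
    have h3 := (hC.deriv_p x hx s hs).hasDerivWithinAt (s := Icc 0 t₁)
    have h4 := ((hC.deriv_q x' hx' s hs).sub (hC.deriv_q x hx s hs)).hasDerivWithinAt
      (s := Icc 0 t₁)
    refine ((h1.sub h2).sub (h3.inner ℝ h4)).congr_deriv ?_
    simp only [inner_sub_left, inner_sub_right, inner_neg_left, Pi.sub_apply,
      real_inner_comm (p (s, x))]
    ring
  have hbd : ∀ s ∈ Icc 0 t₁,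
      ‖(inner ℝ (positionGradient H (q (s, x)) (p (s, x))) (q (s, x') - q (s, x)) +
        inner ℝ (velocity H (q (s, x)) (p (s, x))) (p (s, x') - p (s, x))) +
        inner ℝ (velocity H (q (s, x')) (p (s, x')) - velocity H (q (s, x)) (p (s, x)))
          (p (s, x') - p (s, x))‖ ≤ (C + L * L) * ‖x' - x‖ ^ 2 := by
    intro s hs
    have h1 := htaylor (s, x) ⟨hs, hx⟩ (s, x') ⟨hs, hx'⟩
    have h2 := hv (s, x) ⟨hs, hx⟩ (s, x') ⟨hs, hx'⟩
    have h3 := hp (s, x) ⟨hs, hx⟩ (s, x') ⟨hs, hx'⟩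
    have e : ‖((s, x') : ℝ × Vec n) - (s, x)‖ = ‖x' - x‖ := by
      rw [Prod.mk_sub_mk, Prod.norm_mk, sub_self, norm_zero, max_eq_right (norm_nonneg _)]
    rw [e] at h1 h2 h3
    have h4 : |inner ℝ (velocity H (q (s, x')) (p (s, x')) - velocity H (q (s, x)) (p (s, x)))
        (p (s, x') - p (s, x))| ≤ L * ‖x' - x‖ * (L * ‖x' - x‖) :=
      (abs_real_inner_le_norm _ _).trans
        (mul_le_mul h2 h3 (norm_nonneg _) ((norm_nonneg _).trans h2))
    rw [Real.norm_eq_abs]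
    calc _ ≤ C * ‖x' - x‖ ^ 2 + L * ‖x' - x‖ * (L * ‖x' - x‖) :=
          (abs_add_le _ _).trans (add_le_add h1 h4)
      _ = _ := by ring
  have h5 := (convex_Icc 0 t₁).norm_image_sub_le_of_norm_hasDerivWithin_le hd hbd
    (left_mem_Icc.2 ht₁.le) ht
  have hf0 : f 0 = 0 := by
    simp [hf, restAction_zero, hC.p_zero x hx]
  rw [hf0, sub_zero, sub_zero, Real.norm_eq_abs, Real.norm_of_nonneg ht.1] at h5
  refine h5.trans ?_
  have hLL := mul_self_nonneg L
  calc _ ≤ (C + L * L) * ‖x' - x‖ ^ 2 * t₁ := by gcongr; exact ht.2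
    _ = _ := by ring

/-- Along the orbit of `x'` the action grows at rate `⟨v, p⟩`. Replacing `p` by `p(t, x)` costs
`O(N)` per unit of time, over a time of at most `N`. -/
theorem action_bound_of_fixed_point (hC : IsCollarChart H E D t₁ q p)
    (hH : IsClassicalHamiltonian H) {L R : ℝ} (hL : 0 ≤ L)
    (hv : ∀ w ∈ Icc 0 t₁ ×ˢ frontier D, ‖velocity H (q w) (p w)‖ ≤ R)
    (hp : ∀ w ∈ Icc 0 t₁ ×ˢ frontier D, ∀ w' ∈ Icc 0 t₁ ×ˢ frontier D,
      ‖p w' - p w‖ ≤ L * ‖w' - w‖)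
    {t t' : ℝ} (ht : t ∈ Icc 0 t₁) (ht' : t' ∈ Icc 0 t₁) {x x' : Vec n}
    (hx : x ∈ frontier D) (hx' : x' ∈ frontier D) {N : ℝ} (hNt : |t' - t| ≤ N)
    (hNx : ‖x' - x‖ ≤ N) :
    |restAction H q p (t', x') - restAction H q p (t, x') -
        inner ℝ (p (t, x)) (q (t', x') - q (t, x'))| ≤ R * L * N ^ 2 := by
  set f : ℝ → ℝ := fun s => restAction H q p (s, x') - inner ℝ (p (t, x)) (q (s, x')) with hf
  have hsub : uIcc t t' ⊆ Icc 0 t₁ := uIcc_subset_Icc ht ht'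
  have hR : 0 ≤ R := (norm_nonneg _).trans (hv (t, x) ⟨ht, hx⟩)
  have hN : 0 ≤ N := (abs_nonneg _).trans hNt
  have hd : ∀ s ∈ uIcc t t', HasDerivWithinAt f
      (inner ℝ (velocity H (q (s, x')) (p (s, x'))) (p (s, x') - p (t, x))) (uIcc t t') s := by
    intro s hs
    have h1 := (hC.hasDerivWithinAt_restAction hH (hsub hs) hx').mono hsub
    have h2 := (hC.deriv_q x' hx' s (hsub hs)).hasDerivWithinAt (s := uIcc t t')
    refine (h1.sub ((hasDerivWithinAt_const s _ (p (t, x))).inner ℝ h2)).congr_deriv ?_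
    simp only [inner_sub_right, inner_zero_left, add_zero,
      real_inner_comm (p (t, x))]
  have hbd : ∀ s ∈ uIcc t t',
      ‖inner ℝ (velocity H (q (s, x')) (p (s, x'))) (p (s, x') - p (t, x))‖ ≤ R * (L * N) := by
    intro s hs
    have h2 : ‖((s, x') : ℝ × Vec n) - (t, x)‖ ≤ N := by
      rw [Prod.mk_sub_mk, Prod.norm_mk, Real.norm_eq_abs]
      exact max_le ((abs_sub_left_of_mem_uIcc hs).trans hNt) hNx
    have h3 : ‖p (s, x') - p (t, x)‖ ≤ L * N :=
      (hp (t, x) ⟨ht, hx⟩ (s, x') ⟨hsub hs, hx'⟩).trans (mul_le_mul_of_nonneg_left h2 hL)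
    exact (norm_inner_le_norm _ _).trans
      (mul_le_mul (hv (s, x') ⟨hsub hs, hx'⟩) h3 (norm_nonneg _) hR)
  have h5 := (convex_uIcc t t').norm_image_sub_le_of_norm_hasDerivWithin_le hd hbd
    left_mem_uIcc right_mem_uIcc
  have e : restAction H q p (t', x') - restAction H q p (t, x') -
      inner ℝ (p (t, x)) (q (t', x') - q (t, x')) = f t' - f t := by
    simp only [hf, inner_sub_right]; ring
  rw [e, ← Real.norm_eq_abs]
  refine h5.trans ?_
  calc _ ≤ R * (L * N) * N := by gcongr; exact hNt
    _ = _ := by ring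

/-- The differential of the action is the momentum, up to a uniform quadratic error. -/
theorem exists_action_quadratic_bound (hC : IsCollarChart H E D t₁ q p)
    (hH : IsClassicalHamiltonian H) (hD : IsPotentialWell H E D)
    (hMc : IsCompact (frontier D)) :
    ∃ C : ℝ, 0 ≤ C ∧ ∀ t ∈ Icc 0 t₁, ∀ x ∈ frontier D, ∀ t' ∈ Icc 0 t₁, ∀ x' ∈ frontier D,
      |restAction H q p (t', x') - restAction H q p (t, x) -
        inner ℝ (p (t, x)) (q (t', x') - q (t, x))| ≤
        C * ‖((t', x') : ℝ × Vec n) - (t, x)‖ ^ 2 := by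
  have hKc : IsCompact (Icc 0 t₁ ×ˢ frontier D) := isCompact_Icc.prod hMc
  have hzc : ∀ w ∈ Icc 0 t₁ ×ˢ frontier D,
      ContDiffAt ℝ 1 (fun w => velocity H (q w) (p w)) w := fun w hw =>
    ContDiffAt.comp (f := fun w => (q w, p w)) w hH.contDiff_velocity.contDiffAt
      ((hC.contDiffAt_q w.1 hw.1 w.2 hw.2).prodMk (hC.contDiffAt_p w.1 hw.1 w.2 hw.2))
  obtain ⟨L₁, hL₁⟩ := ContDiff.exists_lipschitzOnWith_of_isCompact hKc hzc
  obtain ⟨L₂, hL₂⟩ := ContDiff.exists_lipschitzOnWith_of_isCompact hKc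
    (fun w hw => hC.contDiffAt_p w.1 hw.1 w.2 hw.2)
  obtain ⟨R, hR⟩ := hKc.exists_bound_of_continuousOn
    (fun w hw => (hzc w hw).continuousAt.continuousWithinAt)
  have hv : ∀ w ∈ Icc 0 t₁ ×ˢ frontier D, ∀ w' ∈ Icc 0 t₁ ×ˢ frontier D,
      ‖velocity H (q w') (p w') - velocity H (q w) (p w)‖ ≤ max L₁ L₂ * ‖w' - w‖ :=
    fun w hw w' hw' => (hL₁.norm_sub_le hw' hw).trans
      (mul_le_mul_of_nonneg_right (by exact_mod_cast le_max_left L₁ L₂) (norm_nonneg _))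
  have hp : ∀ w ∈ Icc 0 t₁ ×ˢ frontier D, ∀ w' ∈ Icc 0 t₁ ×ˢ frontier D,
      ‖p w' - p w‖ ≤ max L₁ L₂ * ‖w' - w‖ :=
    fun w hw w' hw' => (hL₂.norm_sub_le hw' hw).trans
      (mul_le_mul_of_nonneg_right (by exact_mod_cast le_max_right L₁ L₂) (norm_nonneg _))
  have hL0 : (0 : ℝ) ≤ max L₁ L₂ := le_max_of_le_left L₁.2
  obtain ⟨C, hC0, hB⟩ := hC.exists_action_bound_of_fixed_time hH hD hMc hv hp
  refine ⟨max R 0 * max L₁ L₂ + C, add_nonneg (mul_nonneg (le_max_right _ _) hL0) hC0,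
    fun t ht x hx t' ht' x' hx' => ?_⟩
  have hNt : |t' - t| ≤ ‖((t', x') : ℝ × Vec n) - (t, x)‖ := by
    rw [Prod.mk_sub_mk, Prod.norm_mk]; exact le_max_left _ _
  have hNx : ‖x' - x‖ ≤ ‖((t', x') : ℝ × Vec n) - (t, x)‖ := by
    rw [Prod.mk_sub_mk, Prod.norm_mk]; exact le_max_right _ _
  have hA := hC.action_bound_of_fixed_point hH hL0
    (fun w hw => (hR w hw).trans (le_max_left R 0)) hp ht ht' hx hx' hNt hNx
  have hB' := (hB t ht x hx x' hx').trans
    (mul_le_mul_of_nonneg_left (pow_le_pow_left₀ (norm_nonneg _) hNx 2) hC0)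
  -- Go from `(t, x)` to `(t, x')` at fixed time, then to `(t', x')` along one orbit.
  have e : restAction H q p (t', x') - restAction H q p (t, x) -
        inner ℝ (p (t, x)) (q (t', x') - q (t, x)) =
      (restAction H q p (t', x') - restAction H q p (t, x') -
        inner ℝ (p (t, x)) (q (t', x') - q (t, x'))) +
      (restAction H q p (t, x') - restAction H q p (t, x) -
        inner ℝ (p (t, x)) (q (t, x') - q (t, x))) := by
    simp only [inner_sub_right]; ring
  rw [e, add_mul]
  exact (abs_add_le _ _).trans (add_le_add hA hB')

/-- The Hamilton–Jacobi relation: the gradient of the action is the momentum. -/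
theorem hasFDerivAt_chartAction (hC : IsCollarChart H E D t₁ q p)
    (hH : IsClassicalHamiltonian H) (hD : IsPotentialWell H E D)
    (hMc : IsCompact (frontier D)) {y : Vec n} (hy : y ∈ chartRegion D t₁ q) :
    HasFDerivAt (chartAction H D t₁ q p) (innerSL ℝ (chartMomentum D t₁ q p y)) y := by
  obtain ⟨C, hC0, hbd⟩ := hC.exists_action_quadratic_bound hH hD hMc
  refine HasFDerivAt.of_isLittleO ?_
  have h1 : (fun y' => chartAction H D t₁ q p y' - chartAction H D t₁ q p y -
      innerSL ℝ (chartMomentum D t₁ q p y) (y' - y)) =O[𝓝 y]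
      fun y' => ‖chartInv D t₁ q y' - chartInv D t₁ q y‖ ^ 2 := by
    refine Asymptotics.IsBigO.of_bound C ?_
    filter_upwards [hC.isOpen_chartRegion.mem_nhds hy] with y' hy'
    have m := chartInv_mem hy
    have m' := chartInv_mem hy'
    have := hbd _ (mem_Icc_of_mem_Ioo m.1) _ m.2 _ (mem_Icc_of_mem_Ioo m'.1) _ m'.2
    simp only [Prod.mk.eta, apply_chartInv hy, apply_chartInv hy'] at this
    rw [Real.norm_eq_abs, Real.norm_of_nonneg (by positivity)]
    exact this
  have h2 : (fun y' => chartInv D t₁ q y' - chartInv D t₁ q y) =O[𝓝 y] fun y' => y' - y :=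
    ((hC.contDiffAt_chartInv hy).differentiableAt one_ne_zero).isBigO_sub
  have h3 : (fun y' => ‖y' - y‖ ^ 2) =o[𝓝 y] fun y' => y' - y := by
    refine Asymptotics.IsLittleO.of_norm_right ?_
    have ht : Tendsto (fun v => ‖v - y‖) (𝓝 y) (𝓝 0) := tendsto_norm_sub_self _
    simpa [pow_two, Function.comp_def] using
      ((Asymptotics.isLittleO_one_iff ℝ).2 ht).mul_isBigO
        (Asymptotics.isBigO_refl (fun v => ‖v - y‖) _)
  exact (h1.trans (h2.norm_norm.pow 2)).trans_isLittleO h3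

theorem contDiffAt_chartMomentum (hC : IsCollarChart H E D t₁ q p) {y : Vec n}
    (hy : y ∈ chartRegion D t₁ q) : ContDiffAt ℝ 1 (chartMomentum D t₁ q p) y := by
  have m := chartInv_mem hy
  exact (hC.contDiffAt_p _ (mem_Icc_of_mem_Ioo m.1) _ m.2).comp y (hC.contDiffAt_chartInv hy)

/-- One derivative more than the flow has: the gradient is the momentum, itself of class `C¹` in the
end point. -/
theorem contDiffAt_chartAction (hC : IsCollarChart H E D t₁ q p)
    (hH : IsClassicalHamiltonian H) (hD : IsPotentialWell H E D)
    (hMc : IsCompact (frontier D)) {y : Vec n} (hy : y ∈ chartRegion D t₁ q) :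
    ContDiffAt ℝ 2 (chartAction H D t₁ q p) y := by
  have := (contDiffAt_succ_iff_hasFDerivAt (𝕜 := ℝ) (n := 1) (f := chartAction H D t₁ q p)
    (x := y)).2 ⟨fun y => innerSL ℝ (chartMomentum D t₁ q p y),
      ⟨_, hC.isOpen_chartRegion.mem_nhds hy, fun y' hy' => hC.hasFDerivAt_chartAction hH hD hMc hy'⟩,
      (innerSL ℝ (E := Vec n)).contDiff.contDiffAt.comp y (hC.contDiffAt_chartMomentum hy)⟩
  exact_mod_cast this

theorem energy_chartMomentum (hC : IsCollarChart H E D t₁ q p) (hH : IsClassicalHamiltonian H)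
    (hD : IsPotentialWell H E D) {y : Vec n} (hy : y ∈ chartRegion D t₁ q) :
    H y (chartMomentum D t₁ q p y) = E := by
  have m := chartInv_mem hy
  have := hC.energy_eq hH hD (mem_Icc_of_mem_Ioo m.1) m.2
  rwa [Prod.mk.eta, apply_chartInv hy] at this

theorem chartMomentum_ne_zero (hC : IsCollarChart H E D t₁ q p) (hH : IsClassicalHamiltonian H)
    (hD : IsPotentialWell H E D) {y : Vec n} (hy : y ∈ chartRegion D t₁ q) :
    chartMomentum D t₁ q p y ≠ 0 := by
  have m := chartInv_mem hy
  exact hC.p_ne_zero hH hD ⟨m.1.1, m.1.2.le⟩ m.2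

end IsCollarChart

end BrakeOrbits
end

/-! ### The action as a calibration: lower bounds for lengths -/

theorem AbsolutelyContinuousOnInterval.of_dist_le {X Y : Type*} [PseudoMetricSpace X]
    [PseudoMetricSpace Y] {f : ℝ → X} {g : ℝ → Y} {a b : ℝ}
    (hg : AbsolutelyContinuousOnInterval g a b) (K : ℝ)
    (h : ∀ s ∈ uIcc a b, ∀ t ∈ uIcc a b, dist (f s) (f t) ≤ K * dist (g s) (g t)) :
    AbsolutelyContinuousOnInterval f a b := by
  have h0 := Filter.Tendsto.const_mul K hg
  rw [mul_zero] at h0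
  refine squeeze_zero' (Eventually.of_forall fun I => Finset.sum_nonneg fun _ _ => dist_nonneg) ?_ h0
  refine Eventually.filter_mono inf_le_right (eventually_principal.2 fun I hI => ?_)
  rw [Finset.mul_sum]
  exact Finset.sum_le_sum fun i hi => h _ (hI.1 i hi).1 _ (hI.1 i hi).2

theorem AbsolutelyContinuousOnInterval.contDiffAt_comp {V W : Type*} [NormedAddCommGroup V]
    [NormedSpace ℝ V] [NormedAddCommGroup W] [NormedSpace ℝ W] {γ : ℝ → V} {a b : ℝ}
    (hγ : AbsolutelyContinuousOnInterval γ a b) {f : V → W}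
    (hf : ∀ s ∈ uIcc a b, ContDiffAt ℝ 1 f (γ s)) :
    AbsolutelyContinuousOnInterval (fun s => f (γ s)) a b := by
  have hK : IsCompact (γ '' uIcc a b) := isCompact_uIcc.image_of_continuousOn hγ.continuousOn
  obtain ⟨C, hC⟩ := ContDiff.exists_lipschitzOnWith_of_isCompact hK (X := f) (by
    rintro _ ⟨s, hs, rfl⟩
    exact hf s hs)
  exact hγ.of_dist_le C fun s hs t ht =>
    hC.dist_le_mul _ (mem_image_of_mem _ hs) _ (mem_image_of_mem _ ht)

noncomputable section

namespace BrakeOrbits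

variable {n : ℕ} {H : Vec n → Vec n → ℝ} {E : ℝ} {D : Set (Vec n)} {t₁ : ℝ}
  {q p : ℝ × Vec n → Vec n}

namespace IsCollarChart

theorem exists_restAction_le (hC : IsCollarChart H E D t₁ q p) (hH : IsClassicalHamiltonian H)
    (hD : IsPotentialWell H E D) (hMc : IsCompact (frontier D)) :
    ∃ C : ℝ, 0 ≤ C ∧ ∀ t ∈ Icc 0 t₁, ∀ x ∈ frontier D, restAction H q p (t, x) ≤ C * t ^ 2 := by
  obtain ⟨C, hC0, h⟩ := hC.exists_action_quadratic_bound hH hD hMc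
  refine ⟨C, hC0, fun t ht x hx => ?_⟩
  have h1 := h 0 (left_mem_Icc.2 hC.pos.le) x hx t ht x hx
  rw [restAction_zero, hC.p_zero x hx, inner_zero_left, sub_zero, sub_zero, Prod.mk_sub_mk,
    Prod.norm_mk, sub_self, sub_zero, norm_zero, max_eq_left (norm_nonneg _), Real.norm_eq_abs,
    sq_abs] at h1
  exact (le_abs_self _).trans h1

theorem chartAction_apply (hC : IsCollarChart H E D t₁ q p) {t : ℝ} (ht : t ∈ Ioo 0 t₁) {x : Vec n}
    (hx : x ∈ frontier D) : chartAction H D t₁ q p (q (t, x)) = restAction H q p (t, x) := by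
  rw [chartAction, hC.chartInv_apply ht hx]

theorem restAction_pos (hC : IsCollarChart H E D t₁ q p) (hH : IsClassicalHamiltonian H)
    (hD : IsPotentialWell H E D) {t : ℝ} (ht : t ∈ Ioc 0 t₁) {x : Vec n}
    (hx : x ∈ frontier D) : 0 < restAction H q p (t, x) := by
  have := hC.strictMonoOn_restAction hH hD hx (left_mem_Icc.2 hC.pos.le) ⟨ht.1.le, ht.2⟩ ht.1
  simpa only [restAction_zero] using this

theorem chartAction_pos (hC : IsCollarChart H E D t₁ q p) (hH : IsClassicalHamiltonian H)
    (hD : IsPotentialWell H E D) {y : Vec n} (hy : y ∈ chartRegion D t₁ q) :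
    0 < chartAction H D t₁ q p y := by
  have m := chartInv_mem hy
  exact hC.restAction_pos hH hD ⟨m.1.1, m.1.2.le⟩ m.2

/-- Points close to the boundary are reached in short time, and the action is `O(t²)` because orbits
start at rest. -/
theorem exists_near_boundary (hC : IsCollarChart H E D t₁ q p) (hH : IsClassicalHamiltonian H)
    (hD : IsPotentialWell H E D) (hMc : IsCompact (frontier D)) {w : ℝ} (hw : 0 < w) :
    ∃ δ > 0, ∀ y ∈ D, Metric.infDist y (frontier D) < δ →
      y ∈ chartRegion D t₁ q ∧ chartAction H D t₁ q p y < w := by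
  obtain ⟨C, hC0, h⟩ := hC.exists_restAction_le hH hD hMc
  obtain ⟨t₂, ht₂, ht₂₁, hCt⟩ : ∃ t₂, 0 < t₂ ∧ t₂ ≤ t₁ ∧ C * t₂ ^ 2 < w := by
    have h1 : ContinuousAt (fun t : ℝ => C * t ^ 2) 0 := by fun_prop
    have h2 : ∀ᶠ t in 𝓝[>] (0 : ℝ), C * t ^ 2 < w :=
      (h1.eventually (gt_mem_nhds (by simpa using hw))).filter_mono nhdsWithin_le_nhds
    obtain ⟨t, h3, h4⟩ := (h2.and (Ioc_mem_nhdsGT hC.pos)).exists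
    exact ⟨t, h4.1, h4.2, h3⟩
  obtain ⟨δ, hδ, hcol⟩ := hC.collar t₂ ht₂
  refine ⟨δ, hδ, fun y hy hyd => ?_⟩
  obtain ⟨t, ht, x, hx, rfl⟩ := hcol y hy hyd
  have ht' : t ∈ Ioo 0 t₁ := ⟨ht.1, ht.2.trans_le ht₂₁⟩
  refine ⟨⟨(t, x), ⟨ht', hx⟩, rfl⟩, ?_⟩
  rw [hC.chartAction_apply ht' hx]
  refine ((h t (mem_Icc_of_mem_Ioo ht') x hx).trans ?_).trans_lt hCt
  exact mul_le_mul_of_nonneg_left (pow_le_pow_left₀ ht.1.le ht.2.le 2) hC0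

/-- The constant `c` is a threshold: points of the chart with action below `c` have time below `t₂`,
away from the outer end of the chart. -/
theorem exists_pos_le_restAction (hC : IsCollarChart H E D t₁ q p) (hH : IsClassicalHamiltonian H)
    (hD : IsPotentialWell H E D) (hMc : IsCompact (frontier D)) {t₂ : ℝ} (ht₂ : t₂ ∈ Ioo 0 t₁) :
    ∃ c > 0, ∀ x ∈ frontier D, c ≤ restAction H q p (t₂, x) := by
  rcases (frontier D).eq_empty_or_nonempty with hM | hM
  · exact ⟨1, one_pos, by simp [hM]⟩
  have hcont : ContinuousOn (fun x => chartAction H D t₁ q p (q (t₂, x))) (frontier D) := by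
    intro x hx
    refine ContinuousAt.continuousWithinAt (ContinuousAt.comp (f := fun x => q (t₂, x))
      (hC.contDiffAt_chartAction hH hD hMc ⟨(t₂, x), ⟨ht₂, hx⟩, rfl⟩).continuousAt ?_)
    exact ContinuousAt.comp (f := fun x => (t₂, x))
      (hC.contDiffAt_q t₂ (mem_Icc_of_mem_Ioo ht₂) x hx).continuousAt (by fun_prop)
  obtain ⟨x₀, hx₀, hmin⟩ := hMc.exists_isMinOn hM hcont
  refine ⟨restAction H q p (t₂, x₀), hC.restAction_pos hH hD ⟨ht₂.1, ht₂.2.le⟩ hx₀,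
    fun x hx => ?_⟩
  have := hmin hx
  simp only [mem_ofPred_eq] at this
  rwa [hC.chartAction_apply ht₂ hx, hC.chartAction_apply ht₂ hx₀] at this

/-- The sublevel set lies in the compact image of `[0, t₂] × ∂D`, so its closure can leave the chart
only at `t = 0`, that is, on `∂D`. -/
theorem mem_chartRegion_of_mem_closure (hC : IsCollarChart H E D t₁ q p)
    (hH : IsClassicalHamiltonian H) (hD : IsPotentialWell H E D)
    (hMc : IsCompact (frontier D)) {t₂ : ℝ} (ht₂ : t₂ ∈ Ioo 0 t₁) {c w : ℝ}
    (hc : ∀ x ∈ frontier D, c ≤ restAction H q p (t₂, x)) (hw : w ≤ c) {z : Vec n} (hz : z ∈ D)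
    (hcl : z ∈ closure {y | y ∈ chartRegion D t₁ q ∧ chartAction H D t₁ q p y < w}) :
    z ∈ chartRegion D t₁ q ∧ chartAction H D t₁ q p z ≤ w := by
  have hK : IsCompact (q '' (Icc 0 t₂ ×ˢ frontier D)) :=
    (isCompact_Icc.prod hMc).image_of_continuousOn fun u hu =>
      (hC.contDiffAt_q u.1 ⟨hu.1.1, hu.1.2.trans ht₂.2.le⟩ u.2 hu.2).continuousAt.continuousWithinAt
  have hsub : {y | y ∈ chartRegion D t₁ q ∧ chartAction H D t₁ q p y < w} ⊆
      q '' (Icc 0 t₂ ×ˢ frontier D) := by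
    rintro _ ⟨⟨⟨t, x⟩, ⟨ht, hx⟩, rfl⟩, hlt⟩
    rw [hC.chartAction_apply ht hx] at hlt
    refine ⟨(t, x), ⟨⟨ht.1.le, le_of_not_gt fun h => ?_⟩, hx⟩, rfl⟩
    have := hC.strictMonoOn_restAction hH hD hx (mem_Icc_of_mem_Ioo ht₂) (mem_Icc_of_mem_Ioo ht) h
    have := hc x hx
    simp only at *
    linarith
  obtain ⟨⟨t, x⟩, ⟨ht, hx⟩, rfl⟩ := closure_minimal hsub hK.isClosed hcl
  have ht0 : t ≠ 0 := by
    rintro rfl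
    rw [hC.q_zero x hx] at hz
    exact hD.notMem_of_mem_frontier hx hz
  have hmem : q (t, x) ∈ chartRegion D t₁ q :=
    ⟨(t, x), ⟨⟨lt_of_le_of_ne ht.1 ht0.symm, ht.2.trans_lt ht₂.2⟩, hx⟩, rfl⟩
  refine ⟨hmem, le_of_not_gt fun h => ?_⟩
  have hev := (hC.contDiffAt_chartAction hH hD hMc hmem).continuousAt.eventually (lt_mem_nhds h)
  obtain ⟨y, hy1, hy2⟩ := (mem_closure_iff_frequently.1 hcl).and_eventually hev |>.exists
  exact lt_asymm hy1.2 hy2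

variable {γ : ℝ → Vec n}

theorem ae_hasDerivAt_chartAction (hC : IsCollarChart H E D t₁ q p)
    (hH : IsClassicalHamiltonian H) (hD : IsPotentialWell H E D)
    (hMc : IsCompact (frontier D)) {a b : ℝ} (hab : a ≤ b)
    (hγ : AbsolutelyContinuousOnInterval γ a b) (hmem : ∀ s ∈ Icc a b, γ s ∈ chartRegion D t₁ q) :
    ∀ᵐ s, s ∈ Icc a b → DifferentiableAt ℝ γ s ∧ HasDerivAt (fun s => chartAction H D t₁ q p (γ s))
      (inner ℝ (chartMomentum D t₁ q p (γ s)) (deriv γ s)) s := by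
  filter_upwards [hγ.boundedVariationOn.ae_differentiableAt_of_mem_uIcc] with s h1 hs
  have h2 := h1 (by rwa [uIcc_of_le hab])
  exact ⟨h2, (hC.hasFDerivAt_chartAction hH hD hMc (hmem s hs)).comp_hasDerivAt s h2.hasDerivAt⟩

/-- The calibration inequality: `P(y)` is on the energy surface, and the body is symmetric. -/
theorem neg_inner_chartMomentum_le (hC : IsCollarChart H E D t₁ q p)
    (hH : IsClassicalHamiltonian H) (hD : IsPotentialWell H E D) {y : Vec n}
    (hy : y ∈ chartRegion D t₁ q) (v : Vec n) :
    -inner ℝ (chartMomentum D t₁ q p y) v ≤ supportFunction H E y v := by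
  have := hH.inner_le_supportFunction (hC.energy_chartMomentum hH hD hy).le (-v)
  rwa [hH.supportFunction_neg, inner_neg_left, real_inner_comm] at this

theorem chartAction_sub_le (hC : IsCollarChart H E D t₁ q p)
    (hH : IsClassicalHamiltonian H) (hD : IsPotentialWell H E D)
    (hMc : IsCompact (frontier D)) {a b : ℝ} (hab : a ≤ b)
    (hγ : AbsolutelyContinuousOnInterval γ a b) (hmem : ∀ s ∈ Icc a b, γ s ∈ chartRegion D t₁ q)
    (hint : IntervalIntegrable (fun s => supportFunction H E (γ s) (deriv γ s)) volume a b) :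
    chartAction H D t₁ q p (γ a) - chartAction H D t₁ q p (γ b) ≤
      ∫ s in a..b, supportFunction H E (γ s) (deriv γ s) := by
  have hf : AbsolutelyContinuousOnInterval (fun s => chartAction H D t₁ q p (γ s)) a b :=
    hγ.contDiffAt_comp fun s hs =>
      (hC.contDiffAt_chartAction hH hD hMc (hmem s (by rwa [uIcc_of_le hab] at hs))).of_le
        one_le_two
  have h1 := hf.integral_deriv_eq_sub
  rw [← neg_sub, ← h1, ← intervalIntegral.integral_neg]
  refine intervalIntegral.integral_mono_ae_restrict hab hf.intervalIntegrable_deriv.neg hint ?_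
  rw [EventuallyLE, ae_restrict_iff' measurableSet_Icc]
  filter_upwards [hC.ae_hasDerivAt_chartAction hH hD hMc hab hγ hmem] with s h2 hs
  rw [(h2 hs).2.deriv]
  exact hC.neg_inner_chartMomentum_le hH hD (hmem s hs) _

/-- The action bounds from below the length of a curve which stays in the chart and tends to
the boundary. -/
theorem chartAction_le_integral (hC : IsCollarChart H E D t₁ q p)
    (hH : IsClassicalHamiltonian H) (hD : IsPotentialWell H E D)
    (hMc : IsCompact (frontier D)) {a : ℝ} (ha : a < 1)
    (hγ : AbsolutelyContinuousOnInterval γ a 1) (hmem : ∀ s ∈ Ico a 1, γ s ∈ chartRegion D t₁ q)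
    (h1 : γ 1 ∈ frontier D)
    (hint : IntervalIntegrable (fun s => supportFunction H E (γ s) (deriv γ s)) volume a 1) :
    chartAction H D t₁ q p (γ a) ≤ ∫ s in a..1, supportFunction H E (γ s) (deriv γ s) := by
  refine le_of_forall_pos_le_add fun ε hε => ?_
  -- The end point on `∂D` is outside the chart, so the curve is cut at some `b < 1` where the
  -- action is already below `ε`.
  obtain ⟨δ, hδ, hnear⟩ := hC.exists_near_boundary hH hD hMc hε
  have hcont : ContinuousWithinAt (fun s => Metric.infDist (γ s) (frontier D)) (Icc a 1) 1 := by
    have := hγ.continuousOn 1 right_mem_uIcc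
    rw [uIcc_of_le ha.le] at this
    exact (Metric.continuous_infDist_pt _).continuousAt.comp_continuousWithinAt this
  have hev : ∀ᶠ s in 𝓝[<] (1 : ℝ), Metric.infDist (γ s) (frontier D) < δ := by
    have := hcont.eventually
      (gt_mem_nhds (show Metric.infDist (γ 1) (frontier D) < δ by rwa [Metric.infDist_zero_of_mem h1]))
    rw [nhdsWithin_Icc_eq_nhdsLE ha] at this
    exact this.filter_mono (nhdsWithin_mono _ Iio_subset_Iic_self)
  obtain ⟨b, hb1, hb2⟩ := (hev.and (Ico_mem_nhdsLT ha)).exists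
  have hbm := hmem b hb2
  have hsmall := (hnear _ (hC.chartRegion_subset hbm) hb1).2
  have hsub1 : uIcc a b ⊆ uIcc a 1 := by
    rw [uIcc_of_le hb2.1, uIcc_of_le ha.le]; exact Icc_subset_Icc_right hb2.2.le
  have hsub2 : uIcc b 1 ⊆ uIcc a 1 := by
    rw [uIcc_of_le hb2.2.le, uIcc_of_le ha.le]; exact Icc_subset_Icc_left hb2.1
  have h2 := hC.chartAction_sub_le hH hD hMc hb2.1 (hγ.mono hsub1)
    (fun s hs => hmem s ⟨hs.1, hs.2.trans_lt hb2.2⟩) (hint.mono_set hsub1)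
  have h3 := intervalIntegral.integral_add_adjacent_intervals (hint.mono_set hsub1)
    (hint.mono_set hsub2)
  have h4 : 0 ≤ ∫ s in b..1, supportFunction H E (γ s) (deriv γ s) := by
    refine intervalIntegral.integral_nonneg_of_ae_restrict hb2.2.le ?_
    rw [EventuallyLE, ae_restrict_iff' measurableSet_Icc]
    filter_upwards [compl_mem_ae_iff.2 (Real.volume_singleton (a := 1))] with s hs1 hs
    have hsI : s ∈ Ico a 1 := ⟨hb2.1.trans hs.1, lt_of_le_of_ne hs.2 hs1⟩
    exact hH.supportFunction_nonneg (hD.potential_lt _ (hC.chartRegion_subset (hmem s hsI))).le _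
  linarith

end IsCollarChart

end BrakeOrbits
end

/-! ### Lower bound for the energy and rigidity in the case of equality -/

noncomputable section

namespace BrakeOrbits

variable {n : ℕ} {H : Vec n → Vec n → ℝ} {E : ℝ} {D : Set (Vec n)} {t₁ : ℝ}
  {q p : ℝ × Vec n → Vec n} {γ : ℝ → Vec n} {y : Vec n}

namespace IsClassicalHamiltonian

/-- Momenta of energy at most `E` are bounded uniformly over the compact closure of the well, so
`σ(γ, γ')` inherits square integrability from `γ'`. -/
theorem exists_supportFunction_le (hH : IsClassicalHamiltonian H) (hD : IsPotentialWell H E D)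
    (hDc : IsCompact (closure D)) :
    ∃ R : ℝ, 0 ≤ R ∧ ∀ q ∈ D, ∀ v, supportFunction H E q v ≤ R * ‖v‖ := by
  obtain ⟨ν, hν, hν0, hνH⟩ := hH.posDef
  have hcont : Continuous fun q => √(2 * (E - potential H q) / ν q) :=
    ((continuous_const.mul (continuous_const.sub hH.contDiff_potential.continuous)).div hν
      fun q => (hν0 q).ne').sqrt
  obtain ⟨R, hR⟩ := hDc.exists_bound_of_continuousOn hcont.continuousOn
  refine ⟨max R 0, le_max_right _ _, fun q hq v => supportFunction_le (hD.potential_lt q hq).le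
    fun p hp => ?_⟩
  have h1 : ‖p‖ ≤ max R 0 := (Real.le_sqrt_of_sq_le (hH.norm_sq_le hν0 hνH hp)).trans
    ((le_abs_self _).trans ((hR q (subset_closure hq)).trans (le_max_left _ _)))
  calc _ ≤ ‖v‖ * ‖p‖ := real_inner_le_norm v p
    _ ≤ ‖v‖ * max R 0 := by gcongr
    _ = _ := mul_comm _ _

end IsClassicalHamiltonian

theorem ae_mem_of_mem_curvesToBoundary (hγ : γ ∈ curvesToBoundary D y) :
    ∀ᵐ s ∂volume.restrict (Ioc (0 : ℝ) 1), γ s ∈ D := by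
  rw [ae_restrict_iff' measurableSet_Ioc]
  filter_upwards [compl_mem_ae_iff.2 (Real.volume_singleton (a := 1))] with s hs1 hs
  exact hγ.2.2.1 s ⟨hs.1.le, lt_of_le_of_ne hs.2 hs1⟩

theorem memLp_supportFunction (hH : IsClassicalHamiltonian H) (hD : IsPotentialWell H E D)
    (hDc : IsCompact (closure D)) (hγ : γ ∈ curvesToBoundary D y) :
    MemLp (fun s => supportFunction H E (γ s) (deriv γ s)) 2 (volume.restrict (Ioc 0 1)) := by
  obtain ⟨R, hR0, hR⟩ := hH.exists_supportFunction_le hD hDc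
  have hderiv : MemLp (deriv γ) 2 (volume.restrict (Ioc 0 1)) :=
    hγ.1.2.2.mono_measure (Measure.restrict_mono Ioc_subset_Icc_self le_rfl)
  have hD' := ae_mem_of_mem_curvesToBoundary hγ
  have hγm : AEMeasurable γ (volume.restrict (Ioc 0 1)) := by
    have := hγ.1.2.1.continuousOn
    rw [uIcc_of_le zero_le_one] at this
    exact (this.mono Ioc_subset_Icc_self).aemeasurable measurableSet_Ioc
  have hm : AEStronglyMeasurable (fun s => supportFunction H E (γ s) (deriv γ s))
      (volume.restrict (Ioc 0 1)) := by
    refine AEMeasurable.aestronglyMeasurable ?_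
    have h1 := (hH.measurable_indicator_supportFunction hD.isOpen hD.potential_lt).comp_aemeasurable
      (hγm.prodMk (measurable_deriv γ).aemeasurable)
    refine h1.congr ?_
    filter_upwards [hD'] with s hs
    exact indicator_of_mem (show (γ s, deriv γ s) ∈ Prod.fst ⁻¹' D from hs) _
  refine hderiv.of_le_mul (c := R) hm ?_
  filter_upwards [hD'] with s hs
  rw [Real.norm_of_nonneg (hH.supportFunction_nonneg (hD.potential_lt _ hs).le _)]
  exact hR _ hs _

theorem energy_eq_integral (hH : IsClassicalHamiltonian H) (hD : IsPotentialWell H E D)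
    (hγ : γ ∈ curvesToBoundary D y) :
    energy H E D γ = (∫ s in (0 : ℝ)..1, supportFunction H E (γ s) (deriv γ s) ^ 2) / 4 := by
  rw [energy, ← intervalIntegral.integral_div, intervalIntegral.integral_of_le zero_le_one,
    intervalIntegral.integral_of_le zero_le_one]
  refine integral_congr_ae ?_
  filter_upwards [ae_mem_of_mem_curvesToBoundary hγ] with s hs
  exact hH.jacobiFinsler_eq hs (hD.potential_lt _ hs) _

theorem intervalIntegrable_supportFunction (hH : IsClassicalHamiltonian H)
    (hD : IsPotentialWell H E D) (hDc : IsCompact (closure D)) (hγ : γ ∈ curvesToBoundary D y)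
    {a b : ℝ} (ha : a ∈ Icc (0 : ℝ) 1) (hb : b ∈ Icc (0 : ℝ) 1) :
    IntervalIntegrable (fun s => supportFunction H E (γ s) (deriv γ s)) volume a b := by
  have h1 : IntervalIntegrable (fun s => supportFunction H E (γ s) (deriv γ s)) volume 0 1 := by
    rw [intervalIntegrable_iff_integrableOn_Ioc_of_le zero_le_one]
    exact (memLp_supportFunction hH hD hDc hγ).integrable one_le_two
  refine h1.mono_set ?_
  rw [uIcc_of_le zero_le_one]
  exact uIcc_subset_Icc ha hb

/-- The variance identity on the unit interval. -/
theorem integral_sub_const_sq {f : ℝ → ℝ} (hf : MemLp f 2 (volume.restrict (Ioc (0 : ℝ) 1)))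
    (w : ℝ) : ∫ s in (0 : ℝ)..1, (f s - w) ^ 2 =
      (∫ s in (0 : ℝ)..1, f s ^ 2) - 2 * w * (∫ s in (0 : ℝ)..1, f s) + w ^ 2 := by
  have h1 : IntervalIntegrable f volume 0 1 := by
    rw [intervalIntegrable_iff_integrableOn_Ioc_of_le zero_le_one]
    exact hf.integrable one_le_two
  have h2 : IntervalIntegrable (fun s => f s ^ 2) volume 0 1 := by
    rw [intervalIntegrable_iff_integrableOn_Ioc_of_le zero_le_one]
    exact hf.integrable_sq
  have e : ∀ s, (f s - w) ^ 2 = f s ^ 2 - 2 * w * f s + w ^ 2 := fun s => by ring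
  simp_rw [e]
  rw [intervalIntegral.integral_add (h2.sub (h1.const_mul _)) intervalIntegrable_const,
    intervalIntegral.integral_sub h2 (h1.const_mul _), intervalIntegral.integral_const_mul]
  simp

namespace IsCollarChart

/-- A curve to the boundary crosses the chart from the level of its starting point on. -/
theorem exists_last_entry (hC : IsCollarChart H E D t₁ q p) (hH : IsClassicalHamiltonian H)
    (hD : IsPotentialWell H E D) (hMc : IsCompact (frontier D)) {t₂ : ℝ} (ht₂ : t₂ ∈ Ioo 0 t₁)
    {c : ℝ} (hc : ∀ x ∈ frontier D, c ≤ restAction H q p (t₂, x))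
    (hy : y ∈ chartRegion D t₁ q) (hyc : chartAction H D t₁ q p y ≤ c)
    (hγ : γ ∈ curvesToBoundary D y) :
    ∃ a ∈ Ico (0 : ℝ) 1, chartAction H D t₁ q p (γ a) = chartAction H D t₁ q p y ∧
      ∀ s ∈ Ico a 1, γ s ∈ chartRegion D t₁ q := by
  set w := chartAction H D t₁ q p y with hw
  set O := {z | z ∈ chartRegion D t₁ q ∧ chartAction H D t₁ q p z < w} with hO
  have hOo : IsOpen O := by
    rw [isOpen_iff_mem_nhds]
    rintro z ⟨hz1, hz2⟩
    exact inter_mem (hC.isOpen_chartRegion.mem_nhds hz1)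
      ((hC.contDiffAt_chartAction hH hD hMc hz1).continuousAt.eventually (gt_mem_nhds hz2))
  have hγc : ContinuousOn γ (Icc 0 1) := by
    have := hγ.1.2.1.continuousOn
    rwa [uIcc_of_le zero_le_one] at this
  obtain ⟨δ, hδ, hnear⟩ := hC.exists_near_boundary hH hD hMc (hC.chartAction_pos hH hD hy)
  have hev : ∀ᶠ s in 𝓝[<] (1 : ℝ), Metric.infDist (γ s) (frontier D) < δ := by
    have h1 : ContinuousWithinAt (fun s => Metric.infDist (γ s) (frontier D)) (Icc 0 1) 1 :=
      (Metric.continuous_infDist_pt _).continuousAt.comp_continuousWithinAt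
        (hγc 1 (right_mem_Icc.2 zero_le_one))
    have h2 := h1.eventually (gt_mem_nhds
      (show Metric.infDist (γ 1) (frontier D) < δ by rwa [Metric.infDist_zero_of_mem hγ.2.2.2]))
    rw [nhdsWithin_Icc_eq_nhdsLE zero_lt_one] at h2
    exact h2.filter_mono (nhdsWithin_mono _ Iio_subset_Iic_self)
  obtain ⟨b₀, hb₀, hb⟩ := mem_nhdsLT_iff_exists_Ioo_subset.1 hev
  set b := max b₀ 0 with hbdef
  have hb0 : 0 ≤ b := le_max_right _ _
  have hb1 : b < 1 := max_lt hb₀ zero_lt_one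
  -- After `b` the curve is so close to `∂D` that it lies in `O`; the last time `a ≤ b` outside `O`
  -- exists, since the curve starts outside `O`, at level exactly `w`.
  set A := Icc 0 b ∩ γ ⁻¹' Oᶜ with hA
  have hAc : IsCompact A := by
    refine isCompact_Icc.of_isClosed_subset ?_ inter_subset_left
    exact (hγc.mono (Icc_subset_Icc_right hb1.le)).preimage_isClosed_of_isClosed isClosed_Icc
      hOo.isClosed_compl
  have hA0 : (0 : ℝ) ∈ A := by
    refine ⟨left_mem_Icc.2 hb0, fun h => ?_⟩
    rw [hγ.2.1] at h
    exact lt_irrefl _ h.2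
  obtain ⟨a, ⟨⟨ha0, hab⟩, haO⟩, hmax⟩ := hAc.exists_isGreatest ⟨0, hA0⟩
  have ha1 : a < 1 := hab.trans_lt hb1
  have hIoo : ∀ s ∈ Ioo a 1, γ s ∈ O := by
    intro s hs
    by_contra h
    rcases le_or_gt s b with hsb | hsb
    · exact absurd (hmax ⟨⟨ha0.trans hs.1.le, hsb⟩, h⟩) (not_le.2 hs.1)
    · exact h (hnear _ (hγ.2.2.1 s ⟨hb0.trans hsb.le, hs.2⟩)
        (hb ⟨(le_max_left _ _).trans_lt hsb, hs.2⟩))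
  have hcl : γ a ∈ closure O := by
    have h1 : ContinuousWithinAt γ (Ioo a 1) a :=
      (hγc a ⟨ha0, ha1.le⟩).mono fun s hs => ⟨ha0.trans hs.1.le, hs.2.le⟩
    refine h1.mem_closure ?_ hIoo
    rw [closure_Ioo ha1.ne]
    exact left_mem_Icc.2 ha1.le
  -- `γ a` is in the closure of `O` but not in `O`, so its level is exactly `w`.
  have haD := hC.mem_chartRegion_of_mem_closure hH hD hMc ht₂ hc hyc (hγ.2.2.1 a ⟨ha0, ha1⟩) hcl
  refine ⟨a, ⟨ha0, ha1⟩, le_antisymm haD.2 (le_of_not_gt fun h => haO ⟨haD.1, h⟩), fun s hs => ?_⟩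
  rcases hs.1.eq_or_lt with rfl | h
  · exact haD.1
  · exact (hIoo s ⟨h, hs.2⟩).1

/-- The energy of a curve to the boundary is bounded from below by the action, and curves of
least energy have constant speed and stay in the chart. -/
theorem energy_bound (hC : IsCollarChart H E D t₁ q p) (hH : IsClassicalHamiltonian H)
    (hD : IsPotentialWell H E D) (hDc : IsCompact (closure D)) {t₂ : ℝ} (ht₂ : t₂ ∈ Ioo 0 t₁)
    {c : ℝ} (hc : ∀ x ∈ frontier D, c ≤ restAction H q p (t₂, x))
    (hy : y ∈ chartRegion D t₁ q) (hyc : chartAction H D t₁ q p y ≤ c)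
    (hγ : γ ∈ curvesToBoundary D y) :
    chartAction H D t₁ q p y ^ 2 / 4 ≤ energy H E D γ ∧
      (energy H E D γ ≤ chartAction H D t₁ q p y ^ 2 / 4 →
        (∀ᵐ s, s ∈ Ioc (0 : ℝ) 1 →
          supportFunction H E (γ s) (deriv γ s) = chartAction H D t₁ q p y) ∧
        ∀ s ∈ Ico (0 : ℝ) 1, γ s ∈ chartRegion D t₁ q ∧
          chartAction H D t₁ q p (γ s) = chartAction H D t₁ q p y * (1 - s)) := by
  have hMc : IsCompact (frontier D) := hDc.of_isClosed_subset isClosed_frontier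
    frontier_subset_closure
  obtain ⟨a, ha, haw, hmem⟩ := hC.exists_last_entry hH hD hMc ht₂ hc hy hyc hγ
  have hw := hC.chartAction_pos hH hD hy
  set w := chartAction H D t₁ q p y with hwdef
  set f : ℝ → ℝ := fun s => supportFunction H E (γ s) (deriv γ s) with hf
  have hint : ∀ u ∈ Icc (0 : ℝ) 1, ∀ v ∈ Icc (0 : ℝ) 1, IntervalIntegrable f volume u v :=
    fun u hu v hv => intervalIntegrable_supportFunction hH hD hDc hγ hu hv
  have m0 : (0 : ℝ) ∈ Icc (0 : ℝ) 1 := left_mem_Icc.2 zero_le_one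
  have m1 : (1 : ℝ) ∈ Icc (0 : ℝ) 1 := right_mem_Icc.2 zero_le_one
  have ma : a ∈ Icc (0 : ℝ) 1 := ⟨ha.1, ha.2.le⟩
  have hac : ∀ u ∈ Icc (0 : ℝ) 1, ∀ v ∈ Icc (0 : ℝ) 1, AbsolutelyContinuousOnInterval γ u v :=
    fun u hu v hv => hγ.1.2.1.mono (by rw [uIcc_of_le zero_le_one]; exact uIcc_subset_Icc hu hv)
  have h1 : w ≤ ∫ s in a..1, f s := by
    rw [← haw]
    exact hC.chartAction_le_integral hH hD hMc ha.2 (hac a ma 1 m1) hmem hγ.2.2.2 (hint a ma 1 m1)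
  have h2 : 0 ≤ ∫ s in (0 : ℝ)..a, f s := by
    refine intervalIntegral.integral_nonneg ha.1 fun s hs => ?_
    exact hH.supportFunction_nonneg
      (hD.potential_lt _ (hγ.2.2.1 s ⟨hs.1, hs.2.trans_lt ha.2⟩)).le _
  have h3 := intervalIntegral.integral_add_adjacent_intervals (hint 0 m0 a ma) (hint a ma 1 m1)
  have hLp : MemLp f 2 (volume.restrict (Ioc 0 1)) := memLp_supportFunction hH hD hDc hγ
  have h4 := integral_sub_const_sq hLp w
  have h5 := energy_eq_integral hH hD hγ
  change energy H E D γ = (∫ s in (0 : ℝ)..1, f s ^ 2) / 4 at h5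
  have h6 : 0 ≤ ∫ s in (0 : ℝ)..1, (f s - w) ^ 2 :=
    intervalIntegral.integral_nonneg zero_le_one fun s _ => sq_nonneg _
  -- Insert `∫ f ≥ w` into `0 ≤ ∫ (f - w)² = 4 𝒥 - 2 w ∫ f + w²`: this gives `4 𝒥 ≥ w²`, and
  -- equality makes the variance vanish.
  have h7 : w * w ≤ w * ∫ s in (0 : ℝ)..1, f s := by
    refine mul_le_mul_of_nonneg_left ?_ hw.le
    linarith
  refine ⟨by nlinarith, fun hle => ?_⟩
  have h8 : ∫ s in (0 : ℝ)..1, (f s - w) ^ 2 = 0 := by nlinarith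
  have hae : ∀ᵐ s, s ∈ Ioc (0 : ℝ) 1 → f s = w := by
    have hi : Integrable (fun s => (f s - w) ^ 2) (volume.restrict (Ioc (0 : ℝ) 1)) :=
      (hLp.sub (memLp_const w)).integrable_sq
    rw [intervalIntegral.integral_of_le zero_le_one,
      integral_eq_zero_iff_of_nonneg (fun s => sq_nonneg _) hi] at h8
    rw [← ae_restrict_iff' measurableSet_Ioc]
    filter_upwards [h8] with s hs
    exact sub_eq_zero.1 (pow_eq_zero_iff two_ne_zero |>.1 hs)
  refine ⟨hae, ?_⟩
  have hconst : ∀ u ∈ Icc (0 : ℝ) 1, ∀ v ∈ Icc (0 : ℝ) 1, u ≤ v →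
      ∫ s in u..v, f s = w * (v - u) := by
    intro u hu v hv huv
    have : ∫ s in u..v, f s = ∫ s in u..v, w := by
      refine intervalIntegral.integral_congr_ae ?_
      filter_upwards [hae] with s hs hsu
      rw [uIoc_of_le huv] at hsu
      exact hs ⟨hu.1.trans_lt hsu.1, hsu.2.trans hv.2⟩
    rw [this, intervalIntegral.integral_const, smul_eq_mul, mul_comm]
  -- Speed `w` on `[a, 1]` gives length `w (1 - a)`, which is at least `w` only if `a = 0`.
  have ha0 : a = 0 := by
    rw [hconst a ma 1 m1 ha.2.le] at h1
    have : w * a ≤ 0 := by linarith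
    exact le_antisymm (nonpos_of_mul_nonpos_right this hw) ha.1
  subst ha0
  intro s hs
  have ms : s ∈ Icc (0 : ℝ) 1 := ⟨hs.1, hs.2.le⟩
  refine ⟨hmem s hs, le_antisymm ?_ ?_⟩
  -- The length bound on `[s, 1]` gives `S(γ s) ≤ w (1 - s)`; the one on `[0, s]` gives the reverse.
  · rw [← hconst s ms 1 m1 hs.2.le]
    exact hC.chartAction_le_integral hH hD hMc hs.2 (hac s ms 1 m1)
      (fun r hr => hmem r ⟨hs.1.trans hr.1, hr.2⟩) hγ.2.2.2 (hint s ms 1 m1)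
  · have h9 := hC.chartAction_sub_le hH hD hMc hs.1 (hac 0 m0 s ms)
      (fun r hr => hmem r ⟨hr.1, hr.2.trans_lt hs.2⟩) (hint 0 m0 s ms)
    rw [haw] at h9
    have h10 := hconst 0 m0 s ms hs.1
    simp only [hf] at h10
    rw [h10] at h9
    linarith

/-- In the coordinates `(t, x)` the orbits are the lines `x = const`, run at unit speed. -/
theorem fderiv_chartInv_velocity (hC : IsCollarChart H E D t₁ q p)
    (hy : y ∈ chartRegion D t₁ q) :
    fderiv ℝ (chartInv D t₁ q) y (velocity H y (chartMomentum D t₁ q p y)) = (1, 0) := by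
  obtain ⟨⟨t, x⟩, ⟨ht, hx⟩, rfl⟩ := hy
  have h1 : HasFDerivAt (chartInv D t₁ q) (fderiv ℝ (chartInv D t₁ q) (q (t, x))) (q (t, x)) :=
    ((hC.contDiffAt_chartInv ⟨(t, x), ⟨ht, hx⟩, rfl⟩).differentiableAt one_ne_zero).hasFDerivAt
  have h2 := HasFDerivAt.comp_hasDerivAt (f := fun s => q (s, x)) t h1
    (hC.deriv_q x hx t (mem_Icc_of_mem_Ioo ht))
  have h3 : HasDerivAt (fun s : ℝ => (s, x)) ((1 : ℝ), (0 : Vec n)) t :=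
    (hasDerivAt_id t).prodMk (hasDerivAt_const t x)
  have h4 : (fun s => chartInv D t₁ q (q (s, x))) =ᶠ[𝓝 t] fun s => (s, x) := by
    filter_upwards [Ioo_mem_nhds ht.1 ht.2] with s hs using hC.chartInv_apply hs hx
  have h5 := h2.unique (h3.congr_of_eventuallyEq h4)
  rwa [chartMomentum, hC.chartInv_apply ht hx]

/-- A curve of least energy is a reparametrized orbit. -/
theorem chartInv_snd_eq_of_energy_le (hC : IsCollarChart H E D t₁ q p)
    (hH : IsClassicalHamiltonian H) (hD : IsPotentialWell H E D) (hDc : IsCompact (closure D))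
    {w : ℝ} (hγ : AbsolutelyContinuousOnInterval γ 0 1)
    (hae : ∀ᵐ s, s ∈ Ioc (0 : ℝ) 1 → supportFunction H E (γ s) (deriv γ s) = w)
    (hmem : ∀ s ∈ Ico (0 : ℝ) 1, γ s ∈ chartRegion D t₁ q ∧
      chartAction H D t₁ q p (γ s) = w * (1 - s)) {s : ℝ} (hs : s ∈ Ico (0 : ℝ) 1) :
    (chartInv D t₁ q (γ s)).2 = (chartInv D t₁ q (γ 0)).2 := by
  have hMc : IsCompact (frontier D) := hDc.of_isClosed_subset isClosed_frontier
    frontier_subset_closure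
  have hsub : uIcc 0 s ⊆ uIcc 0 1 := by
    rw [uIcc_of_le hs.1, uIcc_of_le zero_le_one]; exact Icc_subset_Icc_right hs.2.le
  have hmem' : ∀ r ∈ Icc 0 s, γ r ∈ chartRegion D t₁ q := fun r hr =>
    (hmem r ⟨hr.1, hr.2.trans_lt hs.2⟩).1
  have hac : AbsolutelyContinuousOnInterval (fun r => (chartInv D t₁ q (γ r)).2) 0 s :=
    (hγ.mono hsub).contDiffAt_comp (f := fun z => (chartInv D t₁ q z).2) fun r hr =>
      (hC.contDiffAt_chartInv (hmem' r (by rwa [uIcc_of_le hs.1] at hr))).snd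
  have hd : ∀ᵐ r, r ∈ uIcc 0 s → HasDerivAt (fun r => (chartInv D t₁ q (γ r)).2) 0 r := by
    filter_upwards [hC.ae_hasDerivAt_chartAction hH hD hMc hs.1 (hγ.mono hsub) hmem', hae,
      compl_mem_ae_iff.2 (Real.volume_singleton (a := 0))] with r h1 h2 h3 hr
    rw [uIcc_of_le hs.1] at hr
    obtain ⟨h4, h5⟩ := h1 hr
    have hr0 : 0 < r := lt_of_le_of_ne hr.1 (Ne.symm h3)
    have hr1 : r < 1 := hr.2.trans_lt hs.2
    have hσ := h2 ⟨hr0, hr1.le⟩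
    have h6 : HasDerivAt (fun s => chartAction H D t₁ q p (γ s)) (-w) r := by
      have : HasDerivAt (fun s : ℝ => w * (1 - s)) (-w) r := by
        simpa using ((hasDerivAt_id r).const_sub 1).const_mul w
      refine this.congr_of_eventuallyEq ?_
      filter_upwards [Ioo_mem_nhds hr0 hr1] with u hu using (hmem u ⟨hu.1.le, hu.2⟩).2
    have h7 := h5.unique h6
    -- `⟨P, γ'⟩ = -w` and `σ(γ, γ') = w` say that `P` maximizes `⟨-γ', ·⟩` over the body; so `-γ'`
    -- is a multiple of the velocity and does not change the coordinate `x`.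
    have hP := hC.energy_chartMomentum hH hD (hmem' r hr)
    have hP0 := hC.chartMomentum_ne_zero hH hD (hmem' r hr)
    obtain ⟨c, -, h8⟩ := hH.exists_smul_velocity_of_eq_supportFunction (v := -deriv γ r) hP hP0 (by
      rw [hH.supportFunction_neg, hσ, inner_neg_left, real_inner_comm, h7, neg_neg])
    have h9 : HasDerivAt (fun r => chartInv D t₁ q (γ r))
        (fderiv ℝ (chartInv D t₁ q) (γ r) (deriv γ r)) r :=
      ((hC.contDiffAt_chartInv (hmem' r hr)).differentiableAt one_ne_zero).hasFDerivAt.comp_hasDerivAt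
        r h4.hasDerivAt
    have h10 : deriv γ r = -(c • velocity H (γ r) (chartMomentum D t₁ q p (γ r))) := by
      rw [← h8, neg_neg]
    rw [h10, map_neg, map_smul, hC.fderiv_chartInv_velocity (hmem' r hr)] at h9
    have h11 := (ContinuousLinearMap.snd ℝ ℝ (Vec n)).hasFDerivAt.comp_hasDerivAt r h9
    exact h11.congr_deriv (by simp)
  obtain ⟨x, hx⟩ := hac.const_of_ae_hasDerivAt_zero hd
  rw [hx s right_mem_uIcc, hx 0 left_mem_uIcc]

end IsCollarChart

end BrakeOrbits
end

/-! ### The orbit as the unique minimizer -/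

/-- A continuous injective function on a compact interval has a continuous inverse. -/
theorem ContinuousOn.continuousOn_invFunOn_of_isCompact {X Y : Type*} [TopologicalSpace X]
    [TopologicalSpace Y] [T2Space Y] [Nonempty X] {f : X → Y} {K : Set X}
    (hf : ContinuousOn f K) (hK : IsCompact K) (hinj : InjOn f K) :
    ContinuousOn (Function.invFunOn f K) (f '' K) := by
  rw [continuousOn_iff_isClosed]
  intro C hC
  refine ⟨f '' (K ∩ C), ((hK.inter_right hC).image_of_continuousOn
    (hf.mono inter_subset_left)).isClosed, ?_⟩
  ext y
  constructor
  · rintro ⟨hy, x, hx, rfl⟩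
    rw [mem_preimage, hinj.leftInvOn_invFunOn hx] at hy
    exact ⟨⟨x, ⟨hx, hy⟩, rfl⟩, ⟨x, hx, rfl⟩⟩
  · rintro ⟨⟨x, ⟨hx, hxC⟩, rfl⟩, hy⟩
    refine ⟨?_, hy⟩
    rwa [mem_preimage, hinj.leftInvOn_invFunOn hx]

/-- A curve which is differentiable on `[0, 1)`, with square integrable derivative, belongs to
the Sobolev space. -/
theorem absolutelyContinuousOnInterval_of_hasDerivAt {V : Type*} [NormedAddCommGroup V]
    [NormedSpace ℝ V] [CompleteSpace V] {γ : ℝ → V} (hγ : ContinuousOn γ (Icc 0 1))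
    (hd : ∀ s ∈ Ioo (0 : ℝ) 1, DifferentiableAt ℝ γ s)
    (hint : IntervalIntegrable (deriv γ) volume 0 1) : AbsolutelyContinuousOnInterval γ 0 1 := by
  -- Increments of `γ` are dominated by those of the primitive of `‖γ'‖`, which is absolutely
  -- continuous.
  have hF := hint.norm.absolutelyContinuousOnInterval_intervalIntegral (c := 0) left_mem_uIcc
  have key : ∀ s ∈ Icc (0 : ℝ) 1, ∀ t ∈ Icc (0 : ℝ) 1, s ≤ t →
      dist (γ s) (γ t) ≤ dist (∫ v in (0 : ℝ)..s, ‖deriv γ v‖) (∫ v in (0 : ℝ)..t, ‖deriv γ v‖) := by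
    intro s hs t ht hst
    have hi : ∀ u ∈ Icc (0 : ℝ) 1, ∀ v ∈ Icc (0 : ℝ) 1, IntervalIntegrable (deriv γ) volume u v :=
      fun u hu v hv => hint.mono_set (by rw [uIcc_of_le zero_le_one]; exact uIcc_subset_Icc hu hv)
    have h1 := intervalIntegral.integral_eq_sub_of_hasDerivAt_of_le hst
      (hγ.mono (Icc_subset_Icc hs.1 ht.2))
      (fun r hr => (hd r ⟨hs.1.trans_lt hr.1, hr.2.trans_le ht.2⟩).hasDerivAt) (hi s hs t ht)
    have h2 := intervalIntegral.integral_interval_sub_left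
      (hi 0 (left_mem_Icc.2 zero_le_one) t ht).norm (hi 0 (left_mem_Icc.2 zero_le_one) s hs).norm
    rw [dist_comm, dist_comm (∫ v in (0 : ℝ)..s, ‖deriv γ v‖), dist_eq_norm, Real.dist_eq, h2, ← h1]
    exact (intervalIntegral.norm_integral_le_integral_norm hst).trans (le_abs_self _)
  refine hF.of_dist_le 1 fun s hs t ht => ?_
  rw [uIcc_of_le zero_le_one] at hs ht
  rw [one_mul]
  rcases le_total s t with h | h
  · exact key s hs t ht h
  · rw [dist_comm (γ s), dist_comm (∫ v in (0 : ℝ)..s, ‖deriv γ v‖)]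
    exact key t ht s hs h

noncomputable section

namespace BrakeOrbits

variable {n : ℕ} {H : Vec n → Vec n → ℝ} {E : ℝ} {D : Set (Vec n)} {t₁ : ℝ}
  {q p : ℝ × Vec n → Vec n}

/-- The rate of change of the action along the solutions starting at rest. -/
def restPower (H : Vec n → Vec n → ℝ) (q p : ℝ × Vec n → Vec n) (w : ℝ × Vec n) : ℝ :=
  inner ℝ (velocity H (q w) (p w)) (p w)

namespace IsCollarChart

theorem restPower_pos (hC : IsCollarChart H E D t₁ q p) (hH : IsClassicalHamiltonian H)
    (hD : IsPotentialWell H E D) {t : ℝ} (ht : t ∈ Ioc 0 t₁) {x : Vec n}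
    (hx : x ∈ frontier D) : 0 < restPower H q p (t, x) :=
  hH.inner_velocity_pos (hC.p_ne_zero hH hD ht hx)

/-- The time change for which the action grows linearly. -/
theorem exists_timeChange (hC : IsCollarChart H E D t₁ q p) (hH : IsClassicalHamiltonian H)
    (hD : IsPotentialWell H E D) {x : Vec n} (hx : x ∈ frontier D) {t : ℝ} (ht : t ∈ Ioo 0 t₁) :
    ∃ τ : ℝ → ℝ, ContinuousOn τ (Icc 0 1) ∧ τ 0 = t ∧ τ 1 = 0 ∧
      ∀ s ∈ Ico (0 : ℝ) 1, τ s ∈ Ioo 0 t₁ ∧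
        restAction H q p (τ s, x) = restAction H q p (t, x) * (1 - s) ∧
        HasDerivAt τ (-(restAction H q p (t, x) / restPower H q p (τ s, x))) s := by
  set f : ℝ → ℝ := fun s => restAction H q p (s, x) with hf
  have hmono : StrictMonoOn f (Icc 0 t₁) := hC.strictMonoOn_restAction hH hD hx
  have hcont : ContinuousOn f (Icc 0 t₁) := fun s hs =>
    (hC.hasDerivWithinAt_restAction hH hs hx).continuousWithinAt
  have hf0 : f 0 = 0 := restAction_zero x
  have m0 : (0 : ℝ) ∈ Icc 0 t₁ := left_mem_Icc.2 hC.pos.le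
  have m1 : t₁ ∈ Icc 0 t₁ := right_mem_Icc.2 hC.pos.le
  have mt := mem_Icc_of_mem_Ioo ht
  have himg : f '' Icc 0 t₁ = Icc (f 0) (f t₁) := by
    refine Subset.antisymm ?_ (intermediate_value_Icc hC.pos.le hcont)
    rintro _ ⟨s, hs, rfl⟩
    exact ⟨hmono.monotoneOn m0 hs hs.1, hmono.monotoneOn hs m1 hs.2⟩
  rw [hf0] at himg
  set g := Function.invFunOn f (Icc 0 t₁) with hg
  have hgc : ContinuousOn g (Icc 0 (f t₁)) := by
    rw [← himg]
    exact hcont.continuousOn_invFunOn_of_isCompact isCompact_Icc hmono.injOn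
  have hgm : ∀ u ∈ Icc 0 (f t₁), g u ∈ Icc 0 t₁ ∧ f (g u) = u := fun u hu => by
    rw [← himg] at hu
    exact ⟨Function.invFunOn_mem hu, Function.invFunOn_eq hu⟩
  have hgf : ∀ s ∈ Icc 0 t₁, g (f s) = s := fun s hs => hmono.injOn.leftInvOn_invFunOn hs
  set w := f t with hw
  have hw0 : 0 < w := by rw [← hf0]; exact hmono m0 mt ht.1
  have hw1 : w < f t₁ := hmono mt m1 ht.2
  -- The time at which the action equals `w (1 - s)`. Differentiability is asserted only before `s =
  -- 1`, because the power vanishes at rest.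
  refine ⟨fun s => g (w * (1 - s)), ?_, ?_, ?_, fun s hs => ?_⟩
  · refine hgc.comp (by fun_prop) fun s hs => ⟨mul_nonneg hw0.le (sub_nonneg.2 hs.2), ?_⟩
    exact (mul_le_of_le_one_right hw0.le (by linarith [hs.1])).trans hw1.le
  · simp only [sub_zero, mul_one]
    exact hgf t mt
  · simp only [sub_self, mul_zero]
    have := hgf 0 m0
    rwa [hf0] at this
  · have hu : w * (1 - s) ∈ Ioo 0 (f t₁) :=
      ⟨mul_pos hw0 (by linarith [hs.2]),
        (mul_le_of_le_one_right hw0.le (by linarith [hs.1])).trans_lt hw1⟩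
    obtain ⟨h1, h2⟩ := hgm _ ⟨hu.1.le, hu.2.le⟩
    have hpos : 0 < g (w * (1 - s)) := by
      rw [← hmono.lt_iff_lt m0 h1, h2, hf0]; exact hu.1
    have hlt : g (w * (1 - s)) < t₁ := by
      rw [← hmono.lt_iff_lt h1 m1, h2]; exact hu.2
    refine ⟨⟨hpos, hlt⟩, h2, ?_⟩
    have h3 : HasDerivAt f (restPower H q p (g (w * (1 - s)), x)) (g (w * (1 - s))) :=
      (hC.hasDerivWithinAt_restAction hH h1 hx).hasDerivAt (Icc_mem_nhds hpos hlt)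
    have h4 := HasDerivAt.of_local_left_inverse
      (hgc.continuousAt (Icc_mem_nhds hu.1 hu.2)) h3
      (hC.restPower_pos hH hD ⟨hpos, hlt.le⟩ hx).ne'
      (by
        filter_upwards [Ioo_mem_nhds hu.1 hu.2] with v hv
        exact (hgm v ⟨hv.1.le, hv.2.le⟩).2)
    have h5 : HasDerivAt (fun s : ℝ => w * (1 - s)) (-w) s := by
      simpa using ((hasDerivAt_id s).const_sub 1).const_mul w
    refine (h4.comp s h5).congr_deriv ?_
    rw [div_eq_mul_inv]
    ring

theorem _root_.BrakeOrbits.IsClassicalHamiltonian.exists_norm_velocity_le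
    (hH : IsClassicalHamiltonian H) {K : Set (Vec n)} (hK : IsCompact K) (R : ℝ) :
    ∃ L : ℝ, 0 ≤ L ∧ ∀ q ∈ K, ∀ p : Vec n, ‖p‖ ≤ R → ‖velocity H q p‖ ≤ L * ‖p‖ := by
  obtain ⟨L, hL⟩ := ContDiff.exists_lipschitzOnWith_of_isCompact
    (hK.prod (isCompact_closedBall (0 : Vec n) R))
    (fun w _ => hH.contDiff_velocity.contDiffAt)
  refine ⟨L, L.2, fun q hq p hp => ?_⟩
  have m1 : (q, p) ∈ K ×ˢ Metric.closedBall (0 : Vec n) R := ⟨hq, mem_closedBall_zero_iff.2 hp⟩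
  have m2 : (q, (0 : Vec n)) ∈ K ×ˢ Metric.closedBall (0 : Vec n) R :=
    ⟨hq, Metric.mem_closedBall_self ((norm_nonneg _).trans hp)⟩
  have h1 := hL.norm_sub_le m1 m2
  rw [Prod.mk_sub_mk, Prod.norm_mk, sub_self, norm_zero, sub_zero,
    max_eq_right (norm_nonneg _)] at h1
  simpa only [hH.velocity_zero, sub_zero] using h1

/-- The velocity is `O(‖p‖)`, and the power is at least a constant times `‖p‖²`. This compensates
for the vanishing power in the time change. -/
theorem exists_norm_velocity_sq_le (hC : IsCollarChart H E D t₁ q p)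
    (hH : IsClassicalHamiltonian H) {x : Vec n} (hx : x ∈ frontier D) :
    ∃ K : ℝ, 0 ≤ K ∧ ∀ t ∈ Icc 0 t₁,
      ‖velocity H (q (t, x)) (p (t, x))‖ ^ 2 ≤ K * restPower H q p (t, x) := by
  obtain ⟨ν, hν, hν0, hνH⟩ := hH.posDef
  have hqc : ContinuousOn (fun t => q (t, x)) (Icc 0 t₁) := fun t ht =>
    (hC.deriv_q x hx t ht).continuousAt.continuousWithinAt
  have hpc : ContinuousOn (fun t => p (t, x)) (Icc 0 t₁) := fun t ht =>
    (hC.deriv_p x hx t ht).continuousAt.continuousWithinAt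
  obtain ⟨R, hR⟩ := isCompact_Icc.exists_bound_of_continuousOn hpc
  obtain ⟨L, hL0, hL⟩ :=
    hH.exists_norm_velocity_le (isCompact_Icc.image_of_continuousOn hqc) R
  obtain ⟨t₀, ht₀, hmin⟩ := isCompact_Icc.exists_isMinOn (nonempty_Icc.2 hC.pos.le)
    (hν.comp_continuousOn hqc)
  set m := ν (q (t₀, x)) with hm
  have hm0 : 0 < m := hν0 _
  refine ⟨L ^ 2 / m, by positivity, fun t ht => ?_⟩
  have h1 := hL (q (t, x)) (mem_image_of_mem _ ht) (p (t, x)) (hR t ht)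
  have h2 : m ≤ ν (q (t, x)) := hmin ht
  have h3 : ν (q (t, x)) * ‖p (t, x)‖ ^ 2 ≤ restPower H q p (t, x) :=
    hH.le_inner_velocity hνH _ _
  calc _ ≤ (L * ‖p (t, x)‖) ^ 2 := pow_le_pow_left₀ (norm_nonneg _) h1 2
    _ = L ^ 2 / m * (m * ‖p (t, x)‖ ^ 2) := by field_simp
    _ ≤ L ^ 2 / m * restPower H q p (t, x) := by
        refine mul_le_mul_of_nonneg_left (le_trans ?_ h3) (by positivity)
        exact mul_le_mul_of_nonneg_right h2 (sq_nonneg _)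

/-- The orbit through a point of the chart, parametrized by constant speed, is a curve to the
boundary whose energy is a quarter of the squared action. -/
theorem exists_orbit_curve (hC : IsCollarChart H E D t₁ q p) (hH : IsClassicalHamiltonian H)
    (hD : IsPotentialWell H E D) {x : Vec n} (hx : x ∈ frontier D) {t : ℝ} (ht : t ∈ Ioo 0 t₁) :
    ∃ γ : ℝ → Vec n, γ ∈ curvesToBoundary D (q (t, x)) ∧
      energy H E D γ = restAction H q p (t, x) ^ 2 / 4 ∧
      (∀ s ∈ Ico (0 : ℝ) 1, ∃ r ∈ Icc 0 t₁, γ s = q (r, x) ∧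
        restAction H q p (r, x) = restAction H q p (t, x) * (1 - s)) ∧
      HasDerivAt γ (-((restAction H q p (t, x) / restPower H q p (t, x)) •
        velocity H (q (t, x)) (p (t, x)))) 0 := by
  obtain ⟨τ, hτc, hτ0, hτ1, hτ⟩ := hC.exists_timeChange hH hD hx ht
  obtain ⟨K, hK0, hK⟩ := hC.exists_norm_velocity_sq_le hH hx
  set w := restAction H q p (t, x) with hw
  have hw0 : 0 < w := hC.restAction_pos hH hD ⟨ht.1, ht.2.le⟩ hx
  set γ : ℝ → Vec n := fun s => q (τ s, x) with hγ
  have hτmem : ∀ s ∈ Icc (0 : ℝ) 1, τ s ∈ Icc 0 t₁ := by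
    intro s hs
    rcases hs.2.eq_or_lt with rfl | h
    · rw [hτ1]; exact left_mem_Icc.2 hC.pos.le
    · exact mem_Icc_of_mem_Ioo (hτ s ⟨hs.1, h⟩).1
  have hγd : ∀ s ∈ Ico (0 : ℝ) 1, HasDerivAt γ (-((w / restPower H q p (τ s, x)) •
      velocity H (q (τ s, x)) (p (τ s, x)))) s := by
    intro s hs
    have h1 := HasDerivAt.scomp (h := τ) (g₁ := fun r => q (r, x)) s
      (hC.deriv_q x hx (τ s) (mem_Icc_of_mem_Ioo (hτ s hs).1)) (hτ s hs).2.2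
    rw [neg_smul] at h1
    exact h1
  have hγc : ContinuousOn γ (Icc 0 1) := by
    have hqc : ContinuousOn (fun r => q (r, x)) (Icc 0 t₁) := fun r hr =>
      (hC.deriv_q x hx r hr).continuousAt.continuousWithinAt
    exact hqc.comp hτc hτmem
  have hpow : ∀ s ∈ Ico (0 : ℝ) 1, 0 < restPower H q p (τ s, x) := fun s hs =>
    hC.restPower_pos hH hD ⟨(hτ s hs).1.1, (hτ s hs).1.2.le⟩ hx
  -- The bound is a constant times `-τ'`, which is integrable because `τ` is continuous and
  -- decreasing; so `γ'` is square integrable although `τ'` alone need not be.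
  have hbound : ∀ s ∈ Ico (0 : ℝ) 1,
      ‖deriv γ s‖ ^ 2 ≤ w * K * (w / restPower H q p (τ s, x)) := by
    intro s hs
    have h1 := hK (τ s) (mem_Icc_of_mem_Ioo (hτ s hs).1)
    have h2 := hpow s hs
    rw [(hγd s hs).deriv, norm_neg, norm_smul, mul_pow, Real.norm_eq_abs, sq_abs]
    calc _ ≤ (w / restPower H q p (τ s, x)) ^ 2 * (K * restPower H q p (τ s, x)) := by gcongr
      _ = _ := by field_simp
  have hint1 : IntegrableOn (fun s => w / restPower H q p (τ s, x)) (Icc 0 1) := by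
    rw [integrableOn_Icc_iff_integrableOn_Ioc]
    refine intervalIntegral.integrableOn_deriv_of_nonneg (g := fun s => -τ s) hτc.neg
      (fun s hs => ?_) fun s hs => (div_pos hw0 (hpow s ⟨hs.1.le, hs.2⟩)).le
    exact (hτ s ⟨hs.1.le, hs.2⟩).2.2.fun_neg.congr_deriv (neg_neg _)
  have hLp : MemLp (deriv γ) 2 (volume.restrict (Icc 0 1)) := by
    rw [memLp_two_iff_integrable_sq_norm (measurable_deriv γ).aestronglyMeasurable]
    refine Integrable.mono' (hint1.const_mul (w * K))
      ((measurable_deriv γ).norm.pow_const 2).aestronglyMeasurable ?_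
    rw [ae_restrict_iff' measurableSet_Icc]
    filter_upwards [compl_mem_ae_iff.2 (Real.volume_singleton (a := 1))] with s hs1 hs
    rw [Real.norm_of_nonneg (sq_nonneg _)]
    exact hbound s ⟨hs.1, lt_of_le_of_ne hs.2 hs1⟩
  have hac : AbsolutelyContinuousOnInterval γ 0 1 := by
    refine absolutelyContinuousOnInterval_of_hasDerivAt hγc
      (fun s hs => (hγd s ⟨hs.1.le, hs.2⟩).differentiableAt) ?_
    rw [intervalIntegrable_iff_integrableOn_Icc_of_le zero_le_one]
    exact hLp.integrable one_le_two
  have hmemD : ∀ s ∈ Ico (0 : ℝ) 1, γ s ∈ D := fun s hs =>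
    hC.mem x hx (τ s) ⟨(hτ s hs).1.1, (hτ s hs).1.2.le⟩
  have hγ1 : γ 1 = x := by rw [hγ]; simp only [hτ1]; exact hC.q_zero x hx
  have hX : γ ∈ curvesToBoundary D (q (t, x)) := by
    refine ⟨⟨fun s hs => ?_, hac, hLp⟩, by rw [hγ]; simp only [hτ0], hmemD, by rwa [hγ1]⟩
    rcases hs.2.eq_or_lt with rfl | h
    · rw [hγ1]; exact frontier_subset_closure hx
    · exact subset_closure (hmemD s ⟨hs.1, h⟩)
  refine ⟨γ, hX, ?_, fun s hs => ⟨τ s, mem_Icc_of_mem_Ioo (hτ s hs).1, rfl, (hτ s hs).2.1⟩, ?_⟩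
  · rw [energy_eq_integral hH hD hX]
    have : ∫ s in (0 : ℝ)..1, supportFunction H E (γ s) (deriv γ s) ^ 2 = ∫ s in (0 : ℝ)..1, w ^ 2 := by
      refine intervalIntegral.integral_congr_ae ?_
      filter_upwards [compl_mem_ae_iff.2 (Real.volume_singleton (a := 1))] with s hs1 hs
      rw [uIoc_of_le zero_le_one] at hs
      have hs' : s ∈ Ico (0 : ℝ) 1 := ⟨hs.1.le, lt_of_le_of_ne hs.2 hs1⟩
      have hP := hC.energy_eq hH hD (mem_Icc_of_mem_Ioo (hτ s hs').1) hx
      have h0 := hpow s hs'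
      rw [(hγd s hs').deriv, hH.supportFunction_neg,
        hH.supportFunction_smul_velocity hP (div_pos hw0 h0).le]
      change (w / restPower H q p (τ s, x) * restPower H q p (τ s, x)) ^ 2 = w ^ 2
      rw [div_mul_cancel₀ _ h0.ne']
    rw [this]
    simp
  · have := hγd 0 (left_mem_Ico.2 zero_lt_one)
    rwa [hτ0] at this

/-- The value function and the unique minimizer. -/
theorem exists_minimizer (hC : IsCollarChart H E D t₁ q p) (hH : IsClassicalHamiltonian H)
    (hD : IsPotentialWell H E D) (hDc : IsCompact (closure D)) {t₂ : ℝ} (ht₂ : t₂ ∈ Ioo 0 t₁)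
    {c : ℝ} (hc : ∀ x ∈ frontier D, c ≤ restAction H q p (t₂, x)) {y : Vec n}
    (hy : y ∈ chartRegion D t₁ q) (hyc : chartAction H D t₁ q p y ≤ c) :
    boundaryEnergy H E D y = chartAction H D t₁ q p y ^ 2 / 4 ∧
    ∃ γ : ℝ → Vec n, IsMinimizer H E D y γ ∧
      (∀ η, IsMinimizer H E D y η → EqOn η γ (Icc 0 1)) ∧
      HasDerivWithinAt γ (-((chartAction H D t₁ q p y /
        inner ℝ (velocity H y (chartMomentum D t₁ q p y)) (chartMomentum D t₁ q p y)) •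
          velocity H y (chartMomentum D t₁ q p y))) (Icc 0 1) 0 := by
  have hbd := fun η (hη : η ∈ curvesToBoundary D y) =>
    hC.energy_bound hH hD hDc ht₂ hc hy hyc hη
  obtain ⟨⟨t, x⟩, ⟨ht, hx⟩, hq⟩ := id hy
  obtain ⟨γ, hγ, hγE, hγr, hγd⟩ := hC.exists_orbit_curve hH hD hx ht
  have hS : chartAction H D t₁ q p y = restAction H q p (t, x) := by
    rw [← hq, hC.chartAction_apply ht hx]
  have hP : chartMomentum D t₁ q p y = p (t, x) := by
    rw [← hq, chartMomentum, hC.chartInv_apply ht hx]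
  have hinv : chartInv D t₁ q y = (t, x) := by rw [← hq, hC.chartInv_apply ht hx]
  rw [hq] at hγ hγd
  rw [← hS] at hγE
  have hmin : IsMinimizer H E D y γ := ⟨hγ, fun η hη => hγE.le.trans (hbd η hη).1⟩
  refine ⟨?_, γ, hmin, fun η hη => ?_, ?_⟩
  · rw [boundaryEnergy, ← hγE]
    exact IsLeast.csInf_eq ⟨mem_image_of_mem _ hγ, by rintro _ ⟨η, hη, rfl⟩; exact hmin.2 hη⟩
  -- A second minimizer has the same starting point `x` of its orbit and the same action `w (1 - s)`
  -- at each `s`; the action determines the time along the orbit.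
  · obtain ⟨hae, hmem⟩ := (hbd η hη.1).2 ((hη.2 hγ).trans hγE.le)
    have hcη := hη.1.1.2.1.continuousOn
    have hcγ := hγ.1.2.1.continuousOn
    rw [uIcc_of_le zero_le_one] at hcη hcγ
    refine EqOn.of_subset_closure (s := Ico 0 1) (fun s hs => ?_) hcη hcγ Ico_subset_Icc_self
      (closure_Ico zero_ne_one).ge
    have h1 := hC.chartInv_snd_eq_of_energy_le hH hD hDc hη.1.1.2.1 hae hmem hs
    rw [hη.1.2.1, hinv] at h1
    obtain ⟨hreg, hact⟩ := hmem s hs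
    have m := chartInv_mem hreg
    obtain ⟨r, hr, hγs, hract⟩ := hγr s hs
    have e : chartInv D t₁ q (η s) = ((chartInv D t₁ q (η s)).1, x) := Prod.ext rfl h1
    rw [chartAction, e, hS, ← hract] at hact
    have h2 := (hC.strictMonoOn_restAction hH hD hx).injOn (mem_Icc_of_mem_Ioo m.1) hr hact
    rw [hγs, ← apply_chartInv hreg, e, h2]
  · rw [hS, hP, ← hq] at *
    exact hγd.hasDerivWithinAt

end IsCollarChart

end BrakeOrbits
end

/-! ### Collar solutions and the differential of the value function -/

noncomputable section

namespace BrakeOrbits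

variable {n : ℕ} {H : Vec n → Vec n → ℝ} {E : ℝ} {D : Set (Vec n)} {t₁ : ℝ}
  {q p : ℝ × Vec n → Vec n} {y : Vec n}

theorem IsClassicalHamiltonian.velocity_neg (hH : IsClassicalHamiltonian H) (q p : Vec n) :
    velocity H q (-p) = -velocity H q p := by
  have h1 : HasGradientAt (fun x => H q x) (velocity H q (-p)) (-p) :=
    (hH.hasFDerivAt_snd q (-p)).differentiableAt.hasGradientAt
  have h2 : HasFDerivAt (fun x => H q (-x))
      ((InnerProductSpace.toDual ℝ (Vec n) (velocity H q (-p))).comp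
        (-ContinuousLinearMap.id ℝ (Vec n))) p :=
    HasFDerivAt.comp (f := fun x : Vec n => -x) p h1.hasFDerivAt (hasFDerivAt_id p).neg
  have h3 : HasGradientAt (fun x => H q x) (-velocity H q (-p)) p := by
    rw [hasGradientAt_iff_hasFDerivAt]
    simp only [hH.even] at h2
    refine h2.congr_fderiv ?_
    ext v
    simp
  have h4 : velocity H q p = -velocity H q (-p) := h3.gradient
  rw [h4, neg_neg]

/-- Otherwise `D` would be clopen, hence the whole space, which is not compact when `n ≥ 1`. -/
theorem frontier_nonempty (hn : 1 ≤ n) (hDc : IsCompact (closure D)) (hDn : D.Nonempty) :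
    (frontier D).Nonempty := by
  rw [nonempty_iff_ne_empty]
  intro h
  have : Nonempty (Fin n) := ⟨⟨0, hn⟩⟩
  rcases isClopen_iff.1 (isClopen_iff_frontier_eq_empty.2 h) with h | h
  · exact hDn.ne_empty h
  · rw [h, closure_univ] at hDc
    have := NormedSpace.noncompactSpace ℝ (Vec n)
    exact noncompact_univ (Vec n) hDc

namespace IsCollarChart

/-- At time `t₂` every orbit is farther than `d` from `∂D`, so a solution confined to distance `d`
ends before `t₂`. This rules out solutions that leave the chart and return. -/
theorem exists_pos_lt_infDist (hC : IsCollarChart H E D t₁ q p)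
    (hMc : IsCompact (frontier D)) {t₂ : ℝ} (ht₂ : t₂ ∈ Ioo 0 t₁) :
    ∃ d > 0, ∀ x ∈ frontier D, d < Metric.infDist (q (t₂, x)) (frontier D) := by
  rcases (frontier D).eq_empty_or_nonempty with hM | hM
  · exact ⟨1, one_pos, by simp [hM]⟩
  have hcont : ContinuousOn (fun x => Metric.infDist (q (t₂, x)) (frontier D)) (frontier D) := by
    intro x hx
    refine ContinuousAt.continuousWithinAt ((Metric.continuous_infDist_pt _).continuousAt.comp ?_)
    exact ContinuousAt.comp (f := fun x => (t₂, x))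
      (hC.contDiffAt_q t₂ (mem_Icc_of_mem_Ioo ht₂) x hx).continuousAt (by fun_prop)
  obtain ⟨x₀, hx₀, hmin⟩ := hMc.exists_isMinOn hM hcont
  have hpos : 0 < Metric.infDist (q (t₂, x₀)) (frontier D) := by
    have := hC.strictMonoOn x₀ hx₀ (left_mem_Icc.2 hC.pos.le) (mem_Icc_of_mem_Ioo ht₂) ht₂.1
    simpa only [hC.q_zero x₀ hx₀, Metric.infDist_zero_of_mem hx₀] using this
  exact ⟨_, half_pos hpos, fun x hx => (half_lt_self hpos).trans_le (hmin hx)⟩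

/-- Solutions starting at rest on the boundary are the orbits of the chart. -/
theorem eqOn_of_isHamiltonSolution (hC : IsCollarChart H E D t₁ q p)
    (hH : IsClassicalHamiltonian H) {T : ℝ} (hT : T ≤ t₁) {q' p' : ℝ → Vec n}
    (hs : IsHamiltonSolution H T q' p') (hq : q' 0 ∈ frontier D) (hp : p' 0 = 0) :
    ∀ t ∈ Icc 0 T, q' t = q (t, q' 0) ∧ p' t = p (t, q' 0) := by
  have h := ContDiff.ode_unique_right hH.contDiff_hamiltonField (T := T)
    (f := fun t => (q' t, p' t)) (g := fun t => (q (t, q' 0), p (t, q' 0)))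
    (fun t ht => (hs t ht).1.prodMk (hs t ht).2)
    (fun t ht => ((hC.deriv_q _ hq t ⟨ht.1, ht.2.trans hT⟩).prodMk
      (hC.deriv_p _ hq t ⟨ht.1, ht.2.trans hT⟩)).hasDerivWithinAt)
    (by simp only [hC.q_zero _ hq, hC.p_zero _ hq, hp])
  exact fun t ht => Prod.mk.inj (h ht)

/-- Energy `E` on `∂D` forces zero initial momentum, so the solution is an orbit of the chart while
the chart lasts; the distance condition excludes `T ≥ t₂`. -/
theorem eqOn_of_isCollarSolution (hC : IsCollarChart H E D t₁ q p)
    (hH : IsClassicalHamiltonian H) (hD : IsPotentialWell H E D) {t₂ : ℝ} (ht₂ : t₂ ∈ Ioo 0 t₁)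
    {δ : ℝ} (hδ : ∀ x ∈ frontier D, δ < Metric.infDist (q (t₂, x)) (frontier D))
    {T : ℝ} {q' p' : ℝ → Vec n} (hs : IsCollarSolution H E D δ y T q' p') :
    T ∈ Ioo 0 t₁ ∧ y = q (T, q' 0) ∧
      ∀ t ∈ Icc 0 T, q' t = q (t, q' 0) ∧ p' t = p (t, q' 0) := by
  have hT := hs.time_pos
  have hp : p' 0 = 0 := by
    refine hH.eq_zero_of_eq_potential (q := q' 0) ?_
    rw [hs.energy_eq 0 (left_mem_Icc.2 hT.le), hD.potential_eq _ hs.start]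
  have hlt : T < t₂ := by
    by_contra! h
    have hsol : IsHamiltonSolution H t₂ q' p' := fun t ht =>
      ⟨(hs.solution t ⟨ht.1, ht.2.trans h⟩).1.mono (Icc_subset_Icc_right h),
        (hs.solution t ⟨ht.1, ht.2.trans h⟩).2.mono (Icc_subset_Icc_right h)⟩
    have h1 := hC.eqOn_of_isHamiltonSolution hH ht₂.2.le hsol hs.start hp t₂
      (right_mem_Icc.2 ht₂.1.le)
    have h2 := hs.near t₂ ⟨ht₂.1.le, h⟩
    rw [h1.1] at h2
    exact (hδ _ hs.start).not_ge h2
  have h3 := hC.eqOn_of_isHamiltonSolution hH (hlt.trans ht₂.2).le hs.solution hs.start hp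
  refine ⟨⟨hT, hlt.trans ht₂.2⟩, ?_, h3⟩
  rw [← (h3 T (right_mem_Icc.2 hT.le)).1, hs.arrive]

/-- For existence, the distance to `∂D` increases along the orbit, so its bound at the end point `y`
holds throughout. For uniqueness, the chart is injective. -/
theorem collarProperty (hC : IsCollarChart H E D t₁ q p)
    (hH : IsClassicalHamiltonian H) (hD : IsPotentialWell H E D) {t₂ : ℝ} (ht₂ : t₂ ∈ Ioo 0 t₁)
    {δ : ℝ} (hδ : ∀ x ∈ frontier D, δ < Metric.infDist (q (t₂, x)) (frontier D))
    (hcol : ∀ y ∈ BrakeOrbits.collar D δ, y ∈ chartRegion D t₁ q) : CollarProperty H E D δ := by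
  intro y hy
  obtain ⟨⟨t, x⟩, ⟨ht, hx⟩, hq⟩ := hcol y hy
  have ht' := mem_Icc_of_mem_Ioo ht
  have hsub : Icc 0 t ⊆ Icc 0 t₁ := Icc_subset_Icc_right ht.2.le
  refine ⟨t, fun s => q (s, x), fun s => p (s, x), ⟨ht.1, fun s hs =>
    ⟨(hC.deriv_q x hx s (hsub hs)).hasDerivWithinAt,
      (hC.deriv_p x hx s (hsub hs)).hasDerivWithinAt⟩,
    fun s hs => hC.energy_eq hH hD (hsub hs) hx, ?_, hq, fun s hs => ?_⟩, fun T q' p' hs => ?_⟩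
  · simpa only [hC.q_zero x hx] using hx
  · refine le_trans ?_ hy.2
    rw [← hq]
    exact (hC.strictMonoOn x hx).monotoneOn (hsub hs) ht' hs.2
  · obtain ⟨hT, hyT, heq⟩ := hC.eqOn_of_isCollarSolution hH hD ht₂ hδ hs
    have h1 := hC.injOn ⟨mem_Icc_of_mem_Ioo hT, hs.start⟩ ⟨ht', hx⟩ (hyT.symm.trans hq.symm)
    obtain ⟨rfl, rfl⟩ := Prod.mk.inj h1
    exact ⟨rfl, fun s hs => (heq s hs).1, fun s hs => (heq s hs).2⟩

theorem eventually_boundaryEnergy_eq (hC : IsCollarChart H E D t₁ q p)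
    (hH : IsClassicalHamiltonian H) (hD : IsPotentialWell H E D) (hDc : IsCompact (closure D))
    {t₂ : ℝ} (ht₂ : t₂ ∈ Ioo 0 t₁) {c : ℝ}
    (hc : ∀ x ∈ frontier D, c ≤ restAction H q p (t₂, x))
    (hy : y ∈ chartRegion D t₁ q) (hyc : chartAction H D t₁ q p y < c) :
    boundaryEnergy H E D =ᶠ[𝓝 y] fun z => chartAction H D t₁ q p z ^ 2 / 4 := by
  have hMc : IsCompact (frontier D) := hDc.of_isClosed_subset isClosed_frontier
    frontier_subset_closure
  filter_upwards [hC.isOpen_chartRegion.mem_nhds hy,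
    (hC.contDiffAt_chartAction hH hD hMc hy).continuousAt.eventually (gt_mem_nhds hyc)]
    with z hz1 hz2
  exact (hC.exists_minimizer hH hD hDc ht₂ hc hz1 hz2.le).1

theorem hasFDerivAt_boundaryEnergy (hC : IsCollarChart H E D t₁ q p)
    (hH : IsClassicalHamiltonian H) (hD : IsPotentialWell H E D) (hDc : IsCompact (closure D))
    {t₂ : ℝ} (ht₂ : t₂ ∈ Ioo 0 t₁) {c : ℝ}
    (hc : ∀ x ∈ frontier D, c ≤ restAction H q p (t₂, x))
    (hy : y ∈ chartRegion D t₁ q) (hyc : chartAction H D t₁ q p y < c) :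
    HasFDerivAt (boundaryEnergy H E D)
      ((chartAction H D t₁ q p y / 2) • innerSL ℝ (chartMomentum D t₁ q p y)) y := by
  have hMc : IsCompact (frontier D) := hDc.of_isClosed_subset isClosed_frontier
    frontier_subset_closure
  refine HasFDerivAt.congr_of_eventuallyEq ?_
    (hC.eventually_boundaryEnergy_eq hH hD hDc ht₂ hc hy hyc)
  simp only [div_eq_mul_inv]
  refine (((hC.hasFDerivAt_chartAction hH hD hMc hy).pow 2).mul_const (4 : ℝ)⁻¹).congr_fderiv ?_
  ext v
  simp only [_root_.smul_apply, smul_eq_mul, nsmul_eq_mul]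
  push_cast
  ring

theorem contDiffAt_boundaryEnergy (hC : IsCollarChart H E D t₁ q p)
    (hH : IsClassicalHamiltonian H) (hD : IsPotentialWell H E D) (hDc : IsCompact (closure D))
    {t₂ : ℝ} (ht₂ : t₂ ∈ Ioo 0 t₁) {c : ℝ}
    (hc : ∀ x ∈ frontier D, c ≤ restAction H q p (t₂, x))
    (hy : y ∈ chartRegion D t₁ q) (hyc : chartAction H D t₁ q p y < c) :
    ContDiffAt ℝ 2 (boundaryEnergy H E D) y := by
  have hMc : IsCompact (frontier D) := hDc.of_isClosed_subset isClosed_frontier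
    frontier_subset_closure
  exact (((hC.contDiffAt_chartAction hH hD hMc hy).pow 2).div_const 4).congr_of_eventuallyEq
    (hC.eventually_boundaryEnergy_eq hH hD hDc ht₂ hc hy hyc)

/-- The differential of `G(y, ·)` at the initial velocity of the minimizer. -/
theorem hasFDerivAt_jacobiFinsler_minimizer (hC : IsCollarChart H E D t₁ q p)
    (hH : IsClassicalHamiltonian H) (hD : IsPotentialWell H E D) (hy : y ∈ chartRegion D t₁ q) :
    HasFDerivAt (jacobiFinsler H E D y)
      (-((chartAction H D t₁ q p y / 2) • innerSL ℝ (chartMomentum D t₁ q p y)))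
      (-((chartAction H D t₁ q p y /
        inner ℝ (velocity H y (chartMomentum D t₁ q p y)) (chartMomentum D t₁ q p y)) •
          velocity H y (chartMomentum D t₁ q p y))) := by
  set P := chartMomentum D t₁ q p y with hP
  have hyD := hC.chartRegion_subset hy
  -- The minimizer runs against the orbit, so its velocity is a positive multiple of `∂H/∂p` at
  -- `-P`, by oddness of `∂H/∂p`.
  have hPE : H y (-P) = E := by rw [hH.even]; exact hC.energy_chartMomentum hH hD hy
  have hpos : 0 < inner ℝ (velocity H y P) P :=
    hH.inner_velocity_pos (hC.chartMomentum_ne_zero hH hD hy)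
  have h1 := hH.hasFDerivAt_jacobiFinsler hyD (hD.potential_lt y hyD) hPE
    (div_pos (hC.chartAction_pos hH hD hy) hpos)
  rw [hH.velocity_neg, inner_neg_neg, div_mul_cancel₀ _ hpos.ne', smul_neg, map_neg, smul_neg] at h1
  exact h1

end IsCollarChart

end BrakeOrbits
end

/-! ### Choice of the collar width and assembly -/

theorem mainTheorem5 (n : ℕ) (hn : 1 ≤ n)
    (H : BrakeOrbits.Vec n → BrakeOrbits.Vec n → ℝ)
    (hH : BrakeOrbits.IsClassicalHamiltonian H)
    (E : ℝ) (D : Set (BrakeOrbits.Vec n))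
    (hD : BrakeOrbits.IsPotentialWell H E D)
    (hDc : IsCompact (closure D)) :
    ∃ δ₀ : ℝ, 0 < δ₀ ∧ ∀ δ : ℝ, 0 < δ → δ ≤ δ₀ →
      BrakeOrbits.CollarProperty H E D δ ∧
      (∀ y ∈ BrakeOrbits.collar D δ, ∃ γ : ℝ → BrakeOrbits.Vec n,
        BrakeOrbits.IsMinimizer H E D y γ ∧
        (∀ η, BrakeOrbits.IsMinimizer H E D y η → EqOn η γ (Icc 0 1)) ∧
        DifferentiableWithinAt ℝ γ (Icc 0 1) 0 ∧
        DifferentiableAt ℝ (BrakeOrbits.jacobiFinsler H E D y)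
          (derivWithin γ (Icc 0 1) 0) ∧
        HasFDerivAt (BrakeOrbits.boundaryEnergy H E D)
          (-(fderiv ℝ (BrakeOrbits.jacobiFinsler H E D y) (derivWithin γ (Icc 0 1) 0))) y) ∧
      (∃ φ : BrakeOrbits.Vec n × BrakeOrbits.Vec n → ℝ,
        (∀ y ∈ BrakeOrbits.collar D δ, ∀ w, ContDiffAt ℝ 1 φ (y, w)) ∧
        ∀ y ∈ BrakeOrbits.collar D δ, ∀ (T : ℝ) (q p γ : ℝ → BrakeOrbits.Vec n),
          BrakeOrbits.IsCollarSolution H E D δ y T q p →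
          BrakeOrbits.IsMinimizer H E D y γ →
          (Real.sqrt (BrakeOrbits.boundaryEnergy H E D y) *
              φ (y, derivWithin q (Icc 0 T) T)) • derivWithin q (Icc 0 T) T
            = -(derivWithin γ (Icc 0 1) 0)) ∧
      (∀ y ∈ BrakeOrbits.collar D δ,
        ContDiffAt ℝ 2 (BrakeOrbits.boundaryEnergy H E D) y) := by
  open BrakeOrbits in
  -- An empty well has empty frontier and no chart, but also empty collars.
  rcases D.eq_empty_or_nonempty with hDe | hDn
  · have hempty : ∀ δ, ∀ y ∈ BrakeOrbits.collar D δ, False := fun δ y hy => by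
      rw [hDe] at hy; exact hy.1
    exact ⟨1, one_pos, fun δ _ _ => ⟨fun y hy => (hempty δ y hy).elim,
      fun y hy => (hempty δ y hy).elim,
      ⟨fun _ => 0, fun y hy => (hempty δ y hy).elim, fun y hy => (hempty δ y hy).elim⟩,
      fun y hy => (hempty δ y hy).elim⟩⟩
  have hM := BrakeOrbits.frontier_nonempty hn hDc hDn
  have hMc : IsCompact (frontier D) := hDc.of_isClosed_subset isClosed_frontier
    frontier_subset_closure
  obtain ⟨t₁, q, p, hC⟩ := hD.exists_collarChart hH hDc hM
  have ht₂ : t₁ / 2 ∈ Ioo 0 t₁ := ⟨half_pos hC.pos, half_lt_self hC.pos⟩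
  obtain ⟨c, hc0, hc⟩ := hC.exists_pos_le_restAction hH hD hMc ht₂
  obtain ⟨d, hd0, hd⟩ := hC.exists_pos_lt_infDist hMc ht₂
  obtain ⟨δ₁, hδ₁, hnear⟩ := hC.exists_near_boundary hH hD hMc hc0
  -- `d` makes collar solutions stop before `t₁ / 2`; `δ₁` puts the collar in the chart with action
  -- below the threshold `c`. The half turns the non-strict bound of the collar into a strict one.
  refine ⟨min d (δ₁ / 2), lt_min hd0 (half_pos hδ₁), fun δ _ hδ => ?_⟩
  have hδd : ∀ x ∈ frontier D, δ < Metric.infDist (q (t₁ / 2, x)) (frontier D) := fun x hx =>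
    (hδ.trans (min_le_left _ _)).trans_lt (hd x hx)
  have hcol : ∀ y ∈ collar D δ, y ∈ chartRegion D t₁ q ∧ chartAction H D t₁ q p y < c :=
    fun y hy => hnear y hy.1
      ((hy.2.trans (hδ.trans (min_le_right _ _))).trans_lt (half_lt_self hδ₁))
  have h01 : UniqueDiffWithinAt ℝ (Icc (0 : ℝ) 1) 0 :=
    uniqueDiffOn_Icc zero_lt_one 0 (left_mem_Icc.2 zero_le_one)
  refine ⟨hC.collarProperty hH hD ht₂ hδd fun y hy => (hcol y hy).1, fun y hy => ?_,
    -- `√ψ = S/2` and `γ'(0) = -(S / ⟨v, P⟩) v` with `v` the arrival velocity, so the factor is `2 /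
    -- ⟨v, P⟩`. It depends on the position only, and is `C¹` because `P` is.
    ⟨fun u => 2 / inner ℝ (velocity H u.1 (chartMomentum D t₁ q p u.1))
      (chartMomentum D t₁ q p u.1), fun y hy w => ?_, fun y hy T q' p' γ hsol hmin => ?_⟩,
    fun y hy => hC.contDiffAt_boundaryEnergy hH hD hDc ht₂ hc (hcol y hy).1 (hcol y hy).2⟩
  · obtain ⟨hyr, hyc⟩ := hcol y hy
    obtain ⟨-, γ, hγ, huniq, hder⟩ := hC.exists_minimizer hH hD hDc ht₂ hc hyr hyc.le
    have hG := hC.hasFDerivAt_jacobiFinsler_minimizer hH hD hyr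
    rw [← hder.derivWithin h01] at hG
    refine ⟨γ, hγ, huniq, hder.differentiableWithinAt, hG.differentiableAt, ?_⟩
    rw [hG.fderiv, neg_neg]
    exact hC.hasFDerivAt_boundaryEnergy hH hD hDc ht₂ hc hyr hyc
  · have hyr := (hcol y hy).1
    have hP : ContDiffAt ℝ 1 (fun u : Vec n × Vec n => chartMomentum D t₁ q p u.1) (y, w) :=
      ContDiffAt.comp (f := fun u : Vec n × Vec n => u.1) (y, w) (hC.contDiffAt_chartMomentum hyr)
        contDiffAt_fst
    have hv : ContDiffAt ℝ 1
        (fun u : Vec n × Vec n => velocity H u.1 (chartMomentum D t₁ q p u.1)) (y, w) :=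
      ContDiffAt.comp (f := fun u : Vec n × Vec n => (u.1, chartMomentum D t₁ q p u.1)) (y, w)
        hH.contDiff_velocity.contDiffAt (contDiffAt_fst.prodMk hP)
    exact contDiffAt_const.div (hv.inner ℝ hP)
      (hH.inner_velocity_pos (hC.chartMomentum_ne_zero hH hD hyr)).ne'
  · obtain ⟨hyr, hyc⟩ := hcol y hy
    obtain ⟨hval, γ', -, huniq, hder⟩ := hC.exists_minimizer hH hD hDc ht₂ hc hyr hyc.le
    obtain ⟨hT, hyT, heq⟩ := hC.eqOn_of_isCollarSolution hH hD ht₂ hδd hsol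
    have hTT : T ∈ Icc 0 T := right_mem_Icc.2 hT.1.le
    have hP : p' T = chartMomentum D t₁ q p y := by
      rw [hyT, chartMomentum, hC.chartInv_apply hT hsol.start, (heq T hTT).2]
    have hdq : derivWithin q' (Icc 0 T) T = velocity H y (chartMomentum D t₁ q p y) := by
      have := (hsol.solution T hTT).1.derivWithin (uniqueDiffOn_Icc hT.1 T hTT)
      rw [this, hsol.arrive, hP]
      rfl
    have hdγ : derivWithin γ (Icc 0 1) 0 = derivWithin γ' (Icc 0 1) 0 :=
      derivWithin_congr (huniq γ hmin) (huniq γ hmin (left_mem_Icc.2 zero_le_one))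
    have hw := hC.chartAction_pos hH hD hyr
    rw [hdq, hdγ, hder.derivWithin h01, neg_neg, hval,
      show chartAction H D t₁ q p y ^ 2 / 4 = (chartAction H D t₁ q p y / 2) ^ 2 by ring,
      Real.sqrt_sq (by positivity)]
    congr 1
    ring
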